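/- Manifolds are smooth, Hausdorff, second countable and connected, and $l,m\ge 0$ are integers. An almost contact metric 3-structure on $M$ consists of a Riemannian metric $g$, $(1,1)$-tensors $\phi_\alpha$, vector fields $\xi_\alpha$ and 1-forms $\eta_\alpha$ ($\alpha=1,2,3$) such that $\phi_\alpha^2=-I+\eta_\alpha\otimes\xi_\alpha$, $\eta_\alpha(\xi_\alpha)=1$, $g(\phi_\alpha X,\phi_\alpha Y)=g(X,Y)-\eta_\alpha(X)\eta_\alpha(Y)$ and, for every cyclic permutation $(\alpha,\beta,\gamma)$ of $(1,2,3)$, $\phi_\gamma=\phi_\alpha\phi_\beta-\eta_\beta\otimes\xi_\alpha=-\phi_\beta\phi_\alpha+\eta_\alpha\otimes\xi_\beta$, $\xi_\gamma=\phi_\alpha\xi_\beta=-\phi_\beta\xi_\alpha$, $\eta_\gamma=\eta_\alpha\circ\phi_\beta=-\eta_\beta\circ\phi_\alpha$. Put $\Phi_\alpha(X,Y)=g(X,\phi_\alpha Y)$, and use the convention $d\eta(X,Y)=X\eta(Y)-Y\eta(X)-\eta([X,Y])$. Structure $\alpha$ is normal if $[\phi_\alpha,\phi_\alpha]_{FN}+2d\eta_\alpha\otimes\xi_\alpha=0$,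 where $[\phi,\phi]_{FN}(X,Y)=2(\phi^2[X,Y]+[\phi X,\phi Y]-\phi[\phi X,Y]-\phi[X,\phi Y])$. The 3-structure is 3-quasi-Sasakian if, for each $\alpha$, structure $\alpha$ is normal and $d\Phi_\alpha=0$, and 3-Sasakian if, for each $\alpha$, structure $\alpha$ is normal and $d\eta_\alpha=2\Phi_\alpha$. It has rank $2p+1$ if, for each $\alpha$, $\eta_\alpha\wedge(d\eta_\alpha)^p$ vanishes nowhere and $(d\eta_\alpha)^{p+1}=0$. (1) Let $(M',\phi'_\alpha,\xi'_\alpha,\eta'_\alpha,g')$ be a 3-Sasakian manifold of dimension $4l+3$ and $(M'',J''_\alpha,g'')$ a hyper-Kähler manifold of dimension $4m$. On $M=M'\times M''$ put $g=g'+g''$, $\xi_\alpha=\xi'_\alpha$, $\phi_\alpha=\phi'_\alpha$ on $TM'$, $\phi_\alpha=J''_\alpha$ on $TM''$, and $\eta_\alpha=g(\cdot,\xi_\alpha)$. Then $(M,\phi_\alpha,\xi_\alpha,\eta_\alpha,g)$ is a 3-quasi-Sasakian manifold of rank $4l+3$. (2) Suppose moreover that a finite group $G$ acts on $M'$ by 3-Sasakian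 isometries (isometries preserving all $\phi'_\alpha$ and $\xi'_\alpha$) and on $M''$ by hyper-Kähler isometries (isometries commuting with all $J''_\alpha$), and that the diagonal action of $G$ on $M$ is free. Then $G$ preserves the structure of (1), and $M/G$ is a manifold for which the projection $M\to M/G$ is a local diffeomorphism; $M/G$ carries an induced 3-quasi-Sasakian structure (the projection is isometric on tangent spaces and preserves $\phi_\alpha$ and $\xi_\alpha$), of rank $4l+3$. (3) The unit sphere $S^{4l+3}\subset\mathbb H^{l+1}$, with outer normal $N$, induced metric, $\xi'_\alpha=-J_\alpha N$ and $J_\alpha X=\phi'_\alpha X+\eta'_\alpha(X)N$, where $J_1,J_2,J_3$ are left multiplication by $\mathbf i,\mathbf j,\mathbf k$, is a 3-Sasakian manifold. The torus $\mathbb T^{4m}=\mathbb H^m/\mathbb Z^{4m}$, with the flat metric and the complex structures induced by $J_1,J_2,J_3$, is a hyper-Kähler manifold. Right multiplication by $\mathbf i$ generates an action of $\mathbb Z_4$ on $S^{4l+3}$ by 3-Sasakian isometries and on $\mathbb T^{4m}$ by hyper-Kähler isometries; the diagonal action on $S^{4l+3}\times\mathbb T^{4m}$ is free, and $M_{l,m}=(S^{4l+3}\times\mathbb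 T^{4m})/\mathbb Z_4$, with the structure induced from the product structure of (1), is a compact 3-quasi-Sasakian manifold, of rank $4l+3$. -/

import Mathlib

open Set Bundle Module
open scoped Manifold ContDiff Topology Quaternion RealInnerProductSpace

noncomputable section

namespace ThreeQuasiSasakian

/-! ### Alternating forms on a real vector space -/

section Forms

variable {V : Type*} [AddCommGroup V] [Module ℝ V]

/-- The wedge product of real-valued alternating forms (sum over shuffles). -/
def wedge {k l : ℕ} (a : V [⋀^Fin k]→ₗ[ℝ] ℝ) (b : V [⋀^Fin l]→ₗ[ℝ] ℝ) :
    V [⋀^Fin (k + l)]→ₗ[ℝ] ℝ :=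
  ((LinearMap.mul' ℝ ℝ).compAlternatingMap (a.domCoprod b)).domDomCongr finSumFinEquiv

/-- The `p`-th wedge power of a 2-form. -/
def wedgePow (w : V [⋀^Fin 2]→ₗ[ℝ] ℝ) : (p : ℕ) → V [⋀^Fin (2 * p)]→ₗ[ℝ] ℝ
  | 0 => AlternatingMap.constOfIsEmpty ℝ V (Fin 0) (1 : ℝ)
  | p + 1 => wedge (wedgePow w p) w

end Forms

/-- The 2-form `(u, v) ↦ B u (f v)` when it is alternating. -/
def twoForm {E : Type*} [NormedAddCommGroup E] [NormedSpace ℝ E]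
    (B : E →L[ℝ] E →L[ℝ] ℝ) (f : E →L[ℝ] E) (h : ∀ v, B v (f v) = 0) : E [⋀^Fin 2]→L[ℝ] ℝ where
  toFun v := B (v 0) (f (v 1))
  map_update_add' := by
    intro _ v i x y
    fin_cases i <;> simp
  map_update_smul' := by
    intro _ v i c x
    fin_cases i <;> simp
  cont := by fun_prop
  map_eq_zero_of_eq' := by
    intro v i j hv hij
    have h01 : v 0 = v 1 := by
      fin_cases i <;> fin_cases j <;> simp_all
    simp only [h01, h]

section Manifold

variable {E : Type*} [NormedAddCommGroup E] [NormedSpace ℝ E]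
  {H : Type*} [TopologicalSpace H] (I : ModelWithCorners ℝ E H)
  (M : Type*) [TopologicalSpace M] [ChartedSpace H M]

variable {M} in
/-- The exterior derivative of a differential `n`-form on a manifold: the exterior derivative of
its expression in the preferred chart at `x`, transported back to the tangent space at `x`
(without factors `1 / (n + 1)`, so that `dη(X, Y) = X(η(Y)) - Y(η(X)) - η([X, Y])`). -/
def extDerivM {n : ℕ} (w : (x : M) → TangentSpace I x [⋀^Fin n]→L[ℝ] ℝ) (x : M) :
    TangentSpace I x [⋀^Fin (n + 1)]→L[ℝ] ℝ :=
  (extDerivWithin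
    (fun z : E ↦ ((w ((extChartAt I x).symm z)).compContinuousLinearMap
      (mfderivWithin 𝓘(ℝ, E) I (extChartAt I x).symm (range I) z) : E [⋀^Fin n]→L[ℝ] ℝ))
    (range I) (extChartAt I x x)).compContinuousLinearMap
      (mfderiv I 𝓘(ℝ, E) (extChartAt I x) x : TangentSpace I x →L[ℝ] E)

variable {M} in
/-- The Nijenhuis expression
`φ² [X, Y] + [φ X, φ Y] - φ [φ X, Y] - φ [X, φ Y]` of a field of endomorphisms. -/
def nijenhuis (φ : (x : M) → TangentSpace I x →L[ℝ] TangentSpace I x)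
    (X Y : (x : M) → TangentSpace I x) (x : M) : TangentSpace I x :=
  φ x (φ x (VectorField.mlieBracket I X Y x))
    + VectorField.mlieBracket I (fun y ↦ φ y (X y)) (fun y ↦ φ y (Y y)) x
    - φ x (VectorField.mlieBracket I (fun y ↦ φ y (X y)) Y x)
    - φ x (VectorField.mlieBracket I X (fun y ↦ φ y (Y y)) x)

variable {M} in
/-- A vector field that is smooth near the point `x`. -/
def SmoothFieldAt [IsManifold I ∞ M] (X : (x : M) → TangentSpace I x) (x : M) : Prop :=
  ContMDiffAt I I.tangent ∞ (fun y ↦ (TotalSpace.mk' E y (X y) : TangentBundle I M)) x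

variable {M} in
/-- Smoothness of a field of endomorphisms of the tangent spaces. -/
def SmoothEndo [IsManifold I ∞ M]
    (φ : (x : M) → TangentSpace I x →L[ℝ] TangentSpace I x) : Prop :=
  ContMDiff I (I.prod 𝓘(ℝ, E →L[ℝ] E)) ∞
    (fun x ↦ TotalSpace.mk' (E →L[ℝ] E)
      (E := fun x : M ↦ (TangentSpace I x →L[ℝ] TangentSpace I x)) x (φ x))

variable {M} in
/-- Smoothness of a field of covectors. -/
def SmoothOneForm [IsManifold I ∞ M] (η : (x : M) → TangentSpace I x →L[ℝ] ℝ) : Prop :=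
  ContMDiff I (I.prod 𝓘(ℝ, E →L[ℝ] ℝ)) ∞
    (fun x ↦ TotalSpace.mk' (E →L[ℝ] ℝ)
      (E := fun x : M ↦ (TangentSpace I x →L[ℝ] Bundle.Trivial M ℝ x)) x (η x))

/-- A smooth Riemannian metric on the manifold `M`. -/
abbrev Metric [IsManifold I ∞ M] :=
  ContMDiffRiemannianMetric I ∞ E (fun x : M ↦ TangentSpace I x)

/-! ### Almost contact metric structures -/

/-- An almost contact metric structure `(φ, ξ, η, g)`. -/
structure AlmostContactMetric [IsManifold I ∞ M] where
  metric : Metric I M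
  φ : (x : M) → TangentSpace I x →L[ℝ] TangentSpace I x
  ξ : (x : M) → TangentSpace I x
  η : (x : M) → TangentSpace I x →L[ℝ] ℝ
  smooth_φ : SmoothEndo I φ
  smooth_ξ : ∀ x, SmoothFieldAt I ξ x
  smooth_η : SmoothOneForm I η
  φ_φ : ∀ x v, φ x (φ x v) = -v + η x v • ξ x
  η_ξ : ∀ x, η x (ξ x) = 1
  compatible : ∀ x u v,
    metric.inner x (φ x u) (φ x v) = metric.inner x u v - η x u * η x v

namespace AlmostContactMetric

variable {I M} [IsManifold I ∞ M] (S : AlmostContactMetric I M)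

theorem φ_ξ (x : M) : S.φ x (S.ξ x) = 0 := by
  have h1 : S.φ x (S.φ x (S.ξ x)) = 0 := by rw [S.φ_φ, S.η_ξ]; simp
  have h2 := S.φ_φ x (S.φ x (S.ξ x))
  rw [h1, map_zero] at h2
  have h3 : S.φ x (S.ξ x) = S.η x (S.φ x (S.ξ x)) • S.ξ x := by
    rw [eq_comm, neg_add_eq_zero] at h2; exact h2
  have h4 : S.η x (S.φ x (S.ξ x)) • S.φ x (S.ξ x) = 0 := by
    rw [← map_smul, ← h3, h1]
  rcases smul_eq_zero.1 h4 with h | h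
  · rw [h3, h, zero_smul]
  · exact h

theorem η_φ (x : M) (v : TangentSpace I x) : S.η x (S.φ x v) = 0 := by
  have h1 := S.φ_φ x (S.φ x v)
  rw [S.φ_φ x v, map_add, map_neg, map_smul, φ_ξ, smul_zero, add_zero, left_eq_add] at h1
  have h2 := congrArg (S.η x) h1
  rwa [map_smul, S.η_ξ, map_zero, smul_eq_mul, mul_one] at h2

theorem metric_φ_self (x : M) (v : TangentSpace I x) : S.metric.inner x v (S.φ x v) = 0 := by
  have hη : S.metric.inner x (S.φ x v) (S.ξ x) = 0 := by
    have := S.compatible x (S.φ x v) (S.ξ x)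
    rw [φ_ξ, map_zero, η_φ, zero_mul, sub_zero] at this
    exact this.symm
  have h := S.compatible x v (S.φ x v)
  rw [S.φ_φ x v, η_φ, mul_zero, sub_zero, map_add, map_neg, map_smul, hη, smul_zero, add_zero,
    S.metric.symm] at h
  linarith

/-- The fundamental 2-form `Φ(u, v) = g(u, φ v)`. -/
def fundamentalForm (x : M) : TangentSpace I x [⋀^Fin 2]→L[ℝ] ℝ :=
  twoForm (E := E) (S.metric.inner x) (S.φ x) (S.metric_φ_self x)

/-- The 1-form `η`, as an alternating form of degree one. -/
def ηForm (x : M) : TangentSpace I x [⋀^Fin 1]→L[ℝ] ℝ :=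
  ContinuousAlternatingMap.ofSubsingleton ℝ (TangentSpace I x) ℝ (0 : Fin 1) (S.η x)

/-- The 2-form `dη`. -/
def dη (x : M) : TangentSpace I x [⋀^Fin 2]→L[ℝ] ℝ :=
  extDerivM I S.ηForm x

/-- Normality: `[φ, φ] + 2 dη ⊗ ξ = 0`, where `[φ, φ]` is the Frölicher-Nijenhuis bracket, that is,
twice the Nijenhuis expression. -/
def IsNormal : Prop :=
  ∀ (x : M) (X Y : (x : M) → TangentSpace I x), SmoothFieldAt I X x → SmoothFieldAt I Y x →
    (2 : ℝ) • nijenhuis I S.φ X Y x + (2 * S.dη x ![X x, Y x]) • S.ξ x = 0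

/-- Quasi-Sasakian: normal with closed fundamental 2-form. -/
def IsQuasiSasakian : Prop :=
  S.IsNormal ∧ ∀ x, extDerivM I S.fundamentalForm x = 0

/-- Sasakian: normal with `dη = 2 Φ`. -/
def IsSasakian : Prop :=
  S.IsNormal ∧ ∀ x, S.dη x = (2 : ℝ) • S.fundamentalForm x

/-- The structure has (constant) rank `r`: either `r = 2 p`, `(dη)^p` vanishes nowhere and
`η ∧ (dη)^p = 0`, or `r = 2 p + 1`, `η ∧ (dη)^p` vanishes nowhere and `(dη)^(p+1) = 0`. -/
def HasRank (r : ℕ) : Prop :=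
  ∃ p : ℕ,
    (r = 2 * p ∧ ∀ x : M, wedgePow (S.dη x).toAlternatingMap p ≠ 0 ∧
      wedge (S.ηForm x).toAlternatingMap (wedgePow (S.dη x).toAlternatingMap p) = 0) ∨
    (r = 2 * p + 1 ∧ ∀ x : M,
      wedge (S.ηForm x).toAlternatingMap (wedgePow (S.dη x).toAlternatingMap p) ≠ 0 ∧
      wedgePow (S.dη x).toAlternatingMap (p + 1) = 0)

end AlmostContactMetric

/-! ### Almost contact metric 3-structures -/

/-- An almost contact metric 3-structure: three almost contact metric structures with the same
metric satisfying the quaternionic-like relations, for `(a, b, c) = (a, a + 1, a + 2)` a cyclic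
permutation of the three indices. -/
structure AlmostContactMetric3 [IsManifold I ∞ M] where
  metric : Metric I M
  φ : Fin 3 → (x : M) → TangentSpace I x →L[ℝ] TangentSpace I x
  ξ : Fin 3 → (x : M) → TangentSpace I x
  η : Fin 3 → (x : M) → TangentSpace I x →L[ℝ] ℝ
  smooth_φ : ∀ a, SmoothEndo I (φ a)
  smooth_ξ : ∀ a x, SmoothFieldAt I (ξ a) x
  smooth_η : ∀ a, SmoothOneForm I (η a)
  φ_φ_self : ∀ a x v, φ a x (φ a x v) = -v + η a x v • ξ a x
  η_ξ_self : ∀ a x, η a x (ξ a x) = 1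
  compatible : ∀ a x u v,
    metric.inner x (φ a x u) (φ a x v) = metric.inner x u v - η a x u * η a x v
  φ_eq : ∀ a x v, φ (a + 2) x v = φ a x (φ (a + 1) x v) - η (a + 1) x v • ξ a x
  φ_eq' : ∀ a x v, φ (a + 2) x v = -φ (a + 1) x (φ a x v) + η a x v • ξ (a + 1) x
  ξ_eq : ∀ a x, ξ (a + 2) x = φ a x (ξ (a + 1) x)
  ξ_eq' : ∀ a x, ξ (a + 2) x = -φ (a + 1) x (ξ a x)
  η_eq : ∀ a x v, η (a + 2) x v = η a x (φ (a + 1) x v)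
  η_eq' : ∀ a x v, η (a + 2) x v = -η (a + 1) x (φ a x v)

namespace AlmostContactMetric3

variable {I M} [IsManifold I ∞ M] (S : AlmostContactMetric3 I M)

/-- The three almost contact metric structures of a 3-structure. -/
def component (a : Fin 3) : AlmostContactMetric I M where
  metric := S.metric
  φ := S.φ a
  ξ := S.ξ a
  η := S.η a
  smooth_φ := S.smooth_φ a
  smooth_ξ := S.smooth_ξ a
  smooth_η := S.smooth_η a
  φ_φ := S.φ_φ_self a
  η_ξ := S.η_ξ_self a
  compatible := S.compatible a

/-- A quasi-Sasakian 3-structure. -/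
def IsThreeQuasiSasakian : Prop := ∀ a, (S.component a).IsQuasiSasakian

/-- A Sasakian 3-structure. -/
def IsThreeSasakian : Prop := ∀ a, (S.component a).IsSasakian

/-- The common rank of the three structures is `r`. -/
def HasRank (r : ℕ) : Prop := ∀ a, (S.component a).HasRank r

/-- A smooth map which is isometric on tangent spaces and carries `φ_a`, `ξ_a` to `φ_a`, `ξ_a`. -/
structure IsStructureMap {N : Type*} [TopologicalSpace N] [ChartedSpace H N] [IsManifold I ∞ N]
    (S : AlmostContactMetric3 I M) (T : AlmostContactMetric3 I N) (f : M → N) : Prop where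
  contMDiff : ContMDiff I I ∞ f
  metric : ∀ x u v,
    T.metric.inner (f x) (mfderiv I I f x u) (mfderiv I I f x v) = S.metric.inner x u v
  φ : ∀ a x u, mfderiv I I f x (S.φ a x u) = T.φ a (f x) (mfderiv I I f x u)
  ξ : ∀ a x, mfderiv I I f x (S.ξ a x) = T.ξ a (f x)

end AlmostContactMetric3

/-! ### Hyper-Kähler structures -/

/-- An almost hyper-Hermitian structure `(J_1, J_2, J_3, g)`. -/
structure AlmostHyperHermitian [IsManifold I ∞ M] where
  metric : Metric I M
  J : Fin 3 → (x : M) → TangentSpace I x →L[ℝ] TangentSpace I x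
  smooth_J : ∀ a, SmoothEndo I (J a)
  J_J_self : ∀ a x v, J a x (J a x v) = -v
  compatible : ∀ a x u v, metric.inner x (J a x u) (J a x v) = metric.inner x u v
  J_eq : ∀ a x v, J (a + 2) x v = J a x (J (a + 1) x v)
  J_eq' : ∀ a x v, J (a + 2) x v = -J (a + 1) x (J a x v)

namespace AlmostHyperHermitian

variable {I M} [IsManifold I ∞ M] (K : AlmostHyperHermitian I M)

theorem metric_J_self (a : Fin 3) (x : M) (v : TangentSpace I x) :
    K.metric.inner x v (K.J a x v) = 0 := by
  have h := K.compatible a x v (K.J a x v)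
  rw [K.J_J_self, map_neg, K.metric.symm] at h
  linarith

/-- The fundamental 2-forms `Ω_a(u, v) = g(u, J_a v)`. -/
def fundamentalForm (a : Fin 3) (x : M) : TangentSpace I x [⋀^Fin 2]→L[ℝ] ℝ :=
  twoForm (E := E) (K.metric.inner x) (K.J a x) (K.metric_J_self a x)

/-- Hyper-Kähler: each `J_a` is integrable and each `Ω_a` is closed, that is, each
`(J_a, g)` is a Kähler structure. -/
def IsHyperKahler : Prop :=
  ∀ a, (∀ (x : M) (X Y : (x : M) → TangentSpace I x),
      SmoothFieldAt I X x → SmoothFieldAt I Y x → nijenhuis I (K.J a) X Y x = 0) ∧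
    ∀ x, extDerivM I (K.fundamentalForm a) x = 0

/-- A smooth map which is isometric on tangent spaces and commutes with the `J_a`. -/
structure IsStructureMap {N : Type*} [TopologicalSpace N] [ChartedSpace H N] [IsManifold I ∞ N]
    (K : AlmostHyperHermitian I M) (L : AlmostHyperHermitian I N) (f : M → N) : Prop where
  contMDiff : ContMDiff I I ∞ f
  metric : ∀ x u v,
    L.metric.inner (f x) (mfderiv I I f x u) (mfderiv I I f x v) = K.metric.inner x u v
  J : ∀ a x u, mfderiv I I f x (K.J a x u) = L.J a (f x) (mfderiv I I f x u)

end AlmostHyperHermitian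

end Manifold

/-! ### The product structure -/

section Product

variable {E' : Type*} [NormedAddCommGroup E'] [NormedSpace ℝ E']
  {H' : Type*} [TopologicalSpace H'] {I' : ModelWithCorners ℝ E' H'}
  {M' : Type*} [TopologicalSpace M'] [ChartedSpace H' M'] [IsManifold I' ∞ M']
  {E'' : Type*} [NormedAddCommGroup E''] [NormedSpace ℝ E'']
  {H'' : Type*} [TopologicalSpace H''] {I'' : ModelWithCorners ℝ E'' H''}
  {M'' : Type*} [TopologicalSpace M''] [ChartedSpace H'' M''] [IsManifold I'' ∞ M'']

/-- `S` is the canonical structure on `M' × M''`: `g = g' + g''`, `ξ_a = ξ'_a` (tangent to the first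
factor), `φ_a = φ'_a` on `TM'` and `φ_a = J''_a` on `TM''`, and `η_a = g(·, ξ_a)`.
Tangent vectors of the product are described by their two projections. -/
structure IsProductStructure (S' : AlmostContactMetric3 I' M') (K : AlmostHyperHermitian I'' M'')
    (S : AlmostContactMetric3 (I'.prod I'') (M' × M'')) : Prop where
  metric : ∀ p u v, S.metric.inner p u v =
    S'.metric.inner p.1 (mfderiv (I'.prod I'') I' Prod.fst p u)
        (mfderiv (I'.prod I'') I' Prod.fst p v)
      + K.metric.inner p.2 (mfderiv (I'.prod I'') I'' Prod.snd p u)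
        (mfderiv (I'.prod I'') I'' Prod.snd p v)
  ξ_fst : ∀ a p, mfderiv (I'.prod I'') I' Prod.fst p (S.ξ a p) = S'.ξ a p.1
  ξ_snd : ∀ a p, mfderiv (I'.prod I'') I'' Prod.snd p (S.ξ a p) = 0
  φ_fst : ∀ a p u, mfderiv (I'.prod I'') I' Prod.fst p (S.φ a p u) =
    S'.φ a p.1 (mfderiv (I'.prod I'') I' Prod.fst p u)
  φ_snd : ∀ a p u, mfderiv (I'.prod I'') I'' Prod.snd p (S.φ a p u) =
    K.J a p.2 (mfderiv (I'.prod I'') I'' Prod.snd p u)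
  η : ∀ a p u, S.η a p u = S.metric.inner p u (S.ξ a p)

end Product

/-! ### Quotients -/

section Quotient

variable {E : Type*} [NormedAddCommGroup E] [NormedSpace ℝ E]
  {H : Type*} [TopologicalSpace H] {I : ModelWithCorners ℝ E H}
  {M : Type*} [TopologicalSpace M] [ChartedSpace H M] [IsManifold I ∞ M]

/-- The orbit space `M / G`, with the quotient topology, is a (Hausdorff, second countable,
connected) smooth manifold whose projection is a local diffeomorphism (which determines the smooth
structure), and it carries a 3-quasi-Sasakian structure of rank `r` induced by `S`, that is,
such that the projection preserves metric, `φ_a` and `ξ_a`. -/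
def QuotientIsThreeQuasiSasakian (G : Type*) [Group G] [MulAction G M]
    (S : AlmostContactMetric3 I M) (r : ℕ) : Prop :=
  T2Space (MulAction.orbitRel.Quotient G M) ∧
  SecondCountableTopology (MulAction.orbitRel.Quotient G M) ∧
  ConnectedSpace (MulAction.orbitRel.Quotient G M) ∧
  ∃ (_ : ChartedSpace H (MulAction.orbitRel.Quotient G M))
    (_ : IsManifold I ∞ (MulAction.orbitRel.Quotient G M)),
    IsLocalDiffeomorph I I ∞
      (Quotient.mk (MulAction.orbitRel G M) : M → MulAction.orbitRel.Quotient G M) ∧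
    ∃ T : AlmostContactMetric3 I (MulAction.orbitRel.Quotient G M),
      S.IsStructureMap T
        (Quotient.mk (MulAction.orbitRel G M) : M → MulAction.orbitRel.Quotient G M) ∧
      T.IsThreeQuasiSasakian ∧ T.HasRank r

end Quotient

/-! ### The quaternionic space, the sphere and the torus -/

/-- The imaginary units `i, j, k`. -/
def imUnit : Fin 3 → ℍ[ℝ] := ![⟨0, 1, 0, 0⟩, ⟨0, 0, 1, 0⟩, ⟨0, 0, 0, 1⟩]

theorem imUnit_zero_re : (imUnit 0).re = 0 := rfl

theorem imUnit_zero_imI : (imUnit 0).imI = 1 := rfl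

theorem imUnit_zero_imJ : (imUnit 0).imJ = 0 := rfl

theorem imUnit_zero_imK : (imUnit 0).imK = 0 := rfl

/-- The space `ℍⁿ` with its Euclidean norm; `q • v` is multiplication on the left. -/
abbrev QSpace (n : ℕ) := PiLp 2 (fun _ : Fin n ↦ ℍ[ℝ])

theorem finrank_qSpace (n : ℕ) : finrank ℝ (QSpace n) = 4 * n := by
  rw [(WithLp.linearEquiv 2 ℝ (Fin n → ℍ[ℝ])).finrank_eq, finrank_pi_fintype]
  simp [Quaternion.finrank_eq_four, mul_comm]

instance fact_finrank_qSpace (l : ℕ) : Fact (finrank ℝ (QSpace (l + 1)) = (4 * l + 3) + 1) :=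
  ⟨by rw [finrank_qSpace]; ring⟩

/-- The unit sphere `S^{4l+3}` of `ℍ^{l+1}`. -/
abbrev QSphere (l : ℕ) := Metric.sphere (0 : QSpace (l + 1)) 1

/-- The group `ℤ/4`, written multiplicatively. -/
abbrev Z4 := Multiplicative (ZMod 4)

/-- The quaternion `i^a`, for `a` in `ℤ/4`. -/
def iPow (a : Z4) : ℍ[ℝ] := imUnit 0 ^ (Multiplicative.toAdd a).val

theorem imUnit_zero_pow_four : imUnit 0 ^ 4 = 1 := by
  have h : imUnit 0 * imUnit 0 = -1 := by
    ext <;> simp [imUnit_zero_re, imUnit_zero_imI, imUnit_zero_imJ, imUnit_zero_imK]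
  rw [show (4 : ℕ) = 2 + 2 from rfl, pow_add, pow_two, h]; simp

theorem iPow_one : iPow 1 = 1 := by simp [iPow]

theorem iPow_mul (a b : Z4) : iPow (a * b) = iPow a * iPow b := by
  unfold iPow
  rw [toAdd_mul, ZMod.val_add, ← pow_add]
  exact (pow_eq_pow_mod _ imUnit_zero_pow_four).symm

theorem norm_iPow (a : Z4) : ‖iPow a‖ = 1 := by
  have h : ‖imUnit 0‖ = 1 := by
    have := congrArg norm imUnit_zero_pow_four
    rw [norm_pow, norm_one] at this
    exact (pow_eq_one_iff_of_nonneg (norm_nonneg _) (by norm_num)).1 this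
  rw [iPow, norm_pow, h, one_pow]

/-- The generator of `ℤ/4` acts on `ℍⁿ` by multiplication with `i` on the right. -/
instance qSpaceAction (n : ℕ) : DistribMulAction Z4 (QSpace n) where
  smul a v := WithLp.toLp 2 (fun s ↦ v s * iPow a)
  one_smul v := by
    change WithLp.toLp 2 (fun s ↦ v s * iPow 1) = v
    simp [iPow_one]
  mul_smul a b v := by
    change WithLp.toLp 2 (fun s ↦ v s * iPow (a * b)) =
      WithLp.toLp 2 (fun s ↦ (v s * iPow b) * iPow a)
    simp [mul_comm a b, iPow_mul, mul_assoc]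
  smul_zero a := by
    change WithLp.toLp 2 (fun s ↦ (0 : QSpace n) s * iPow a) = 0
    ext <;> simp
  smul_add a v w := by
    change WithLp.toLp 2 (fun s ↦ (v + w) s * iPow a) =
      WithLp.toLp 2 (fun s ↦ v s * iPow a) + WithLp.toLp 2 (fun s ↦ w s * iPow a)
    ext s <;> simp [add_mul]

theorem z4_smul_apply {n : ℕ} (a : Z4) (v : QSpace n) (s : Fin n) : (a • v) s = v s * iPow a :=
  rfl

theorem norm_z4_smul {n : ℕ} (a : Z4) (v : QSpace n) : ‖a • v‖ = ‖v‖ := by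
  simp [PiLp.norm_eq_of_L2, z4_smul_apply, norm_iPow]

/-- The induced action of `ℤ/4` on the sphere. -/
instance qSphereAction (l : ℕ) : MulAction Z4 (QSphere l) where
  smul a x := ⟨a • (x : QSpace (l + 1)), by
    rw [mem_sphere_zero_iff_norm, norm_z4_smul]; exact mem_sphere_zero_iff_norm.1 x.2⟩
  one_smul x := Subtype.ext (one_smul Z4 (x : QSpace (l + 1)))
  mul_smul a b x := Subtype.ext (mul_smul a b (x : QSpace (l + 1)))

/-- The additive group of the quaternions with integer coordinates. -/
def intQuaternions : AddSubgroup ℍ[ℝ] where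
  carrier := {q | ∃ a b c d : ℤ, q.re = a ∧ q.imI = b ∧ q.imJ = c ∧ q.imK = d}
  zero_mem' := ⟨0, 0, 0, 0, by simp⟩
  add_mem' := by
    rintro p q ⟨a, b, c, d, h1, h2, h3, h4⟩ ⟨a', b', c', d', h1', h2', h3', h4'⟩
    exact ⟨a + a', b + b', c + c', d + d', by simp [*]⟩
  neg_mem' := by
    rintro q ⟨a, b, c, d, h1, h2, h3, h4⟩
    exact ⟨-a, -b, -c, -d, by simp [*]⟩

/-- The lattice `ℤ^{4m}` of the vectors of `ℍᵐ` with integer coordinates. -/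
def intLattice (m : ℕ) : AddSubgroup (QSpace m) where
  carrier := {v | ∀ s, v s ∈ intQuaternions}
  zero_mem' := fun _ ↦ intQuaternions.zero_mem
  add_mem' := fun hv hw s ↦ intQuaternions.add_mem (hv s) (hw s)
  neg_mem' := fun hv s ↦ intQuaternions.neg_mem (hv s)

/-- The torus `T^{4m} = ℍᵐ / ℤ^{4m}`. -/
abbrev QTorus (m : ℕ) := QSpace m ⧸ intLattice m

theorem intQuaternions_eq_zero {q : ℍ[ℝ]} (hq : q ∈ intQuaternions) (h : ‖q‖ < 1) : q = 0 := by
  obtain ⟨a, b, c, d, ha, hb, hc, hd⟩ := hq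
  have h1 := Quaternion.normSq_eq_norm_mul_self q
  rw [Quaternion.normSq_def', ha, hb, hc, hd] at h1
  have h2 : ((a ^ 2 + b ^ 2 + c ^ 2 + d ^ 2 : ℤ) : ℝ) < 1 := by
    push_cast
    rw [h1]
    nlinarith [norm_nonneg q]
  have h3 : a ^ 2 + b ^ 2 + c ^ 2 + d ^ 2 < 1 := by exact_mod_cast h2
  have ha0 : a = 0 := by
    have : a ^ 2 = 0 := by nlinarith [sq_nonneg a, sq_nonneg b, sq_nonneg c, sq_nonneg d]
    simpa using this
  have hb0 : b = 0 := by
    have : b ^ 2 = 0 := by nlinarith [sq_nonneg a, sq_nonneg b, sq_nonneg c, sq_nonneg d]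
    simpa using this
  have hc0 : c = 0 := by
    have : c ^ 2 = 0 := by nlinarith [sq_nonneg a, sq_nonneg b, sq_nonneg c, sq_nonneg d]
    simpa using this
  have hd0 : d = 0 := by
    have : d ^ 2 = 0 := by nlinarith [sq_nonneg a, sq_nonneg b, sq_nonneg c, sq_nonneg d]
    simpa using this
  ext <;> simp [*]

theorem isDiscrete_intLattice (m : ℕ) : IsDiscrete (intLattice m : Set (QSpace m)) := by
  refine ⟨discreteTopology_of_isOpen_singleton_zero ?_⟩
  rw [Metric.isOpen_singleton_iff]
  refine ⟨1, one_pos, fun v hv ↦ Subtype.ext ?_⟩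
  rw [dist_zero_right] at hv
  ext1 s
  exact intQuaternions_eq_zero (v.2 s) (lt_of_le_of_lt (PiLp.norm_apply_le (v : QSpace m) s) hv)

/-- The manifold structure of the torus: its charts are the local inverses of the projection. -/
instance qTorusChartedSpace (m : ℕ) : ChartedSpace (QSpace m) (QTorus m) :=
  ((intLattice m).isAddQuotientCoveringMap_of_comm
    (isDiscrete_intLattice m)).isCoveringMap.isLocalHomeomorph.chartedSpace
      (QuotientAddGroup.mk_surjective (s := intLattice m))

theorem mul_imUnit_zero_mem {q : ℍ[ℝ]} (hq : q ∈ intQuaternions) : q * imUnit 0 ∈ intQuaternions := by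
  obtain ⟨a, b, c, d, ha, hb, hc, hd⟩ := hq
  exact ⟨-b, a, d, -c, by
    simp [ha, hb, hc, hd, imUnit_zero_re, imUnit_zero_imI, imUnit_zero_imJ, imUnit_zero_imK]⟩

theorem smul_mem_intLattice {m : ℕ} (a : Z4) {v : QSpace m} (hv : v ∈ intLattice m) :
    a • v ∈ intLattice m := by
  intro s
  rw [z4_smul_apply, iPow]
  induction (Multiplicative.toAdd a).val with
  | zero => simpa using hv s
  | succ k ih => rw [pow_succ, ← mul_assoc]; exact mul_imUnit_zero_mem ih

/-- The induced action of `ℤ/4` on the torus. -/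
instance qTorusAction (m : ℕ) : MulAction Z4 (QTorus m) where
  smul a := QuotientAddGroup.map (intLattice m) (intLattice m)
    (DistribSMul.toAddMonoidHom (QSpace m) a) (fun _ hv ↦ smul_mem_intLattice a hv)
  one_smul t := by
    induction t using QuotientAddGroup.induction_on with
    | H v => exact congrArg (QuotientAddGroup.mk (s := intLattice m)) (one_smul Z4 v)
  mul_smul a b t := by
    induction t using QuotientAddGroup.induction_on with
    | H v => exact congrArg (QuotientAddGroup.mk (s := intLattice m)) (mul_smul a b v)

/-- The standard structure of the sphere, with `N x = x` the outer normal, `ι` the inclusion and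
`J_a` the multiplication with `i, j, k` on the left: `g` is induced by `ι`, `ξ_a = -J_a N` and
`J_a X = φ_a X + η_a(X) N`. -/
structure IsStandardSphereStructure {l : ℕ}
    (S : AlmostContactMetric3 (𝓡 (4 * l + 3)) (QSphere l)) : Prop where
  metric : ∀ x u v, S.metric.inner x u v =
    ⟪mvfderiv (𝓡 (4 * l + 3)) (fun y : QSphere l ↦ (y : QSpace (l + 1))) x u,
      mvfderiv (𝓡 (4 * l + 3)) (fun y : QSphere l ↦ (y : QSpace (l + 1))) x v⟫
  ξ : ∀ a x, mvfderiv (𝓡 (4 * l + 3)) (fun y : QSphere l ↦ (y : QSpace (l + 1))) x (S.ξ a x) =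
    -(imUnit a • (x : QSpace (l + 1)))
  φ_η : ∀ a x u,
    imUnit a • mvfderiv (𝓡 (4 * l + 3)) (fun y : QSphere l ↦ (y : QSpace (l + 1))) x u =
      mvfderiv (𝓡 (4 * l + 3)) (fun y : QSphere l ↦ (y : QSpace (l + 1))) x (S.φ a x u)
        + S.η a x u • (x : QSpace (l + 1))

/-- The standard flat structure of the torus: the projection `ℍᵐ → T^{4m}` carries the Euclidean
metric to `g` and the multiplications with `i, j, k` on the left to `J_1, J_2, J_3`. -/
structure IsStandardTorusStructure {m : ℕ} [IsManifold 𝓘(ℝ, QSpace m) ∞ (QTorus m)]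
    (K : AlmostHyperHermitian 𝓘(ℝ, QSpace m) (QTorus m)) : Prop where
  metric : ∀ v u w : QSpace m, K.metric.inner (QuotientAddGroup.mk v)
      (mfderiv 𝓘(ℝ, QSpace m) 𝓘(ℝ, QSpace m) (QuotientAddGroup.mk (s := intLattice m)) v u)
      (mfderiv 𝓘(ℝ, QSpace m) 𝓘(ℝ, QSpace m) (QuotientAddGroup.mk (s := intLattice m)) v w) =
    ⟪u, w⟫
  J : ∀ (a : Fin 3) (v u : QSpace m), K.J a (QuotientAddGroup.mk v)
      (mfderiv 𝓘(ℝ, QSpace m) 𝓘(ℝ, QSpace m) (QuotientAddGroup.mk (s := intLattice m)) v u) =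
    mfderiv 𝓘(ℝ, QSpace m) 𝓘(ℝ, QSpace m) (QuotientAddGroup.mk (s := intLattice m)) v
      (imUnit a • u : QSpace m)

end ThreeQuasiSasakian

end

/-!
Every statement about a tensor field is reduced to a statement about maps between vector spaces by
reading the field in the preferred chart at the point in question. In such a chart the Nijenhuis
tensor of a field of endomorphisms and the exterior derivative of a form are given by first
derivatives of the coordinate expressions (`nijenhuis_eq_nijAt`, `extDerivM_eq`), and they are
natural: a smooth map whose derivative intertwines two fields of endomorphisms carries the
Nijenhuis tensor of one to that of the other (`mfderiv_nijAt`), and `d` commutes with pullback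
(`extDerivM_pullForm`). Normality, closedness and rank can therefore be transported along the two
projections of a product and along a local diffeomorphism.

A 3-Sasakian structure is 3-quasi-Sasakian, since `Φ = ½ dη` is closed. Its rank is the dimension:
in an orthonormal frame `ξ, eᵢ, φ eᵢ` the form `dη = 2Φ` is in normal form, and expanding
`η ∧ (dη)^p` over permutations leaves only contributions of one sign (`wedge_wedgePow_ne_zero`,
`AlmostContactMetric.IsSasakian.rank`).

On a product, a tangent vector is determined by its two projections. These carry the Nijenhuis
tensor of `φ_a` to those of `φ'_a` and `J''_a`, and `dη_a` is the pullback of `dη'_a` because `ξ_a`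
is tangent to the first factor; `Φ_a` is the sum of the pullbacks of `Φ'_a` and of the Kähler form.
Hence normality, `dΦ_a = 0` and the rank are those of the factors
(`IsProductStructure.isThreeQuasiSasakian`, `IsProductStructure.hasRank`).

For a local homeomorphism whose fibres are orbits of smooth maps commuting with it, local sections
transport the charts of the source to the target, which becomes a manifold such that the map is a
local diffeomorphism (`isManifold_chartedSpaceOfRightInverse`). Tensor fields invariant under these
maps descend, and so do all the identities between them (`AlmostContactMetric3.exists_descend`,
`AlmostHyperHermitian.exists_descend`). A free action of a finite group of structure maps has a
covering projection to which this applies (`quotientIsThreeQuasiSasakian`); the projection of `ℍᵐ`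
to the torus is another instance, and the flat structure of `ℍᵐ`, whose tensors are constant,
descends to the hyper-Kähler structure of the torus (`exists_torusStructure`).

The tensors of the sphere are obtained by splitting `J_a` along the sphere into its tangential and
normal parts, `J_a ∘ dF = dF ∘ φ_a + η_a ⊗ F` for the inclusion `F`, which is its own normal.
Differentiating this relation, and `η_a = ⟪F, J_a dF⟫`, yields normality and `dη_a = 2Φ_a`, the
terms with `d²F` being symmetric (`fderiv_nijTensor_hypersurface`, `fderiv_contactForm`). Right
multiplication by `i` is an isometry which commutes with the left multiplications `J_a` and
preserves the lattice, hence acts on the sphere and on the torus by structure maps. It is free on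
the sphere because a nonzero quaternion can be cancelled (`eq_one_of_smul_eq_self`), and therefore
the diagonal action on the product is free as well.
-/

noncomputable section

namespace ThreeQuasiSasakian

/-! ### Wedge products of alternating forms -/

section Wedge

variable {V W : Type*} [AddCommGroup V] [Module ℝ V] [AddCommGroup W] [Module ℝ W]

theorem wedge_compLinearMap {k l : ℕ} (a : V [⋀^Fin k]→ₗ[ℝ] ℝ) (b : V [⋀^Fin l]→ₗ[ℝ] ℝ)
    (f : W →ₗ[ℝ] V) :
    wedge (a.compLinearMap f) (b.compLinearMap f) = (wedge a b).compLinearMap f := by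
  ext v
  simp only [wedge, AlternatingMap.domDomCongr_apply, LinearMap.compAlternatingMap_apply,
    AlternatingMap.compLinearMap_apply, AlternatingMap.domCoprod_apply]
  congr 1
  rw [sum_apply, sum_apply]
  refine Finset.sum_congr rfl fun σ _ ↦ ?_
  induction σ using Quotient.inductionOn'
  rfl

theorem wedgePow_compLinearMap (w : V [⋀^Fin 2]→ₗ[ℝ] ℝ) (f : W →ₗ[ℝ] V) (p : ℕ) :
    wedgePow (w.compLinearMap f) p = (wedgePow w p).compLinearMap f := by
  induction p with
  | zero => ext v; simp [wedgePow]
  | succ p ih => rw [wedgePow, ih, wedge_compLinearMap, wedgePow]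

/-- The tensor product of real-valued multilinear forms. -/
def multilinearMul {k l : ℕ} (a : MultilinearMap ℝ (fun _ : Fin k ↦ V) ℝ)
    (b : MultilinearMap ℝ (fun _ : Fin l ↦ V) ℝ) : MultilinearMap ℝ (fun _ : Fin (k + l) ↦ V) ℝ :=
  ((LinearMap.mul' ℝ ℝ).compMultilinearMap (a.domCoprod b)).domDomCongr finSumFinEquiv

theorem multilinearMul_apply {k l : ℕ} (a : MultilinearMap ℝ (fun _ : Fin k ↦ V) ℝ)
    (b : MultilinearMap ℝ (fun _ : Fin l ↦ V) ℝ) (v : Fin (k + l) → V) :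
    multilinearMul a b v = a (fun i ↦ v (Fin.castAdd l i)) * b (fun i ↦ v (Fin.natAdd k i)) := by
  simp [multilinearMul]

theorem wedge_alternatization {k l : ℕ} (a : MultilinearMap ℝ (fun _ : Fin k ↦ V) ℝ)
    (b : MultilinearMap ℝ (fun _ : Fin l ↦ V) ℝ) :
    wedge (MultilinearMap.alternatization a) (MultilinearMap.alternatization b) =
      MultilinearMap.alternatization (multilinearMul a b) := by
  ext v
  rw [wedge, ← MultilinearMap.domCoprod_alternization]
  simp only [AlternatingMap.domDomCongr_apply, LinearMap.compAlternatingMap_apply,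
    MultilinearMap.alternatization_apply, map_sum, multilinearMul]
  refine Fintype.sum_equiv (finSumFinEquiv.permCongr) _ _ fun σ ↦ ?_
  rw [Units.smul_def, Units.smul_def, map_zsmul, Equiv.Perm.sign_permCongr]
  congr 1
  simp

/-- The `p`-th tensor power of a bilinear form. -/
def bilinearPow (b : MultilinearMap ℝ (fun _ : Fin 2 ↦ V) ℝ) :
    (p : ℕ) → MultilinearMap ℝ (fun _ : Fin (2 * p) ↦ V) ℝ
  | 0 => MultilinearMap.constOfIsEmpty ℝ (fun _ : Fin 0 ↦ V) (1 : ℝ)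
  | p + 1 => multilinearMul (bilinearPow b p) b

theorem bilinearPow_apply (b : MultilinearMap ℝ (fun _ : Fin 2 ↦ V) ℝ) (p : ℕ)
    (v : Fin (2 * p) → V) :
    bilinearPow b p v = ∏ i : Fin p, b ![v ⟨2 * i, by omega⟩, v ⟨2 * i + 1, by omega⟩] := by
  induction p with
  | zero => simp [bilinearPow]
  | succ p ih =>
    rw [bilinearPow, multilinearMul_apply, ih, Fin.prod_univ_castSucc]
    congr 2
    funext i
    fin_cases i <;> rfl

theorem wedgePow_alternatization (b : MultilinearMap ℝ (fun _ : Fin 2 ↦ V) ℝ) (p : ℕ) :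
    wedgePow (MultilinearMap.alternatization b) p =
      MultilinearMap.alternatization (bilinearPow b p) := by
  induction p with
  | zero =>
    ext v
    simp [wedgePow, bilinearPow, MultilinearMap.alternatization_apply]
  | succ p ih => rw [wedgePow, ih, wedge_alternatization, bilinearPow]

theorem alternatingForm_eq_zero_of_finrank_lt [FiniteDimensional ℝ V] {n : ℕ}
    (a : V [⋀^Fin n]→ₗ[ℝ] ℝ) (h : finrank ℝ V < n) : a = 0 := by
  ext v
  refine a.map_linearDependent v fun hv ↦ ?_
  have := hv.fintype_card_le_finrank
  simp at this
  omega

/-- The labels of a basis `ξ, eᵢ, fᵢ` of a space of dimension `2 p + 1`. -/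
abbrev PairIndex (p : ℕ) := Unit ⊕ Fin 2 × Fin p

/-- Nonvanishing criterion: if `w` is in normal form `c ∑ᵢ eᵢ* ∧ fᵢ*` on the span of `ξ, eᵢ, fᵢ`,
and `η = ξ*` there, then `η ∧ w^p` does not vanish. Pulled back to the span, `w` is the
alternatization of the bilinear form `c ∑ᵢ eᵢ* ⊗ fᵢ*`, so that the value of `η ∧ w^p` on the basis
is a signed sum over permutations; only those which permute the pairs `(eᵢ, fᵢ)` contribute, and
these are even. -/
theorem wedge_wedgePow_ne_zero (η : V [⋀^Fin 1]→ₗ[ℝ] ℝ) (w : V [⋀^Fin 2]→ₗ[ℝ] ℝ) {p : ℕ} (ξ : V)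
    (e f : Fin p → V) {c : ℝ} (hc : 0 < c) (hξ : η ![ξ] = 1) (he : ∀ i, η ![e i] = 0)
    (hf : ∀ i, η ![f i] = 0) (hξe : ∀ i, w ![ξ, e i] = 0) (hξf : ∀ i, w ![ξ, f i] = 0)
    (hee : ∀ i j, w ![e i, e j] = 0) (hff : ∀ i j, w ![f i, f j] = 0)
    (hef : ∀ i j, w ![e i, f j] = if i = j then c else 0) :
    wedge η (wedgePow w p) ≠ 0 := by
  classical
  -- in the coordinates of the frame `T`, `a` is `ξ*` and `b` is `c ∑ᵢ eᵢ* ⊗ fᵢ*`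
  let T : PairIndex p → V := Sum.elim (fun _ ↦ ξ) (fun q ↦ ![e q.2, f q.2] q.1)
  let F : (PairIndex p → ℝ) →ₗ[ℝ] V := Fintype.linearCombination ℝ T
  have hF : ∀ s, F (Pi.single s 1) = T s := fun s ↦ by
    simp [F, Fintype.linearCombination_apply_single]
  let a : MultilinearMap ℝ (fun _ : Fin 1 ↦ PairIndex p → ℝ) ℝ :=
    (MultilinearMap.mkPiAlgebra ℝ (Fin 1) ℝ).compLinearMap fun _ ↦ LinearMap.proj (Sum.inl ())
  let b : MultilinearMap ℝ (fun _ : Fin 2 ↦ PairIndex p → ℝ) ℝ := ∑ i : Fin p, c •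
    (MultilinearMap.mkPiAlgebra ℝ (Fin 2) ℝ).compLinearMap
      fun k ↦ LinearMap.proj (Sum.inr (k, i))
  have ha : ∀ x : Fin 1 → PairIndex p → ℝ, a x = x 0 (Sum.inl ()) := fun x ↦ by simp [a]
  have hb : ∀ x : Fin 2 → PairIndex p → ℝ,
      b x = ∑ i, c * (x 0 (Sum.inr (0, i)) * x 1 (Sum.inr (1, i))) := fun x ↦ by
    simp [b, Fin.prod_univ_two]
  have hηa : η.compLinearMap F = MultilinearMap.alternatization a := by
    refine (Pi.basisFun ℝ (PairIndex p)).ext_alternating fun v _ ↦ ?_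
    rw [MultilinearMap.alternatization_apply, Fintype.sum_subsingleton _ 1]
    have h1 : ∀ x : V, η (fun _ ↦ x) = η ![x] := fun x ↦ by
      congr 1; funext i; fin_cases i; rfl
    have h2 : ∀ s, η ![T s] = (Pi.single s 1 : PairIndex p → ℝ) (Sum.inl ()) := by
      rintro (s | ⟨k, i⟩)
      · simpa [T] using hξ
      · fin_cases k
        · simpa [T] using he i
        · simpa [T] using hf i
    rw [AlternatingMap.compLinearMap_apply]
    have h3 : (fun i ↦ F ((Pi.basisFun ℝ (PairIndex p)) (v i))) = fun _ ↦ T (v 0) := by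
      funext i; rw [Subsingleton.elim i 0, Pi.basisFun_apply, hF]
    change η (fun i ↦ F ((Pi.basisFun ℝ (PairIndex p)) (v i))) = _
    rw [h3, h1, h2]
    simp [ha]
  have hwb : w.compLinearMap F = MultilinearMap.alternatization b := by
    refine (Pi.basisFun ℝ (PairIndex p)).ext_alternating fun v hv ↦ ?_
    rw [AlternatingMap.compLinearMap_apply, MultilinearMap.alternatization_apply]
    have h1 : (F ∘ fun i ↦ (Pi.basisFun ℝ (PairIndex p)) (v i)) = ![T (v 0), T (v 1)] := by
      funext i
      fin_cases i <;> simp [hF]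
    have h2 : ∀ x y : V, w ![x, y] = - w ![y, x] := fun x y ↦ by
      have := w.map_swap ![y, x] (show (0 : Fin 2) ≠ 1 by decide)
      rw [← this]
      congr 1
      funext i; fin_cases i <;> simp
    have h3 : ∀ s t, w ![T s, T t] = b ![Pi.single s 1, Pi.single t 1]
        - b ![Pi.single t 1, Pi.single s 1] := by
      rintro (s | ⟨k, i⟩) (t | ⟨l, j⟩)
      · have := h2 ξ ξ
        simp [hb, T]; linarith
      · fin_cases l <;> simp [hb, T, hξe, hξf]
      · fin_cases k <;> simp [hb, T, h2 _ ξ, hξe, hξf]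
      · fin_cases k <;> fin_cases l <;>
          simp [hb, T, hee, hff, hef, h2 (f _) (e _), Pi.single_apply, eq_comm]
    change w (F ∘ fun i ↦ (Pi.basisFun ℝ (PairIndex p)) (v i)) = _
    have h4 : (Finset.univ : Finset (Equiv.Perm (Fin 2))) = {1, Equiv.swap 0 1} := by decide
    rw [h1, h3, h4, Finset.sum_pair (by decide), Equiv.Perm.sign_one,
      Equiv.Perm.sign_swap (by decide), sub_eq_add_neg]
    simp only [one_smul, Units.neg_smul, MultilinearMap.domDomCongr_apply, hb]
    simp
  intro h0
  have h1 : MultilinearMap.alternatization (multilinearMul a (bilinearPow b p)) = 0 := by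
    rw [← wedge_alternatization, ← wedgePow_alternatization, ← hηa, ← hwb,
      wedgePow_compLinearMap, wedge_compLinearMap, h0]
    rfl
  -- the sum is evaluated on the basis in the order `ξ, e₀, f₀, e₁, f₁, …`
  let D : PairIndex p ≃ Fin (1 + 2 * p) := (Equiv.sumCongr (Equiv.ofUnique Unit (Fin 1))
    ((Equiv.prodComm _ _).trans (finProdFinEquiv.trans (finCongr (mul_comm p 2))))).trans
      finSumFinEquiv
  have hD0 : D.symm (Fin.castAdd (2 * p) (0 : Fin 1)) = Sum.inl () := by
    rw [Equiv.symm_apply_eq]; rfl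
  have hD1 : ∀ i : Fin p, D.symm (Fin.natAdd 1 ⟨2 * i, by omega⟩) = Sum.inr (0, i) := fun i ↦ by
    rw [Equiv.symm_apply_eq]; ext; simp [D, Equiv.trans_apply]
  have hD2 : ∀ i : Fin p, D.symm (Fin.natAdd 1 ⟨2 * i + 1, by omega⟩) = Sum.inr (1, i) :=
    fun i ↦ by
      rw [Equiv.symm_apply_eq]; ext; simp [D, Equiv.trans_apply]; omega
  have h2 := congrArg (fun A ↦ A (fun j ↦ (Pi.single (D.symm j) 1 : PairIndex p → ℝ))) h1
  simp only [MultilinearMap.alternatization_apply, AlternatingMap.zero_apply,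
    MultilinearMap.domDomCongr_apply, multilinearMul_apply, bilinearPow_apply] at h2
  rw [Fintype.sum_equiv D.symm.permCongr _ (fun s : Equiv.Perm (PairIndex p) ↦ Equiv.Perm.sign s •
    ((Pi.single (s (Sum.inl ())) 1 : PairIndex p → ℝ) (Sum.inl ()) *
      ∏ i : Fin p, b ![Pi.single (s (Sum.inr (0, i))) 1, Pi.single (s (Sum.inr (1, i))) 1]))] at h2
  swap
  · intro s
    rw [Equiv.Perm.sign_permCongr, ha]
    simp only [← hD0, ← hD1, ← hD2, Equiv.permCongr_apply, Equiv.symm_symm,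
      Equiv.apply_symm_apply]
  have hbs : ∀ s t : PairIndex p, 0 ≤ b ![(Pi.single s 1 : PairIndex p → ℝ), Pi.single t 1] ∧
      (b ![(Pi.single s 1 : PairIndex p → ℝ), Pi.single t 1] ≠ 0 →
        ∃ k, s = Sum.inr (0, k) ∧ t = Sum.inr (1, k)) := by
    intro s t
    rw [hb]
    refine ⟨Finset.sum_nonneg fun i _ ↦ ?_, fun h ↦ ?_⟩
    · refine mul_nonneg hc.le (mul_nonneg ?_ ?_) <;>
      · simp only [Matrix.cons_val_zero, Matrix.cons_val_one, Pi.single_apply]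
        split_ifs <;> norm_num
    · obtain ⟨i, -, hi⟩ := Finset.exists_ne_zero_of_sum_ne_zero h
      refine ⟨i, ?_⟩
      simp only [Matrix.cons_val_zero, Matrix.cons_val_one, Pi.single_apply] at hi
      by_contra hne
      apply hi
      by_cases h3 : Sum.inr (0, i) = s
      · by_cases h4 : Sum.inr (1, i) = t
        · exact absurd ⟨h3.symm, h4.symm⟩ hne
        · simp [h4]
      · simp [h3]
  -- no permutation contributes negatively, and the identity contributes `c ^ p`
  refine (Finset.sum_pos' (fun s _ ↦ ?_) ⟨1, Finset.mem_univ _, ?_⟩).ne' h2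
  · by_cases h3 : (Pi.single (s (Sum.inl ())) 1 : PairIndex p → ℝ) (Sum.inl ()) *
      ∏ i : Fin p, b ![Pi.single (s (Sum.inr (0, i))) 1, Pi.single (s (Sum.inr (1, i))) 1] = 0
    · rw [h3, smul_zero]
    -- a contributing permutation is induced by a permutation `τ` of the pairs
    have h4 := left_ne_zero_of_mul h3
    have h5 := Finset.prod_ne_zero_iff.1 (right_ne_zero_of_mul h3)
    have h6 : s (Sum.inl ()) = Sum.inl () := by
      by_contra hne
      exact h4 (by simp [Ne.symm hne])
    choose τ hτ0 hτ1 using fun i ↦ (hbs _ _).2 (h5 i (Finset.mem_univ i))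
    have hτ : Function.Injective τ := fun i j hij ↦ by
      have := hτ0 i
      rw [hij, ← hτ0 j] at this
      simpa using s.injective this
    let t : Equiv.Perm (Fin p) := Equiv.ofBijective τ (Finite.injective_iff_bijective.1 hτ)
    have hs : s = Equiv.sumCongr 1 (Equiv.prodCongrRight fun _ : Fin 2 ↦ t) := by
      ext1 q
      rcases q with q | ⟨k, i⟩
      · exact h6
      · fin_cases k
        · exact hτ0 i
        · exact hτ1 i
    have hsign : Equiv.Perm.sign s = 1 := by
      rw [hs, Equiv.Perm.sign_sumCongr, Equiv.Perm.sign_prodCongrRight, Fin.prod_univ_two,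
        Int.units_mul_self, Equiv.Perm.sign_one, one_mul]
    rw [hsign, one_smul]
    refine mul_nonneg ?_ (Finset.prod_nonneg fun i _ ↦ (hbs _ _).1)
    rw [Pi.single_apply]
    split_ifs <;> norm_num
  · have h7 : ∀ i : Fin p, 0 < b ![(Pi.single (Sum.inr (0, i)) 1 : PairIndex p → ℝ),
        Pi.single (Sum.inr (1, i)) 1] := fun i ↦ by
      rw [hb, Finset.sum_eq_single i (fun j _ hj ↦ by simp [hj]) (by simp)]
      simpa using hc
    rw [Equiv.Perm.sign_one, one_smul]
    simpa using Finset.prod_pos fun i _ ↦ h7 i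

/-- A finite-dimensional odd-dimensional vector space with a linear almost contact metric structure
has an orthonormal basis `ξ, eᵢ, φ eᵢ`; this is its part `eᵢ`, built one vector at a time. -/
theorem exists_phi_frame [FiniteDimensional ℝ V] (g : V →ₗ[ℝ] V →ₗ[ℝ] ℝ) (φ : V →ₗ[ℝ] V)
    (η : V →ₗ[ℝ] ℝ) (ξ : V) (hsymm : ∀ u v, g u v = g v u) (hpos : ∀ v, v ≠ 0 → 0 < g v v)
    (hφφ : ∀ v, φ (φ v) = -v + η v • ξ) (hg : ∀ u v, g (φ u) (φ v) = g u v - η u * η v)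
    (hηφ : ∀ v, η (φ v) = 0) (hskew : ∀ v, g v (φ v) = 0)
    {p : ℕ} (hp : finrank ℝ V = 2 * p + 1) (k : ℕ) (hk : k ≤ p) :
    ∃ e : Fin k → V, (∀ i, η (e i) = 0) ∧ (∀ i j, g (e i) (e j) = if i = j then 1 else 0) ∧
      ∀ i j, g (e i) (φ (e j)) = 0 := by
  induction k with
  | zero => exact ⟨Fin.elim0, fun i ↦ i.elim0, fun i ↦ i.elim0, fun i ↦ i.elim0⟩
  | succ k ih =>
    obtain ⟨e, h1, h2, h3⟩ := ih (by omega)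
    -- `2 k + 1` linear conditions on a space of dimension `2 p + 1` have a nonzero solution
    let A : V →ₗ[ℝ] ℝ × (Fin k → ℝ) × (Fin k → ℝ) :=
      η.prod ((LinearMap.pi fun i ↦ g (e i)).prod (LinearMap.pi fun i ↦ g (φ (e i))))
    have hA : LinearMap.ker A ≠ ⊥ := LinearMap.ker_ne_bot_of_finrank_lt (by
      simp [hp]; omega)
    obtain ⟨v, hv, hv0⟩ := Submodule.exists_mem_ne_zero_of_ne_bot hA
    have hAv : A v = 0 := hv
    have hv1 : η v = 0 := congrArg Prod.fst hAv
    have hv2 : ∀ i, g (e i) v = 0 := fun i ↦ congrFun (congrArg (fun q ↦ q.2.1) hAv) i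
    have hv3 : ∀ i, g (φ (e i)) v = 0 := fun i ↦ congrFun (congrArg (fun q ↦ q.2.2) hAv) i
    have hpv := hpos v hv0
    let u : V := (Real.sqrt (g v v))⁻¹ • v
    have hu : g u u = 1 := by
      have h := Real.mul_self_sqrt hpv.le
      have h' := (Real.sqrt_pos.2 hpv).ne'
      simp only [u, map_smul, LinearMap.smul_apply, smul_eq_mul]
      field_simp
      rw [pow_two, h]
    have hu1 : η u = 0 := by simp [u, hv1]
    have hu2 : ∀ i, g (e i) u = 0 := fun i ↦ by simp [u, hv2]
    have hu3 : ∀ i, g (φ (e i)) u = 0 := fun i ↦ by simp [u, hv3]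
    have hu4 : ∀ i, g (e i) (φ u) = 0 := fun i ↦ by
      have h := hg (e i) (φ u)
      rw [hφφ, hu1, zero_smul, add_zero, map_neg, hu3, hηφ, mul_zero, sub_zero, neg_zero] at h
      exact h.symm
    refine ⟨Fin.snoc e u, fun i ↦ ?_, fun i j ↦ ?_, fun i j ↦ ?_⟩
    · induction i using Fin.lastCases <;> simp [h1, hu1]
    · induction i using Fin.lastCases <;> induction j using Fin.lastCases <;>
        simp [h2, hu, hu2, hsymm u, (Fin.castSucc_lt_last _).ne, (Fin.castSucc_lt_last _).ne']
    · induction i using Fin.lastCases <;> induction j using Fin.lastCases <;>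
        simp [h3, hskew, hu4, hsymm u, hu3]

end Wedge

/-! ### Tensor fields in charts -/

/-- The pullback of a bilinear form along a linear map. -/
def pullBilin {E F : Type*} [NormedAddCommGroup E] [NormedSpace ℝ E] [NormedAddCommGroup F]
    [NormedSpace ℝ F] (B : F →L[ℝ] F →L[ℝ] ℝ) (A : E →L[ℝ] F) : E →L[ℝ] E →L[ℝ] ℝ :=
  B.bilinearComp A A

theorem contDiffAt_congr_iff {E F : Type*} [NormedAddCommGroup E] [NormedSpace ℝ E]
    [NormedAddCommGroup F] [NormedSpace ℝ F] {f g : E → F} {x : E} {n : WithTop ℕ∞}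
    (h : f =ᶠ[𝓝 x] g) : ContDiffAt ℝ n f x ↔ ContDiffAt ℝ n g x :=
  ⟨fun hf ↦ hf.congr_of_eventuallyEq h.symm, fun hg ↦ hg.congr_of_eventuallyEq h⟩

section Charts

variable {E : Type*} [NormedAddCommGroup E] [NormedSpace ℝ E]
  {H : Type*} [TopologicalSpace H] (I : ModelWithCorners ℝ E H)
  {M : Type*} [TopologicalSpace M] [ChartedSpace H M]

/-- The derivative at `y` of the preferred chart at `x`. All tangent spaces are definitionally the
model space `E`; the values here and below are typed in `E`, so that tensors at different points
can be composed and compared. -/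
def chartD (x y : M) : E →L[ℝ] E :=
  (mfderiv I 𝓘(ℝ, E) (extChartAt I x) y : TangentSpace I y →L[ℝ] E)

/-- The derivative at `z` of the inverse of the preferred chart at `x`. -/
def chartInv (x : M) (z : E) : E →L[ℝ] E :=
  (mfderivWithin 𝓘(ℝ, E) I (extChartAt I x).symm (range I) z :
    E →L[ℝ] TangentSpace I ((extChartAt I x).symm z))

variable {I} in
/-- A field of endomorphisms read in the preferred chart at `x`. -/
def locEndo (φ : (x : M) → TangentSpace I x →L[ℝ] TangentSpace I x) (x : M) (z : E) :
    E →L[ℝ] E :=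
  chartD I x ((extChartAt I x).symm z) ∘L (φ ((extChartAt I x).symm z) : E →L[ℝ] E) ∘L
    chartInv I x z

variable {I} in
/-- A vector field read in the preferred chart at `x`. -/
def locField (X : (x : M) → TangentSpace I x) (x : M) (z : E) : E :=
  chartD I x ((extChartAt I x).symm z) (X ((extChartAt I x).symm z) : E)

variable {I} in
/-- A field of covectors read in the preferred chart at `x`. -/
def locCovector (η : (x : M) → TangentSpace I x →L[ℝ] ℝ) (x : M) (z : E) : E →L[ℝ] ℝ :=
  (η ((extChartAt I x).symm z) : E →L[ℝ] ℝ) ∘L chartInv I x z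

variable {I} in
/-- A field of bilinear forms read in the preferred chart at `x`. -/
def locBilin (g : (x : M) → TangentSpace I x →L[ℝ] TangentSpace I x →L[ℝ] ℝ) (x : M) (z : E) :
    E →L[ℝ] E →L[ℝ] ℝ :=
  pullBilin (E := E) (F := E) (g ((extChartAt I x).symm z)) (chartInv I x z)

variable {I} in
/-- A differential form read in the preferred chart at `x`. -/
def locForm {n : ℕ} (w : (x : M) → TangentSpace I x [⋀^Fin n]→L[ℝ] ℝ) (x : M) (z : E) :
    E [⋀^Fin n]→L[ℝ] ℝ :=
  (w ((extChartAt I x).symm z) : E [⋀^Fin n]→L[ℝ] ℝ).compContinuousLinearMap (chartInv I x z)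

variable {I}

theorem chartD_self [IsManifold I 1 M] (x : M) : chartD I x x = ContinuousLinearMap.id ℝ E :=
  mfderiv_extChartAt_self

theorem chartInv_self [IsManifold I 1 M] (x : M) :
    chartInv I x (extChartAt I x x) = ContinuousLinearMap.id ℝ E :=
  mfderivWithin_range_extChartAt_symm

theorem chartD_comp_chartInv [IsManifold I 1 M] {x : M} {z : E} (hz : z ∈ (extChartAt I x).target) :
    chartD I x ((extChartAt I x).symm z) ∘L chartInv I x z = ContinuousLinearMap.id ℝ E :=
  mfderiv_extChartAt_comp_mfderivWithin_extChartAt_symm hz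

theorem chartInv_comp_chartD [IsManifold I 1 M] {x : M} {z : E} (hz : z ∈ (extChartAt I x).target) :
    chartInv I x z ∘L chartD I x ((extChartAt I x).symm z) = ContinuousLinearMap.id ℝ E :=
  mfderivWithin_extChartAt_symm_comp_mfderiv_extChartAt hz

theorem chartD_chartInv [IsManifold I 1 M] {x : M} {z : E} (hz : z ∈ (extChartAt I x).target)
    (v : E) : chartD I x ((extChartAt I x).symm z) (chartInv I x z v) = v :=
  DFunLike.congr_fun (chartD_comp_chartInv hz) v

theorem chartInv_chartD [IsManifold I 1 M] {x : M} {z : E} (hz : z ∈ (extChartAt I x).target)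
    (v : E) : chartInv I x z (chartD I x ((extChartAt I x).symm z) v) = v :=
  DFunLike.congr_fun (chartInv_comp_chartD hz) v

theorem extChartAt_target_mem_nhds_self [I.Boundaryless] (x : M) :
    (extChartAt I x).target ∈ 𝓝 (extChartAt I x x) :=
  extChartAt_target_mem_nhds x

theorem contMDiffAt_iff_contDiffAt_chart [I.Boundaryless] {F : Type*} [NormedAddCommGroup F]
    [NormedSpace ℝ F] {f : M → F} {x : M} {n : WithTop ℕ∞} :
    ContMDiffAt I 𝓘(ℝ, F) n f x ↔
      ContDiffAt ℝ n (fun z ↦ f ((extChartAt I x).symm z)) (extChartAt I x x) := by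
  rw [contMDiffAt_iff_source, I.range_eq_univ, contMDiffWithinAt_univ, contMDiffAt_iff_contDiffAt]
  rfl

variable [IsManifold I ∞ M] [I.Boundaryless]

/-- Smoothness of a section of the tangent bundle is smoothness of its expression in the preferred
chart, since the trivialization of the tangent bundle at `x` is the derivative of that chart; the
same holds below for the bundles of endomorphisms, covectors and bilinear forms. -/
theorem smoothFieldAt_iff {X : (x : M) → TangentSpace I x} {x : M} :
    SmoothFieldAt I X x ↔ ContDiffAt ℝ ∞ (locField X x) (extChartAt I x x) := by
  have : IsManifold I 1 M := .of_le (n := ∞) (by simp)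
  unfold SmoothFieldAt
  rw [ModelWithCorners.tangent]
  refine (contMDiffAt_section x).trans ?_
  rw [contMDiffAt_iff_contDiffAt_chart]
  refine contDiffAt_congr_iff ?_
  filter_upwards [extChartAt_target_mem_nhds_self (I := I) x] with z hz
  have hs : (extChartAt I x).symm z ∈ (chartAt H x).source := by
    rw [← extChartAt_source I]; exact (extChartAt I x).map_target hz
  have h := TangentBundle.continuousLinearMapAt_trivializationAt (I := I) (𝕜 := ℝ) hs
  have h2 := DFunLike.congr_fun h (X ((extChartAt I x).symm z))
  refine Eq.trans ?_ h2
  rw [Trivialization.continuousLinearMapAt_apply, Trivialization.coe_linearMapAt_of_mem]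
  simpa using hs

theorem smoothEndo_iff {φ : (x : M) → TangentSpace I x →L[ℝ] TangentSpace I x} :
    SmoothEndo I φ ↔ ∀ x, ContDiffAt ℝ ∞ (locEndo φ x) (extChartAt I x x) := by
  have : IsManifold I 1 M := .of_le (n := ∞) (by simp)
  refine forall_congr' fun x ↦ ?_
  rw [contMDiffAt_hom_bundle]
  refine (and_iff_right contMDiffAt_id).trans ?_
  rw [contMDiffAt_iff_contDiffAt_chart]
  refine contDiffAt_congr_iff ?_
  filter_upwards [extChartAt_target_mem_nhds_self (I := I) x] with z hz
  have hs : (extChartAt I x).symm z ∈ (chartAt H x).source := by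
    rw [← extChartAt_source I]; exact (extChartAt I x).map_target hz
  have h1 := TangentBundle.continuousLinearMapAt_trivializationAt (I := I) (𝕜 := ℝ) hs
  have h2 := TangentBundle.symmL_trivializationAt (I := I) (𝕜 := ℝ) hs
  rw [(extChartAt I x).right_inv hz] at h2
  simp only [ContinuousLinearMap.inCoordinates]
  rw [h1, h2]
  rfl

theorem smoothOneForm_iff {η : (x : M) → TangentSpace I x →L[ℝ] ℝ} :
    SmoothOneForm I η ↔ ∀ x, ContDiffAt ℝ ∞ (locCovector η x) (extChartAt I x x) := by
  have : IsManifold I 1 M := .of_le (n := ∞) (by simp)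
  refine forall_congr' fun x ↦ ?_
  rw [contMDiffAt_hom_bundle]
  refine (and_iff_right contMDiffAt_id).trans ?_
  rw [contMDiffAt_iff_contDiffAt_chart]
  refine contDiffAt_congr_iff ?_
  filter_upwards [extChartAt_target_mem_nhds_self (I := I) x] with z hz
  have hs : (extChartAt I x).symm z ∈ (chartAt H x).source := by
    rw [← extChartAt_source I]; exact (extChartAt I x).map_target hz
  have h2 := TangentBundle.symmL_trivializationAt (I := I) (𝕜 := ℝ) hs
  rw [(extChartAt I x).right_inv hz] at h2
  simp only [ContinuousLinearMap.inCoordinates]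
  rw [h2]
  ext v
  exact DFunLike.congr_fun (Bundle.Trivial.continuousLinearMapAt_trivialization ℝ M ℝ _) _

theorem smoothBilin_iff {g : (x : M) → TangentSpace I x →L[ℝ] TangentSpace I x →L[ℝ] ℝ} :
    ContMDiff I (I.prod 𝓘(ℝ, E →L[ℝ] E →L[ℝ] ℝ)) ∞
      (fun b ↦ TotalSpace.mk' (E →L[ℝ] E →L[ℝ] ℝ)
        (E := fun b : M ↦ TangentSpace I b →L[ℝ] TangentSpace I b →L[ℝ] ℝ) b (g b)) ↔
      ∀ x, ContDiffAt ℝ ∞ (locBilin g x) (extChartAt I x x) := by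
  have : IsManifold I 1 M := .of_le (n := ∞) (by simp)
  refine forall_congr' fun x ↦ ?_
  rw [contMDiffAt_hom_bundle]
  refine (and_iff_right contMDiffAt_id).trans ?_
  rw [contMDiffAt_iff_contDiffAt_chart]
  refine contDiffAt_congr_iff ?_
  filter_upwards [extChartAt_target_mem_nhds_self (I := I) x] with z hz
  have hs : (extChartAt I x).symm z ∈ (chartAt H x).source := by
    rw [← extChartAt_source I]; exact (extChartAt I x).map_target hz
  have h2 := TangentBundle.symmL_trivializationAt (I := I) (𝕜 := ℝ) hs
  rw [(extChartAt I x).right_inv hz] at h2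
  ext v w
  rw [inCoordinates_apply_eq₂ (by simpa using hs) (by simpa using hs) (by simp)]
  have h3 : ∀ u : E, (trivializationAt E (TangentSpace I) x).symm ((extChartAt I x).symm z) u =
      chartInv I x z u := fun u ↦ by
    exact (Trivialization.symmL_apply (R := ℝ) _ (by simpa using hs) u).symm.trans
      (DFunLike.congr_fun h2 u)
  rw [h3, h3]
  exact DFunLike.congr_fun (Bundle.Trivial.linearMapAt_trivialization ℝ M ℝ _) _

end Charts

/-! ### The Nijenhuis tensor and the exterior derivative in charts -/

theorem two_le_infty : (1 + 1 : WithTop ℕ∞) ≤ ∞ :=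
  WithTop.coe_le_coe.2 (le_top (a := (1 + 1 : ℕ∞)))

section NijenhuisTensor

variable {E : Type*} [NormedAddCommGroup E] [NormedSpace ℝ E]
  {E' : Type*} [NormedAddCommGroup E'] [NormedSpace ℝ E']

/-- The Nijenhuis tensor at `z` of a field `φ` of endomorphisms of a vector space, in terms of the
derivative of `φ`. -/
def nijTensor (φ : E → E →L[ℝ] E) (z u v : E) : E :=
  fderiv ℝ φ z (φ z u) v - fderiv ℝ φ z (φ z v) u + φ z (fderiv ℝ φ z v u)
    - φ z (fderiv ℝ φ z u v)

/-- The Nijenhuis expression of two vector fields depends only on their values. -/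
theorem nijTensor_eq_lieBracket {φ : E → E →L[ℝ] E} {X Y : E → E} {z : E}
    (hφ : DifferentiableAt ℝ φ z) (hX : DifferentiableAt ℝ X z) (hY : DifferentiableAt ℝ Y z) :
    φ z (φ z (VectorField.lieBracket ℝ X Y z))
      + VectorField.lieBracket ℝ (fun y ↦ φ y (X y)) (fun y ↦ φ y (Y y)) z
      - φ z (VectorField.lieBracket ℝ (fun y ↦ φ y (X y)) Y z)
      - φ z (VectorField.lieBracket ℝ X (fun y ↦ φ y (Y y)) z) = nijTensor φ z (X z) (Y z) := by
  simp only [VectorField.lieBracket, fderiv_clm_apply hφ hX, fderiv_clm_apply hφ hY, nijTensor,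
    add_apply, ContinuousLinearMap.comp_apply, ContinuousLinearMap.flip_apply, map_sub, map_add]
  abel

/-- Naturality of the Nijenhuis tensor: if `dF` intertwines `φ` and `ψ`, it carries the tensor of
`φ` to that of `ψ`. The second derivatives of `F` cancel by symmetry. -/
theorem fderiv_nijTensor {F : E → E'} {z : E} (hF : ContDiffAt ℝ ∞ F z) {φ : E → E →L[ℝ] E}
    {ψ : E' → E' →L[ℝ] E'} (hφ : DifferentiableAt ℝ φ z) (hψ : DifferentiableAt ℝ ψ (F z))
    (h : ∀ᶠ y in 𝓝 z, ∀ v, fderiv ℝ F y (φ y v) = ψ (F y) (fderiv ℝ F y v)) (u v : E) :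
    fderiv ℝ F z (nijTensor φ z u v) = nijTensor ψ (F z) (fderiv ℝ F z u) (fderiv ℝ F z v) := by
  have hF1 : DifferentiableAt ℝ F z := hF.differentiableAt (by simp)
  have hF2 : DifferentiableAt ℝ (fderiv ℝ F) z :=
    (hF.fderiv_right (m := 1) two_le_infty).differentiableAt (by simp)
  have hψF : DifferentiableAt ℝ (fun y ↦ ψ (F y)) z := hψ.comp z hF1
  have hsymm : ∀ a b, fderiv ℝ (fderiv ℝ F) z a b = fderiv ℝ (fderiv ℝ F) z b a := fun a b ↦
    (hF.isSymmSndFDerivAt (by simpa [one_add_one_eq_two] using two_le_infty)) a b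
  have key : ∀ w v, fderiv ℝ F z (fderiv ℝ φ z w v) =
      fderiv ℝ ψ (F z) (fderiv ℝ F z w) (fderiv ℝ F z v) + ψ (F z) (fderiv ℝ (fderiv ℝ F) z w v)
        - fderiv ℝ (fderiv ℝ F) z w (φ z v) := by
    intro w v
    have h1 : (fun y ↦ fderiv ℝ F y (φ y v)) =ᶠ[𝓝 z] fun y ↦ ψ (F y) (fderiv ℝ F y v) :=
      h.mono fun y hy ↦ hy v
    have h2 := DFunLike.congr_fun (h1.fderiv_eq (𝕜 := ℝ)) w
    have h3 : DifferentiableAt ℝ (fun y ↦ φ y v) z := hφ.clm_apply (differentiableAt_const v)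
    have h4 : DifferentiableAt ℝ (fun y ↦ fderiv ℝ F y v) z :=
      hF2.clm_apply (differentiableAt_const v)
    rw [fderiv_clm_apply hF2 h3, fderiv_clm_apply hψF h4,
      fderiv_clm_apply hφ (differentiableAt_const v),
      fderiv_clm_apply hF2 (differentiableAt_const v)] at h2
    have h5 : fderiv ℝ (fun y ↦ ψ (F y)) z = fderiv ℝ ψ (F z) ∘L fderiv ℝ F z :=
      fderiv_comp z hψ hF1
    rw [h5] at h2
    simp only [add_apply, ContinuousLinearMap.comp_apply, ContinuousLinearMap.flip_apply,
      fderiv_fun_const, Pi.zero_apply, zero_apply, map_zero, zero_add] at h2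
    rw [eq_sub_iff_add_eq, h2]
    abel
  have h0 := h.self_of_nhds
  simp only [nijTensor, map_add, map_sub, h0, key]
  rw [hsymm u (φ z v), hsymm v (φ z u), hsymm (φ z u) (φ z v), hsymm u v]
  abel

end NijenhuisTensor

section ChartFormulas

variable {E : Type*} [NormedAddCommGroup E] [NormedSpace ℝ E]
  {H : Type*} [TopologicalSpace H] {I : ModelWithCorners ℝ E H}
  {M : Type*} [TopologicalSpace M] [ChartedSpace H M]

/-- The Nijenhuis tensor of a field of endomorphisms on a manifold, computed in the preferred chart
at each point. -/
def nijAt (φ : (x : M) → TangentSpace I x →L[ℝ] TangentSpace I x) (x : M)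
    (u v : TangentSpace I x) : TangentSpace I x :=
  nijTensor (E := E) (locEndo φ x) (extChartAt I x x) u v

theorem extDerivM_eq [IsManifold I 1 M] [I.Boundaryless] {n : ℕ}
    (w : (x : M) → TangentSpace I x [⋀^Fin n]→L[ℝ] ℝ) (x : M) :
    extDerivM I w x = extDeriv (locForm w x) (extChartAt I x x) := by
  have h : extDerivM I w x = (extDerivWithin (locForm w x) (range I)
      (extChartAt I x x)).compContinuousLinearMap (chartD I x x) := rfl
  rw [h, chartD_self, I.range_eq_univ, extDerivWithin_univ]
  rfl

theorem extDerivM_congr [IsManifold I 1 M] [I.Boundaryless] {n : ℕ}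
    {w w' : (x : M) → TangentSpace I x [⋀^Fin n]→L[ℝ] ℝ} {x : M} (h : ∀ᶠ y in 𝓝 x, w y = w' y) :
    extDerivM I w x = extDerivM I w' x := by
  rw [extDerivM_eq, extDerivM_eq]
  refine Filter.EventuallyEq.extDeriv_eq ?_
  have h1 : ∀ᶠ z in 𝓝 (extChartAt I x x), w ((extChartAt I x).symm z) =
      w' ((extChartAt I x).symm z) := by
    refine (continuousAt_extChartAt_symm (I := I) x).eventually (p := fun y ↦ w y = w' y) ?_
    rwa [extChartAt_to_inv]
  filter_upwards [h1] with z hz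
  rw [locForm, locForm, hz]

theorem mlieBracket_eq_lieBracket [IsManifold I 1 M] [I.Boundaryless]
    (X Y : (x : M) → TangentSpace I x) (x : M) :
    VectorField.mlieBracket I X Y x =
      VectorField.lieBracket ℝ (locField X x) (locField Y x) (extChartAt I x x) := by
  have h1 : ∀ Z : (x : M) → TangentSpace I x,
      (VectorField.mpullbackWithin 𝓘(ℝ, E) I (extChartAt I x).symm Z (range I) : E → E) =ᶠ[
        𝓝 (extChartAt I x x)] locField Z x := fun Z ↦ by
    filter_upwards [extChartAt_target_mem_nhds_self (I := I) x] with z hz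
    have h2 := ContinuousLinearMap.inverse_eq (chartInv_comp_chartD hz) (chartD_comp_chartInv hz)
    exact DFunLike.congr_fun h2 _
  rw [← VectorField.mlieBracketWithin_univ, VectorField.mlieBracketWithin_apply]
  have h3 : (mfderiv I 𝓘(ℝ, E) (extChartAt I x) x).inverse = ContinuousLinearMap.id ℝ E := by
    have := ContinuousLinearMap.inverse_id (R := ℝ) (M := E)
    rw [← chartD_self (I := I) x] at this
    refine Eq.trans ?_ (this.trans (chartD_self (I := I) x))
    rfl
  rw [h3, preimage_univ, univ_inter]
  have h4 := (congrFun (VectorField.lieBracketWithin_univ (𝕜 := ℝ)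
    (V := (VectorField.mpullbackWithin 𝓘(ℝ, E) I (extChartAt I x).symm X (range I) : E → E))
    (W := (VectorField.mpullbackWithin 𝓘(ℝ, E) I (extChartAt I x).symm Y (range I) : E → E)))
    (extChartAt I x x)).trans ((h1 X).lieBracket_vectorField_eq (h1 Y))
  rw [← I.range_eq_univ] at h4
  exact h4

variable [IsManifold I ∞ M]

theorem locField_self (X : (x : M) → TangentSpace I x) (x : M) :
    locField X x (extChartAt I x x) = X x := by
  have : IsManifold I 1 M := .of_le (n := ∞) (by simp)
  unfold locField
  rw [extChartAt_to_inv, chartD_self]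
  rfl

theorem locEndo_self (φ : (x : M) → TangentSpace I x →L[ℝ] TangentSpace I x) (x : M) :
    locEndo φ x (extChartAt I x x) = φ x := by
  have : IsManifold I 1 M := .of_le (n := ∞) (by simp)
  unfold locEndo
  rw [extChartAt_to_inv, chartD_self, chartInv_self]
  rfl

variable [I.Boundaryless]

theorem locField_endo_eventuallyEq (φ : (x : M) → TangentSpace I x →L[ℝ] TangentSpace I x)
    (X : (x : M) → TangentSpace I x) (x : M) :
    locField (fun y ↦ φ y (X y)) x =ᶠ[𝓝 (extChartAt I x x)]
      fun z ↦ locEndo φ x z (locField X x z) := by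
  have : IsManifold I 1 M := .of_le (n := ∞) (by simp)
  filter_upwards [extChartAt_target_mem_nhds_self (I := I) x] with z hz
  exact congrArg (fun v : E ↦ chartD I x ((extChartAt I x).symm z)
    ((φ ((extChartAt I x).symm z) : E →L[ℝ] E) v)) (chartInv_chartD hz (X _)).symm

theorem nijenhuis_eq_nijAt {φ : (x : M) → TangentSpace I x →L[ℝ] TangentSpace I x}
    (hφ : SmoothEndo I φ) {X Y : (x : M) → TangentSpace I x} {x : M}
    (hX : SmoothFieldAt I X x) (hY : SmoothFieldAt I Y x) :
    nijenhuis I φ X Y x = nijAt φ x (X x) (Y x) := by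
  have : IsManifold I 1 M := .of_le (n := ∞) (by simp)
  have h := nijTensor_eq_lieBracket ((smoothEndo_iff.1 hφ x).differentiableAt (by simp))
    ((smoothFieldAt_iff.1 hX).differentiableAt (by simp))
    ((smoothFieldAt_iff.1 hY).differentiableAt (by simp))
  rw [locField_self, locField_self] at h
  refine Eq.trans ?_ h
  unfold nijenhuis
  rw [mlieBracket_eq_lieBracket, mlieBracket_eq_lieBracket, mlieBracket_eq_lieBracket,
    mlieBracket_eq_lieBracket,
    (locField_endo_eventuallyEq φ X x).lieBracket_vectorField_eq
      (locField_endo_eventuallyEq φ Y x),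
    (locField_endo_eventuallyEq φ X x).lieBracket_vectorField_eq Filter.EventuallyEq.rfl,
    Filter.EventuallyEq.rfl.lieBracket_vectorField_eq (locField_endo_eventuallyEq φ Y x),
    locEndo_self]
  rfl

/-- Every tangent vector extends to a vector field which is smooth near its base point. -/
theorem exists_smoothFieldAt (x : M) (u : E) :
    ∃ X : (x : M) → TangentSpace I x, SmoothFieldAt I X x ∧ X x = u := by
  have : IsManifold I 1 M := .of_le (n := ∞) (by simp)
  refine ⟨fun y ↦ chartInv I x (extChartAt I x y) u, smoothFieldAt_iff.2 ?_, ?_⟩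
  · refine (contDiffAt_congr_iff ?_).2 (contDiffAt_const (c := u))
    filter_upwards [extChartAt_target_mem_nhds_self (I := I) x] with z hz
    change chartD I x _ (chartInv I x (extChartAt I x ((extChartAt I x).symm z)) u) = u
    rw [(extChartAt I x).right_inv hz]
    exact chartD_chartInv hz u
  · exact DFunLike.congr_fun (chartInv_self (I := I) x) u

end ChartFormulas

/-! ### Naturality under smooth maps -/

section Naturality

variable {E : Type*} [NormedAddCommGroup E] [NormedSpace ℝ E]
  {H : Type*} [TopologicalSpace H] {I : ModelWithCorners ℝ E H}
  {M : Type*} [TopologicalSpace M] [ChartedSpace H M]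
  {E' : Type*} [NormedAddCommGroup E'] [NormedSpace ℝ E']
  {H' : Type*} [TopologicalSpace H'] {J : ModelWithCorners ℝ E' H'}
  {N : Type*} [TopologicalSpace N] [ChartedSpace H' N]

variable (I J) in
/-- The map `f` read in the preferred charts at `x` and at `f x`. -/
def localRep (f : M → N) (x : M) (z : E) : E' :=
  extChartAt J (f x) (f ((extChartAt I x).symm z))

theorem localRep_self (f : M → N) (x : M) :
    localRep I J f x (extChartAt I x x) = extChartAt J (f x) (f x) := by
  rw [localRep, extChartAt_to_inv]

variable [I.Boundaryless]

theorem contDiffAt_localRep {f : M → N} {x : M} (hf : ContMDiffAt I J ∞ f x) :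
    ContDiffAt ℝ ∞ (localRep I J f x) (extChartAt I x x) := by
  have h := (contMDiffAt_iff.1 hf).2
  rw [I.range_eq_univ, contDiffWithinAt_univ] at h
  exact h

variable [IsManifold I ∞ M] [IsManifold J ∞ N]

/-- Near the base point the derivative of `f` is the derivative of its local representative, read in
the charts. -/
theorem eventually_mfderiv_eq {f : M → N} {x : M} (hf : ContMDiffAt I J ∞ f x) :
    ∀ᶠ z in 𝓝 (extChartAt I x x), z ∈ (extChartAt I x).target ∧
      localRep I J f x z ∈ (extChartAt J (f x)).target ∧
      (extChartAt J (f x)).symm (localRep I J f x z) = f ((extChartAt I x).symm z) ∧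
      ∀ v : E, (mfderiv I J f ((extChartAt I x).symm z) (chartInv I x z v) : E') =
        chartInv J (f x) (localRep I J f x z) (fderiv ℝ (localRep I J f x) z v) := by
  have hI : IsManifold I 1 M := .of_le (n := ∞) (by simp)
  have hJ : IsManifold J 1 N := .of_le (n := ∞) (by simp)
  have hψ := continuousAt_extChartAt_symm (I := I) x
  have h1 : ∀ᶠ y in 𝓝 x, ContMDiffAt I J 1 f y :=
    (contMDiffAt_iff_contMDiffAt_nhds (by simp)).1 (hf.of_le (by simp : (1 : WithTop ℕ∞) ≤ ∞))
  have h2 : ∀ᶠ y in 𝓝 x, f y ∈ (extChartAt J (f x)).source :=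
    hf.continuousAt.eventually (extChartAt_source_mem_nhds (I := J) (f x))
  have h3 : ∀ᶠ y in 𝓝 ((extChartAt I x).symm (extChartAt I x x)),
      ContMDiffAt I J 1 f y ∧ f y ∈ (extChartAt J (f x)).source := by
    rw [extChartAt_to_inv]; exact h1.and h2
  filter_upwards [extChartAt_target_mem_nhds_self (I := I) x, hψ.eventually h3] with z hz hz'
  have hinv : (extChartAt J (f x)).symm (localRep I J f x z) = f ((extChartAt I x).symm z) :=
    (extChartAt J (f x)).left_inv hz'.2
  have htar : localRep I J f x z ∈ (extChartAt J (f x)).target :=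
    (extChartAt J (f x)).map_source hz'.2
  refine ⟨hz, htar, hinv, fun v ↦ ?_⟩
  have d1 : HasMFDerivAt 𝓘(ℝ, E) I (extChartAt I x).symm z
      (mfderivWithin 𝓘(ℝ, E) I (extChartAt I x).symm (range I) z) := by
    have := (mdifferentiableWithinAt_extChartAt_symm (I := I) hz).hasMFDerivWithinAt
    rw [I.range_eq_univ] at this ⊢
    exact hasMFDerivWithinAt_univ.1 this
  have d2 : HasMFDerivAt I J f ((extChartAt I x).symm z) _ :=
    (hz'.1.mdifferentiableAt (by simp)).hasMFDerivAt
  have d3 : HasMFDerivAt J 𝓘(ℝ, E') (extChartAt J (f x)) (f ((extChartAt I x).symm z)) _ :=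
    (mdifferentiableAt_extChartAt (I := J) (by
      rw [← extChartAt_source J]; exact hz'.2)).hasMFDerivAt
  have d4 := d3.comp z (d2.comp z d1)
  have d5 : HasFDerivAt (localRep I J f x) (chartD J (f x) (f ((extChartAt I x).symm z)) ∘L
      (mfderiv I J f ((extChartAt I x).symm z) : E →L[ℝ] E') ∘L chartInv I x z) z := d4.hasFDerivAt
  have d6 : fderiv ℝ (localRep I J f x) z v = chartD J (f x) (f ((extChartAt I x).symm z))
      (mfderiv I J f ((extChartAt I x).symm z) (chartInv I x z v) : E') := by
    rw [d5.fderiv]; rfl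
  rw [d6, ← hinv]
  exact (chartInv_chartD htar _).symm

theorem mfderiv_eq_fderiv_localRep {f : M → N} {x : M} (hf : ContMDiffAt I J ∞ f x) (v : E) :
    (mfderiv I J f x v : E') = fderiv ℝ (localRep I J f x) (extChartAt I x x) v := by
  have hI : IsManifold I 1 M := .of_le (n := ∞) (by simp)
  have hJ : IsManifold J 1 N := .of_le (n := ∞) (by simp)
  have h := (eventually_mfderiv_eq hf).self_of_nhds.2.2.2 v
  rw [localRep_self, chartInv_self, chartInv_self, extChartAt_to_inv] at h
  exact h

/-- The pullback of a differential form along a map. -/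
def pullForm {n : ℕ} (f : M → N) (w : (y : N) → TangentSpace J y [⋀^Fin n]→L[ℝ] ℝ) (x : M) :
    TangentSpace I x [⋀^Fin n]→L[ℝ] ℝ :=
  (w (f x)).compContinuousLinearMap (mfderiv I J f x)

theorem locForm_pullForm_eventuallyEq {n : ℕ} {f : M → N} {x : M} (hf : ContMDiffAt I J ∞ f x)
    (w : (y : N) → TangentSpace J y [⋀^Fin n]→L[ℝ] ℝ) :
    locForm (pullForm (I := I) f w) x =ᶠ[𝓝 (extChartAt I x x)] fun z ↦
      (locForm w (f x) (localRep I J f x z)).compContinuousLinearMap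
        (fderiv ℝ (localRep I J f x) z) := by
  filter_upwards [eventually_mfderiv_eq hf] with z hz
  ext v
  unfold locForm
  rw [hz.2.2.1]
  exact congrArg (w (f ((extChartAt I x).symm z)) : (Fin n → E') → ℝ)
    (funext fun i ↦ hz.2.2.2 (v i))

/-- If `df` intertwines two fields of endomorphisms, the derivative of the local representative of
`f` intertwines their expressions in charts. -/
theorem eventually_locEndo_related {f : M → N} {x : M} (hf : ContMDiffAt I J ∞ f x)
    {φ : (x : M) → TangentSpace I x →L[ℝ] TangentSpace I x}
    {ψ : (y : N) → TangentSpace J y →L[ℝ] TangentSpace J y}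
    (h : ∀ᶠ y in 𝓝 x, ∀ u, mfderiv I J f y (φ y u) = ψ (f y) (mfderiv I J f y u)) :
    ∀ᶠ z in 𝓝 (extChartAt I x x), ∀ v, fderiv ℝ (localRep I J f x) z (locEndo φ x z v) =
      locEndo ψ (f x) (localRep I J f x z) (fderiv ℝ (localRep I J f x) z v) := by
  have hI : IsManifold I 1 M := .of_le (n := ∞) (by simp)
  have hJ : IsManifold J 1 N := .of_le (n := ∞) (by simp)
  have h1 : ∀ᶠ y in 𝓝 ((extChartAt I x).symm (extChartAt I x x)), ∀ u,
      mfderiv I J f y (φ y u) = ψ (f y) (mfderiv I J f y u) := by rwa [extChartAt_to_inv]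
  filter_upwards [eventually_mfderiv_eq hf,
    (continuousAt_extChartAt_symm (I := I) x).eventually h1] with z hz hz' v
  obtain ⟨hz1, hz2, hz3, hz4⟩ := hz
  -- both sides agree after applying the derivative of the inverse chart
  have h2 := hz' (chartInv I x z v)
  have h3 := hz4 (locEndo φ x z v)
  have h4 : chartInv I x z (locEndo φ x z v) =
      φ ((extChartAt I x).symm z) (chartInv I x z v) := chartInv_chartD hz1 _
  have h5 : chartInv J (f x) (localRep I J f x z) (fderiv ℝ (localRep I J f x) z
      (locEndo φ x z v)) = ψ (f ((extChartAt I x).symm z))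
        (chartInv J (f x) (localRep I J f x z) (fderiv ℝ (localRep I J f x) z v)) := by
    rw [← h3, h4]
    exact h2.trans (congrArg (ψ (f ((extChartAt I x).symm z)) : E' → E') (hz4 v))
  have h6 := congrArg (chartD J (f x) ((extChartAt J (f x)).symm (localRep I J f x z))) h5
  rw [chartD_chartInv hz2] at h6
  rw [h6]
  unfold locEndo
  rw [hz3]
  rfl

theorem eventually_locField_related {f : M → N} {x : M} (hf : ContMDiffAt I J ∞ f x)
    {X : (x : M) → TangentSpace I x} {Y : (y : N) → TangentSpace J y}
    (h : ∀ᶠ y in 𝓝 x, mfderiv I J f y (X y) = Y (f y)) :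
    ∀ᶠ z in 𝓝 (extChartAt I x x), fderiv ℝ (localRep I J f x) z (locField X x z) =
      locField Y (f x) (localRep I J f x z) := by
  have hI : IsManifold I 1 M := .of_le (n := ∞) (by simp)
  have hJ : IsManifold J 1 N := .of_le (n := ∞) (by simp)
  have h1 : ∀ᶠ y in 𝓝 ((extChartAt I x).symm (extChartAt I x x)),
      mfderiv I J f y (X y) = Y (f y) := by rwa [extChartAt_to_inv]
  filter_upwards [eventually_mfderiv_eq hf,
    (continuousAt_extChartAt_symm (I := I) x).eventually h1] with z hz hz'
  obtain ⟨hz1, hz2, hz3, hz4⟩ := hz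
  have h4 : chartInv I x z (locField X x z) = X ((extChartAt I x).symm z) := chartInv_chartD hz1 _
  have h5 : chartInv J (f x) (localRep I J f x z) (fderiv ℝ (localRep I J f x) z
      (locField X x z)) = Y (f ((extChartAt I x).symm z)) := by
    rw [← hz4, h4]
    exact hz'
  have h6 := congrArg (chartD J (f x) ((extChartAt J (f x)).symm (localRep I J f x z))) h5
  rw [chartD_chartInv hz2] at h6
  rw [h6]
  unfold locField
  rw [hz3]

variable [J.Boundaryless]

/-- The exterior derivative commutes with pullback. By the chart formulas, this is the statement
for the local representative of `f`. -/
theorem extDerivM_pullForm {n : ℕ} {f : M → N} {x : M} (hf : ContMDiffAt I J ∞ f x)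
    {w : (y : N) → TangentSpace J y [⋀^Fin n]→L[ℝ] ℝ}
    (hw : DifferentiableAt ℝ (locForm w (f x)) (extChartAt J (f x) (f x))) :
    extDerivM I (pullForm (I := I) f w) x = pullForm (I := I) f (extDerivM J w) x := by
  have hI : IsManifold I 1 M := .of_le (n := ∞) (by simp)
  have hJ : IsManifold J 1 N := .of_le (n := ∞) (by simp)
  rw [extDerivM_eq, (locForm_pullForm_eventuallyEq hf w).extDeriv_eq,
    extDeriv_pullback (r := 2) (by rwa [localRep_self]) ((contDiffAt_localRep hf).of_le
      (by simpa [one_add_one_eq_two] using two_le_infty)) (by simp), localRep_self]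
  ext v
  change _ = extDerivM J w (f x) fun i ↦ mfderiv I J f x (v i)
  rw [extDerivM_eq]
  exact congrArg (extDeriv (locForm w (f x)) (extChartAt J (f x) (f x)))
    (funext fun i ↦ (mfderiv_eq_fderiv_localRep hf (v i)).symm)

/-- A smooth map which intertwines two fields of endomorphisms carries the Nijenhuis tensor of the
first to that of the second. -/
theorem mfderiv_nijAt {f : M → N} {x : M} (hf : ContMDiffAt I J ∞ f x)
    {φ : (x : M) → TangentSpace I x →L[ℝ] TangentSpace I x}
    {ψ : (y : N) → TangentSpace J y →L[ℝ] TangentSpace J y} (hφ : SmoothEndo I φ)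
    (hψ : SmoothEndo J ψ)
    (h : ∀ᶠ y in 𝓝 x, ∀ u, mfderiv I J f y (φ y u) = ψ (f y) (mfderiv I J f y u))
    (u v : TangentSpace I x) :
    mfderiv I J f x (nijAt φ x u v) = nijAt ψ (f x) (mfderiv I J f x u) (mfderiv I J f x v) := by
  have hI : IsManifold I 1 M := .of_le (n := ∞) (by simp)
  have hJ : IsManifold J 1 N := .of_le (n := ∞) (by simp)
  suffices key : fderiv ℝ (localRep I J f x) (extChartAt I x x)
      (nijTensor (E := E) (locEndo φ x) (extChartAt I x x) u v) =
      nijTensor (E := E') (locEndo ψ (f x)) (localRep I J f x (extChartAt I x x))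
        (fderiv ℝ (localRep I J f x) (extChartAt I x x) u)
        (fderiv ℝ (localRep I J f x) (extChartAt I x x) v) by
    rw [localRep_self] at key
    exact (mfderiv_eq_fderiv_localRep hf _).trans (key.trans (congrArg₂ (nijAt ψ (f x))
      (mfderiv_eq_fderiv_localRep hf u).symm (mfderiv_eq_fderiv_localRep hf v).symm))
  refine fderiv_nijTensor (contDiffAt_localRep hf)
    ((smoothEndo_iff.1 hφ x).differentiableAt (by simp)) ?_ ?_ u v
  · rw [localRep_self]
    exact (smoothEndo_iff.1 hψ (f x)).differentiableAt (by simp)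
  · exact eventually_locEndo_related hf h

end Naturality

section ModelSpace

variable {E : Type*} [NormedAddCommGroup E] [NormedSpace ℝ E]

theorem chartInv_modelSpace (x z : E) : chartInv 𝓘(ℝ, E) x z = ContinuousLinearMap.id ℝ E := by
  unfold chartInv
  simp only [mfld_simps]
  exact mfderiv_id

theorem locForm_modelSpace {n : ℕ} (w : E → E [⋀^Fin n]→L[ℝ] ℝ) (x : E) :
    locForm (I := 𝓘(ℝ, E)) w x = w := by
  ext z v
  unfold locForm
  rw [chartInv_modelSpace]
  simp only [mfld_simps]
  rfl

theorem extDerivM_modelSpace {n : ℕ} (w : E → E [⋀^Fin n]→L[ℝ] ℝ) (x : E) :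
    extDerivM 𝓘(ℝ, E) w x = extDeriv w x := by
  have h := extDerivM_eq (I := 𝓘(ℝ, E)) w x
  rw [locForm_modelSpace] at h
  exact h

end ModelSpace

section SecondDerivative

variable {E : Type*} [NormedAddCommGroup E] [NormedSpace ℝ E]
  {H : Type*} [TopologicalSpace H] {I : ModelWithCorners ℝ E H}
  {M : Type*} [TopologicalSpace M] [ChartedSpace H M] [IsManifold I ∞ M] [I.Boundaryless]

/-- `d ∘ d = 0`. Near `x`, the form is the pullback by the chart at `x` of its expression in this
chart. -/
theorem extDerivM_extDerivM {n : ℕ} {w : (x : M) → TangentSpace I x [⋀^Fin n]→L[ℝ] ℝ} {x : M}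
    (hw : ContDiffAt ℝ ∞ (locForm w x) (extChartAt I x x)) :
    extDerivM I (extDerivM I w) x = 0 := by
  have hI : IsManifold I 1 M := .of_le (n := ∞) (by simp)
  have hsm : ∀ᶠ y in 𝓝 x, ContMDiffAt I 𝓘(ℝ, E) ∞ (extChartAt I x) y := by
    filter_upwards [chart_source_mem_nhds H x] with y hy
    exact contMDiffAt_extChartAt' hy
  have h1 : ∀ᶠ y in 𝓝 x, w y = pullForm (I := I) (J := 𝓘(ℝ, E)) (extChartAt I x)
      (locForm w x) y := by
    filter_upwards [extChartAt_source_mem_nhds (I := I) x] with y hy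
    ext v
    have h2 := fun u : E ↦ chartInv_chartD (I := I) ((extChartAt I x).map_source hy) u
    rw [(extChartAt I x).left_inv hy] at h2
    change w y v = w ((extChartAt I x).symm (extChartAt I x y))
      fun i ↦ chartInv I x (extChartAt I x y) (chartD I x y (v i))
    rw [(extChartAt I x).left_inv hy]
    exact congrArg (w y) (funext fun i ↦ (h2 (v i)).symm)
  have hd : ∀ᶠ z in 𝓝 (extChartAt I x x), DifferentiableAt ℝ (locForm w x) z :=
    ((hw.of_le (by simp : (1 : WithTop ℕ∞) ≤ ∞)).eventually (by simp)).mono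
      fun z hz ↦ hz.differentiableAt (by simp)
  have h3 : ∀ᶠ y in 𝓝 x, extDerivM I w y = pullForm (I := I) (J := 𝓘(ℝ, E)) (extChartAt I x)
      (extDeriv (locForm w x)) y := by
    filter_upwards [h1.eventually_nhds, hsm, (continuousAt_extChartAt (I := I) x).eventually hd]
      with y hy hy' hy''
    refine (extDerivM_congr hy).trans ((extDerivM_pullForm hy'
      (by rw [locForm_modelSpace]; exact hy'')).trans ?_)
    unfold pullForm
    exact congrArg (fun a : E [⋀^Fin (n + 1)]→L[ℝ] ℝ ↦ a.compContinuousLinearMap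
      (chartD I x y)) (extDerivM_modelSpace _ _)
  have hd2 : DifferentiableAt ℝ (extDeriv (locForm w x)) (extChartAt I x x) := by
    have : ContDiffAt ℝ 1 (fderiv ℝ (locForm w x)) (extChartAt I x x) :=
      hw.fderiv_right two_le_infty
    exact (ContinuousAlternatingMap.alternatizeUncurryFinCLM ℝ E ℝ).differentiableAt.comp _
      (this.differentiableAt (by simp))
  refine (extDerivM_congr h3).trans ((extDerivM_pullForm hsm.self_of_nhds
    (by rw [locForm_modelSpace]; exact hd2)).trans ?_)
  have h4 : extDeriv (extDeriv (locForm w x)) (extChartAt I x x) = 0 :=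
    extDeriv_extDeriv_apply hw (by simpa [one_add_one_eq_two] using two_le_infty)
  refine (congrArg (fun a : E [⋀^Fin (n + 1 + 1)]→L[ℝ] ℝ ↦ a.compContinuousLinearMap
      (chartD I x x)) ((extDerivM_modelSpace _ _).trans h4)).trans ?_
  rfl

end SecondDerivative

/-! ### Smoothness of tensor fields and of their pullbacks -/

section Bilinear

variable {D E F : Type*} [NormedAddCommGroup D] [NormedSpace ℝ D] [NormedAddCommGroup E]
  [NormedSpace ℝ E] [NormedAddCommGroup F] [NormedSpace ℝ F]

set_option synthInstance.maxHeartbeats 200000 in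
theorem contDiffAt_precomp {B : D → F →L[ℝ] F →L[ℝ] ℝ} {A : D → E →L[ℝ] F} {z : D}
    (hB : ContDiffAt ℝ ∞ B z) (hA : ContDiffAt ℝ ∞ A z) :
    ContDiffAt ℝ ∞ (fun y ↦ (ContinuousLinearMap.compL ℝ E F ℝ).flip (A y) ∘L B y) z := by
  let C : (E →L[ℝ] F) →L[ℝ] ((F →L[ℝ] ℝ) →L[ℝ] (E →L[ℝ] ℝ)) :=
    (ContinuousLinearMap.compL ℝ E F ℝ).flip
  exact (C.contDiff.contDiffAt.comp z hA).clm_comp hB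

theorem contDiffAt_pullBilin {B : D → F →L[ℝ] F →L[ℝ] ℝ} {A : D → E →L[ℝ] F} {z : D}
    (hB : ContDiffAt ℝ ∞ B z) (hA : ContDiffAt ℝ ∞ A z) :
    ContDiffAt ℝ ∞ (fun y ↦ pullBilin (B y) (A y)) z :=
  (contDiffAt_precomp hB hA).clm_comp hA

end Bilinear

section Pullback

variable {E : Type*} [NormedAddCommGroup E] [NormedSpace ℝ E]
  {H : Type*} [TopologicalSpace H] {I : ModelWithCorners ℝ E H}
  {M : Type*} [TopologicalSpace M] [ChartedSpace H M]
  {E' : Type*} [NormedAddCommGroup E'] [NormedSpace ℝ E']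
  {H' : Type*} [TopologicalSpace H'] {J : ModelWithCorners ℝ E' H'}
  {N : Type*} [TopologicalSpace N] [ChartedSpace H' N]
  [I.Boundaryless]

theorem contDiffAt_fderiv_localRep {f : M → N} {x : M} (hf : ContMDiffAt I J ∞ f x) :
    ContDiffAt ℝ ∞ (fderiv ℝ (localRep I J f x)) (extChartAt I x x) :=
  (contDiffAt_localRep hf).fderiv_right (by simp)

variable [IsManifold I ∞ M] [IsManifold J ∞ N]

/-- The pullback of a smooth covector field is smooth. -/
theorem contDiffAt_locCovector_pullback {f : M → N} {x : M} (hf : ContMDiffAt I J ∞ f x)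
    {η : (y : N) → TangentSpace J y →L[ℝ] ℝ}
    (hη : ContDiffAt ℝ ∞ (locCovector η (f x)) (extChartAt J (f x) (f x)))
    {ζ : (x : M) → TangentSpace I x →L[ℝ] ℝ}
    (h : ∀ᶠ y in 𝓝 x, ∀ u, ζ y u = η (f y) (mfderiv I J f y u)) :
    ContDiffAt ℝ ∞ (locCovector ζ x) (extChartAt I x x) := by
  have h1 : locCovector ζ x =ᶠ[𝓝 (extChartAt I x x)] fun z ↦
      locCovector η (f x) (localRep I J f x z) ∘L fderiv ℝ (localRep I J f x) z := by
    have h2 : ∀ᶠ y in 𝓝 ((extChartAt I x).symm (extChartAt I x x)),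
        ∀ u, ζ y u = η (f y) (mfderiv I J f y u) := by rwa [extChartAt_to_inv]
    filter_upwards [eventually_mfderiv_eq hf,
      (continuousAt_extChartAt_symm (I := I) x).eventually h2] with z hz hz'
    ext v
    refine (hz' (chartInv I x z v)).trans ?_
    unfold locCovector
    rw [hz.2.2.1]
    exact congrArg (η (f ((extChartAt I x).symm z)) : E' → ℝ) (hz.2.2.2 v)
  rw [← localRep_self (I := I) (J := J) f x] at hη
  exact ((hη.comp _ (contDiffAt_localRep hf)).clm_comp
    (contDiffAt_fderiv_localRep hf)).congr_of_eventuallyEq h1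

theorem contDiffAt_locBilin_pullback {f : M → N} {x : M} (hf : ContMDiffAt I J ∞ f x)
    {g : (y : N) → TangentSpace J y →L[ℝ] TangentSpace J y →L[ℝ] ℝ}
    (hg : ContDiffAt ℝ ∞ (locBilin g (f x)) (extChartAt J (f x) (f x)))
    {k : (x : M) → TangentSpace I x →L[ℝ] TangentSpace I x →L[ℝ] ℝ}
    (h : ∀ᶠ y in 𝓝 x, ∀ u v, k y u v = g (f y) (mfderiv I J f y u) (mfderiv I J f y v)) :
    ContDiffAt ℝ ∞ (locBilin k x) (extChartAt I x x) := by
  have h1 : locBilin k x =ᶠ[𝓝 (extChartAt I x x)] fun z ↦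
      pullBilin (locBilin g (f x) (localRep I J f x z)) (fderiv ℝ (localRep I J f x) z) := by
    have h2 : ∀ᶠ y in 𝓝 ((extChartAt I x).symm (extChartAt I x x)),
        ∀ u v, k y u v = g (f y) (mfderiv I J f y u) (mfderiv I J f y v) := by
      rwa [extChartAt_to_inv]
    filter_upwards [eventually_mfderiv_eq hf,
      (continuousAt_extChartAt_symm (I := I) x).eventually h2] with z hz hz'
    ext u v
    refine (hz' (chartInv I x z u) (chartInv I x z v)).trans ?_
    unfold locBilin
    rw [hz.2.2.1]
    exact congrArg₂ (fun a b : E' ↦ (g (f ((extChartAt I x).symm z)) : E' →L[ℝ] E' →L[ℝ] ℝ) a b)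
      (hz.2.2.2 u) (hz.2.2.2 v)
  rw [← localRep_self (I := I) (J := J) f x] at hg
  exact (contDiffAt_pullBilin (hg.comp _ (contDiffAt_localRep hf))
    (contDiffAt_fderiv_localRep hf)).congr_of_eventuallyEq h1

/-- If `df` is invertible and intertwines `φ` with a smooth field `ψ`, then `φ = df⁻¹ ψ df` is
smooth, since inversion of linear maps is. -/
theorem contDiffAt_locEndo_of_related [CompleteSpace E] {f : M → N} {x : M}
    (hf : ContMDiffAt I J ∞ f x)
    (hinv : (fderiv ℝ (localRep I J f x) (extChartAt I x x)).IsInvertible)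
    {φ : (x : M) → TangentSpace I x →L[ℝ] TangentSpace I x}
    {ψ : (y : N) → TangentSpace J y →L[ℝ] TangentSpace J y}
    (hψ : ContDiffAt ℝ ∞ (locEndo ψ (f x)) (extChartAt J (f x) (f x)))
    (h : ∀ᶠ y in 𝓝 x, ∀ u, mfderiv I J f y (φ y u) = ψ (f y) (mfderiv I J f y u)) :
    ContDiffAt ℝ ∞ (locEndo φ x) (extChartAt I x x) := by
  have hF := contDiffAt_fderiv_localRep hf
  have h1 : locEndo φ x =ᶠ[𝓝 (extChartAt I x x)] fun z ↦
      (fderiv ℝ (localRep I J f x) z).inverse ∘L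
        (locEndo ψ (f x) (localRep I J f x z) ∘L fderiv ℝ (localRep I J f x) z) := by
    filter_upwards [eventually_locEndo_related hf h, hF.continuousAt.eventually
      (ContinuousLinearEquiv.isOpen.mem_nhds hinv)] with z hz hz'
    obtain ⟨e, he⟩ := hz'
    ext v
    rw [ContinuousLinearMap.comp_apply, ContinuousLinearMap.comp_apply, ← hz, ← he]
    simp
  rw [← localRep_self (I := I) (J := J) f x] at hψ
  exact ((hinv.contDiffAt_map_inverse.comp _ hF).clm_comp
    ((hψ.comp _ (contDiffAt_localRep hf)).clm_comp hF)).congr_of_eventuallyEq h1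

theorem contDiffAt_locField_of_related [CompleteSpace E] {f : M → N} {x : M}
    (hf : ContMDiffAt I J ∞ f x)
    (hinv : (fderiv ℝ (localRep I J f x) (extChartAt I x x)).IsInvertible)
    {X : (x : M) → TangentSpace I x} {Y : (y : N) → TangentSpace J y}
    (hY : ContDiffAt ℝ ∞ (locField Y (f x)) (extChartAt J (f x) (f x)))
    (h : ∀ᶠ y in 𝓝 x, mfderiv I J f y (X y) = Y (f y)) :
    ContDiffAt ℝ ∞ (locField X x) (extChartAt I x x) := by
  have hF := contDiffAt_fderiv_localRep hf
  have h1 : locField X x =ᶠ[𝓝 (extChartAt I x x)] fun z ↦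
      (fderiv ℝ (localRep I J f x) z).inverse (locField Y (f x) (localRep I J f x z)) := by
    filter_upwards [eventually_locField_related hf h, hF.continuousAt.eventually
      (ContinuousLinearEquiv.isOpen.mem_nhds hinv)] with z hz hz'
    obtain ⟨e, he⟩ := hz'
    rw [← hz, ← he]
    simp
  rw [← localRep_self (I := I) (J := J) f x] at hY
  exact ((hinv.contDiffAt_map_inverse.comp _ hF).clm_apply
    (hY.comp _ (contDiffAt_localRep hf))).congr_of_eventuallyEq h1

end Pullback

section Forms

variable {E : Type*} [NormedAddCommGroup E] [NormedSpace ℝ E]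
  {H : Type*} [TopologicalSpace H] {I : ModelWithCorners ℝ E H}
  {M : Type*} [TopologicalSpace M] [ChartedSpace H M] [I.Boundaryless] [IsManifold I ∞ M]

theorem contDiffAt_locForm_ofSubsingleton {η : (x : M) → TangentSpace I x →L[ℝ] ℝ}
    (hη : SmoothOneForm I η) (x : M) :
    ContDiffAt ℝ ∞ (locForm (fun y ↦ ContinuousAlternatingMap.ofSubsingleton ℝ
      (TangentSpace I y) ℝ (0 : Fin 1) (η y)) x) (extChartAt I x x) :=
  (ContinuousAlternatingMap.ofSubsingletonLIE (𝕜 := ℝ) (E := E) (F := ℝ)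
    (0 : Fin 1)).contDiff.contDiffAt.comp _ (smoothOneForm_iff.1 hη x)

/-- The 2-form `g(u, φ v)` is smooth if `g` and `φ` are. Being alternating, it is half of the
alternatization of the bilinear form `g(u, φ v)`, and the latter is built from `g` and `φ` by
continuous linear operations. -/
theorem contDiffAt_locForm_twoForm
    {g : (x : M) → TangentSpace I x →L[ℝ] TangentSpace I x →L[ℝ] ℝ}
    {φ : (x : M) → TangentSpace I x →L[ℝ] TangentSpace I x}
    (h : ∀ (x : M) (v : TangentSpace I x), g x v (φ x v) = 0) {x : M}
    (hg : ContDiffAt ℝ ∞ (locBilin g x) (extChartAt I x x))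
    (hφ : ContDiffAt ℝ ∞ (locEndo φ x) (extChartAt I x x)) :
    ContDiffAt ℝ ∞ (locForm (I := I) (fun y ↦ twoForm (E := E) (g y) (φ y) (h y)) x)
      (extChartAt I x x) := by
  have hI : IsManifold I 1 M := .of_le (n := ∞) (by simp)
  let Λ : (E →L[ℝ] ℝ) →L[ℝ] E [⋀^Fin 1]→L[ℝ] ℝ :=
    (ContinuousAlternatingMap.ofSubsingletonLIE (𝕜 := ℝ) (E := E) (F := ℝ)
      (0 : Fin 1)).toContinuousLinearEquiv
  let A : (E →L[ℝ] E [⋀^Fin 1]→L[ℝ] ℝ) →L[ℝ] E [⋀^Fin 2]→L[ℝ] ℝ :=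
    ContinuousAlternatingMap.alternatizeUncurryFinCLM ℝ E ℝ
  have hA : ContDiff ℝ ∞ A :=
    ContinuousLinearMap.contDiff (𝕜 := ℝ) (E := E →L[ℝ] E [⋀^Fin 1]→L[ℝ] ℝ)
      (F := E [⋀^Fin 2]→L[ℝ] ℝ) A
  have h1 : locForm (I := I) (fun y ↦ twoForm (E := E) (g y) (φ y) (h y)) x =ᶠ[𝓝 (extChartAt I x x)]
      fun z ↦ (1 / 2 : ℝ) •
        A (Λ ∘L (ContinuousLinearMap.compL ℝ E E ℝ).flip (locEndo φ x z) ∘L locBilin g x z) := by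
    filter_upwards [extChartAt_target_mem_nhds_self (I := I) x] with z hz
    have h2 : ∀ u v : E, locBilin g x z u (locEndo φ x z v) = g ((extChartAt I x).symm z)
        (chartInv I x z u) (φ ((extChartAt I x).symm z) (chartInv I x z v)) := fun u v ↦
      congrArg (fun a : E ↦ (g ((extChartAt I x).symm z) : E →L[ℝ] E →L[ℝ] ℝ)
        (chartInv I x z u) a) (chartInv_chartD hz _)
    have h3 : ∀ v : E, locBilin g x z v (locEndo φ x z v) = 0 := fun v ↦ (h2 v v).trans (h _ _)
    have h4 : ∀ u v : E, locBilin g x z v (locEndo φ x z u) =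
        -locBilin g x z u (locEndo φ x z v) := fun u v ↦ by
      have := h3 (u + v)
      simp only [map_add, add_apply, h3] at this
      linarith
    ext v
    refine (h2 (v 0) (v 1)).symm.trans ?_
    simp [A, Λ, ContinuousAlternatingMap.alternatizeUncurryFin_apply, Fin.sum_univ_two]
    have h5 : Fin.tail v 0 = v 1 := rfl
    have h6 : Fin.removeNth 1 v 0 = v 0 := rfl
    rw [h5, h6, h4]
    ring
  have h2 : ContDiffAt ℝ ∞ (fun z ↦ Λ ∘L (ContinuousLinearMap.compL ℝ E E ℝ).flip
      (locEndo φ x z) ∘L locBilin g x z) (extChartAt I x x) :=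
    (contDiffAt_const (c := Λ)).clm_comp (contDiffAt_precomp hg hφ)
  have h3 := (hA.contDiffAt.comp (extChartAt I x x) h2).const_smul (1 / 2 : ℝ)
  exact h3.congr_of_eventuallyEq h1

end Forms

/-! ### Normality, closedness and metrics -/

section Criteria

variable {E : Type*} [NormedAddCommGroup E] [NormedSpace ℝ E]
  {H : Type*} [TopologicalSpace H] {I : ModelWithCorners ℝ E H}
  {M : Type*} [TopologicalSpace M] [ChartedSpace H M] [I.Boundaryless] [IsManifold I ∞ M]

/-- Normality, expressed by the Nijenhuis tensor instead of by vector fields. -/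
theorem AlmostContactMetric.isNormal_iff (S : AlmostContactMetric I M) :
    S.IsNormal ↔ ∀ (x : M) (u v : TangentSpace I x),
      nijAt S.φ x u v + S.dη x ![u, v] • S.ξ x = 0 := by
  have h2 : ∀ (a : E) (c : ℝ) (b : E), (2 : ℝ) • a + (2 * c) • b = 0 ↔ a + c • b = 0 := by
    intro a c b
    rw [mul_smul, ← smul_add, smul_eq_zero_iff_right two_ne_zero]
  constructor
  · intro h x u v
    obtain ⟨X, hX, rfl⟩ := exists_smoothFieldAt (I := I) x u
    obtain ⟨Y, hY, rfl⟩ := exists_smoothFieldAt (I := I) x v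
    have h1 := h x X Y hX hY
    rw [nijenhuis_eq_nijAt S.smooth_φ hX hY] at h1
    exact (h2 _ _ _).1 h1
  · intro h x X Y hX hY
    rw [nijenhuis_eq_nijAt S.smooth_φ hX hY]
    exact (h2 _ _ _).2 (h x (X x) (Y x))

/-- Integrability, expressed by the Nijenhuis tensor instead of by vector fields. -/
theorem nijenhuis_eq_zero_iff {φ : (x : M) → TangentSpace I x →L[ℝ] TangentSpace I x}
    (hφ : SmoothEndo I φ) :
    (∀ (x : M) (X Y : (x : M) → TangentSpace I x), SmoothFieldAt I X x → SmoothFieldAt I Y x →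
      nijenhuis I φ X Y x = 0) ↔ ∀ (x : M) (u v : TangentSpace I x), nijAt φ x u v = 0 := by
  constructor
  · intro h x u v
    obtain ⟨X, hX, rfl⟩ := exists_smoothFieldAt (I := I) x u
    obtain ⟨Y, hY, rfl⟩ := exists_smoothFieldAt (I := I) x v
    exact (nijenhuis_eq_nijAt hφ hX hY).symm.trans (h x X Y hX hY)
  · intro h x X Y hX hY
    exact (nijenhuis_eq_nijAt hφ hX hY).trans (h x (X x) (Y x))

theorem AlmostContactMetric.contDiffAt_locForm_ηForm (S : AlmostContactMetric I M) (x : M) :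
    ContDiffAt ℝ ∞ (locForm S.ηForm x) (extChartAt I x x) :=
  contDiffAt_locForm_ofSubsingleton S.smooth_η x

theorem AlmostContactMetric.contDiffAt_locForm_fundamentalForm (S : AlmostContactMetric I M)
    (x : M) : ContDiffAt ℝ ∞ (locForm S.fundamentalForm x) (extChartAt I x x) :=
  contDiffAt_locForm_twoForm S.metric_φ_self (smoothBilin_iff.1 S.metric.contMDiff x)
    (smoothEndo_iff.1 S.smooth_φ x)

theorem AlmostHyperHermitian.contDiffAt_locForm_fundamentalForm (K : AlmostHyperHermitian I M)
    (a : Fin 3) (x : M) : ContDiffAt ℝ ∞ (locForm (K.fundamentalForm a) x) (extChartAt I x x) :=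
  contDiffAt_locForm_twoForm (K.metric_J_self a) (smoothBilin_iff.1 K.metric.contMDiff x)
    (smoothEndo_iff.1 (K.smooth_J a) x)

theorem extDeriv_ofSubsingleton_apply {e : E → E →L[ℝ] ℝ} {z : E} (he : DifferentiableAt ℝ e z)
    (w : Fin 2 → E) :
    extDeriv (fun y ↦ ContinuousAlternatingMap.ofSubsingleton ℝ E ℝ (0 : Fin 1) (e y)) z w =
      fderiv ℝ e z (w 0) (w 1) - fderiv ℝ e z (w 1) (w 0) := by
  let Λ : (E →L[ℝ] ℝ) →L[ℝ] E [⋀^Fin 1]→L[ℝ] ℝ :=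
    (ContinuousAlternatingMap.ofSubsingletonLIE (𝕜 := ℝ) (E := E) (F := ℝ)
      (0 : Fin 1)).toContinuousLinearEquiv
  have h1 : ∀ u v, fderiv ℝ (fun y ↦ e y v) z u = fderiv ℝ e z u v := fun u v ↦ by
    rw [fderiv_clm_apply he (differentiableAt_const v)]
    simp
  refine (extDeriv_apply (Λ.differentiableAt.comp z he) w).trans ?_
  rw [Fin.sum_univ_two, Fin.val_zero, pow_zero, one_smul, Fin.val_one, pow_one, neg_smul, one_smul,
    ← sub_eq_add_neg]
  exact congrArg₂ (· - ·) (h1 (w 0) (w 1)) (h1 (w 1) (w 0))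

/-- `dη` in terms of the derivative of the expression of `η` in the preferred chart. -/
theorem AlmostContactMetric.dη_apply (S : AlmostContactMetric I M) (x : M)
    (w : Fin 2 → TangentSpace I x) :
    S.dη x w = fderiv ℝ (locCovector S.η x) (extChartAt I x x) (w 0 : E) (w 1 : E)
      - fderiv ℝ (locCovector S.η x) (extChartAt I x x) (w 1 : E) (w 0 : E) := by
  have hI : IsManifold I 1 M := .of_le (n := ∞) (by simp)
  have h3 : S.dη x = extDeriv (locForm S.ηForm x) (extChartAt I x x) := extDerivM_eq _ x
  rw [h3]
  exact extDeriv_ofSubsingleton_apply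
    ((smoothOneForm_iff.1 S.smooth_η x).differentiableAt (by simp)) w

/-- On a Sasakian manifold the fundamental form `Φ = ½ dη` is closed. -/
theorem AlmostContactMetric.IsSasakian.isQuasiSasakian {S : AlmostContactMetric I M}
    (h : S.IsSasakian) : S.IsQuasiSasakian := by
  have hI : IsManifold I 1 M := .of_le (n := ∞) (by simp)
  refine ⟨h.1, fun x ↦ ?_⟩
  have h1 : extDerivM I S.dη x = 0 := extDerivM_extDerivM (S.contDiffAt_locForm_ηForm x)
  have h2 : locForm S.dη x = fun z ↦ (2 : ℝ) • locForm S.fundamentalForm x z := by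
    ext z v
    unfold locForm
    rw [h.2]
    rfl
  have h3 : extDeriv (locForm S.dη x) (extChartAt I x x) = 0 := (extDerivM_eq S.dη x).symm.trans h1
  have h4 : extDeriv (fun z ↦ (2 : ℝ) • locForm S.fundamentalForm x z) (extChartAt I x x) =
      (2 : ℝ) • extDeriv (locForm S.fundamentalForm x) (extChartAt I x x) := extDeriv_smul ..
  rw [h2, h4] at h3
  exact (extDerivM_eq _ _).trans ((smul_eq_zero_iff_right two_ne_zero).1 h3)

/-- The unit ball of a positive definite form `B` is bounded: `B v v ≥ c ‖v‖²`, where `c > 0` is the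
minimum of `B` on the unit sphere. -/
theorem isVonNBounded_of_pos [FiniteDimensional ℝ E] (B : E →L[ℝ] E →L[ℝ] ℝ)
    (hB : ∀ v, v ≠ 0 → 0 < B v v) : Bornology.IsVonNBounded ℝ {v | B v v < 1} := by
  rw [NormedSpace.isVonNBounded_iff, isBounded_iff_forall_norm_le]
  rcases subsingleton_or_nontrivial E with hE | hE
  · exact ⟨0, fun v _ ↦ by simp [Subsingleton.elim v 0]⟩
  have : ProperSpace E := FiniteDimensional.proper ℝ E
  obtain ⟨v₀, hv₀, hmin⟩ := (isCompact_sphere (0 : E) 1).exists_isMinOn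
    (NormedSpace.sphere_nonempty.2 zero_le_one)
    (f := fun v ↦ B v v) (B.continuous.clm_apply continuous_id).continuousOn
  have hc : 0 < B v₀ v₀ := hB v₀ (ne_zero_of_mem_unit_sphere ⟨v₀, hv₀⟩)
  refine ⟨1 / B v₀ v₀ + 1, fun v (hv : B v v < 1) ↦ ?_⟩
  rcases eq_or_ne v 0 with rfl | h0
  · rw [norm_zero]; positivity
  have hn : 0 < ‖v‖ := norm_pos_iff.2 h0
  have h1 : B v₀ v₀ ≤ B (‖v‖⁻¹ • v) (‖v‖⁻¹ • v) :=
    hmin (by simp [norm_smul, hn.ne'])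
  simp only [map_smul, smul_apply, smul_eq_mul] at h1
  have h2 : B v₀ v₀ * ‖v‖ ^ 2 < 1 := by
    refine lt_of_le_of_lt ?_ hv
    calc B v₀ v₀ * ‖v‖ ^ 2 ≤ (‖v‖⁻¹ * (‖v‖⁻¹ * B v v)) * ‖v‖ ^ 2 := by gcongr
      _ = B v v := by field_simp
  have h3 : ‖v‖ ^ 2 ≤ 1 / B v₀ v₀ := by
    rw [le_div_iff₀ hc]; linarith
  nlinarith [sq_nonneg (‖v‖ - 1)]

/-- The Riemannian metric given by a smooth positive definite field of symmetric bilinear forms. -/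
def mkMetric [FiniteDimensional ℝ E]
    (g : (x : M) → TangentSpace I x →L[ℝ] TangentSpace I x →L[ℝ] ℝ)
    (symm : ∀ (x : M) (u v : TangentSpace I x), g x u v = g x v u)
    (pos : ∀ (x : M) (v : TangentSpace I x), v ≠ 0 → 0 < g x v v)
    (smooth : ∀ x, ContDiffAt ℝ ∞ (locBilin g x) (extChartAt I x x)) : Metric I M where
  inner := g
  symm := symm
  pos := pos
  isVonNBounded x := isVonNBounded_of_pos (E := E) (g x) (pos x)
  contMDiff := smoothBilin_iff.2 smooth

end Criteria

/-! ### Tensor fields on products -/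

section ProductTensors

variable {E' : Type*} [NormedAddCommGroup E'] [NormedSpace ℝ E']
  {H' : Type*} [TopologicalSpace H'] {I' : ModelWithCorners ℝ E' H'}
  {M' : Type*} [TopologicalSpace M'] [ChartedSpace H' M']
  {E'' : Type*} [NormedAddCommGroup E''] [NormedSpace ℝ E'']
  {H'' : Type*} [TopologicalSpace H''] {I'' : ModelWithCorners ℝ E'' H''}
  {M'' : Type*} [TopologicalSpace M''] [ChartedSpace H'' M'']

/-- Tangent vectors of a product are determined by their projections. Every identity of tensors on
the product is reduced to the factors by this lemma. -/
theorem tangent_prod_ext {p : M' × M''} {u v : TangentSpace (I'.prod I'') p}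
    (h' : mfderiv (I'.prod I'') I' Prod.fst p u = mfderiv (I'.prod I'') I' Prod.fst p v)
    (h'' : mfderiv (I'.prod I'') I'' Prod.snd p u = mfderiv (I'.prod I'') I'' Prod.snd p v) :
    u = v := by
  rw [mfderiv_fst] at h'
  rw [mfderiv_snd] at h''
  exact Prod.ext h' h''

variable [I'.Boundaryless] [I''.Boundaryless]

theorem localRep_fst_eventuallyEq (p : M' × M'') :
    localRep (I'.prod I'') I' Prod.fst p =ᶠ[𝓝 (extChartAt (I'.prod I'') p p)] Prod.fst := by
  filter_upwards [extChartAt_target_mem_nhds_self (I := I'.prod I'') p] with z hz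
  rw [extChartAt_prod] at hz
  unfold localRep
  rw [extChartAt_prod]
  exact (extChartAt I' p.1).right_inv hz.1

theorem localRep_snd_eventuallyEq (p : M' × M'') :
    localRep (I'.prod I'') I'' Prod.snd p =ᶠ[𝓝 (extChartAt (I'.prod I'') p p)] Prod.snd := by
  filter_upwards [extChartAt_target_mem_nhds_self (I := I'.prod I'') p] with z hz
  rw [extChartAt_prod] at hz
  unfold localRep
  rw [extChartAt_prod]
  exact (extChartAt I'' p.2).right_inv hz.2

theorem eventually_fderiv_localRep_fst (p : M' × M'') :
    ∀ᶠ z in 𝓝 (extChartAt (I'.prod I'') p p), localRep (I'.prod I'') I' Prod.fst p z = z.1 ∧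
      fderiv ℝ (localRep (I'.prod I'') I' Prod.fst p) z = ContinuousLinearMap.fst ℝ E' E'' := by
  filter_upwards [(localRep_fst_eventuallyEq p).eventually_nhds] with z hz
  exact ⟨hz.self_of_nhds, (Filter.EventuallyEq.fderiv_eq (𝕜 := ℝ) hz).trans fderiv_fst⟩

theorem eventually_fderiv_localRep_snd (p : M' × M'') :
    ∀ᶠ z in 𝓝 (extChartAt (I'.prod I'') p p), localRep (I'.prod I'') I'' Prod.snd p z = z.2 ∧
      fderiv ℝ (localRep (I'.prod I'') I'' Prod.snd p) z = ContinuousLinearMap.snd ℝ E' E'' := by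
  filter_upwards [(localRep_snd_eventuallyEq p).eventually_nhds] with z hz
  exact ⟨hz.self_of_nhds, (Filter.EventuallyEq.fderiv_eq (𝕜 := ℝ) hz).trans fderiv_snd⟩

variable [IsManifold I' ∞ M'] [IsManifold I'' ∞ M'']

/-- A field of endomorphisms of a product is smooth if the two projections carry it to smooth
ones. -/
theorem smoothEndo_prod {φ : (p : M' × M'') → TangentSpace (I'.prod I'') p →L[ℝ]
      TangentSpace (I'.prod I'') p}
    {φ' : (x : M') → TangentSpace I' x →L[ℝ] TangentSpace I' x}
    {φ'' : (x : M'') → TangentSpace I'' x →L[ℝ] TangentSpace I'' x}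
    (hφ' : SmoothEndo I' φ') (hφ'' : SmoothEndo I'' φ'')
    (h' : ∀ p u, mfderiv (I'.prod I'') I' Prod.fst p (φ p u) =
      φ' p.1 (mfderiv (I'.prod I'') I' Prod.fst p u))
    (h'' : ∀ p u, mfderiv (I'.prod I'') I'' Prod.snd p (φ p u) =
      φ'' p.2 (mfderiv (I'.prod I'') I'' Prod.snd p u)) :
    SmoothEndo (I'.prod I'') φ := by
  refine smoothEndo_iff.2 fun p ↦ ?_
  have h1 : locEndo φ p =ᶠ[𝓝 (extChartAt (I'.prod I'') p p)] fun z ↦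
      ContinuousLinearMap.inl ℝ E' E'' ∘L (locEndo φ' p.1 z.1 ∘L ContinuousLinearMap.fst ℝ E' E'')
      + ContinuousLinearMap.inr ℝ E' E'' ∘L
        (locEndo φ'' p.2 z.2 ∘L ContinuousLinearMap.snd ℝ E' E'') := by
    filter_upwards [eventually_fderiv_localRep_fst p, eventually_fderiv_localRep_snd p,
      eventually_locEndo_related contMDiffAt_fst (Filter.Eventually.of_forall h'),
      eventually_locEndo_related contMDiffAt_snd (Filter.Eventually.of_forall h'')]
      with z hz1 hz2 hz3 hz4
    refine ContinuousLinearMap.ext fun v ↦ ?_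
    have h3 := hz3 v
    have h4 := hz4 v
    rw [hz1.1, hz1.2] at h3
    rw [hz2.1, hz2.2] at h4
    refine Prod.ext (h3.trans ?_) (h4.trans ?_) <;> simp
  have e1 : ContDiffAt ℝ ∞ (locEndo φ' p.1) (extChartAt (I'.prod I'') p p).1 :=
    smoothEndo_iff.1 hφ' p.1
  have e2 : ContDiffAt ℝ ∞ (locEndo φ'' p.2) (extChartAt (I'.prod I'') p p).2 :=
    smoothEndo_iff.1 hφ'' p.2
  have e3 : ContDiffAt ℝ ∞ (fun z : E' × E'' ↦ locEndo φ' p.1 z.1) (extChartAt (I'.prod I'') p p) :=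
    e1.comp _ contDiffAt_fst
  have e4 : ContDiffAt ℝ ∞ (fun z : E' × E'' ↦ locEndo φ'' p.2 z.2)
    (extChartAt (I'.prod I'') p p) := e2.comp _ contDiffAt_snd
  exact ((contDiffAt_const.clm_comp (e3.clm_comp contDiffAt_const)).add
    (contDiffAt_const.clm_comp (e4.clm_comp contDiffAt_const))).congr_of_eventuallyEq h1

theorem smoothFieldAt_prod {X : (p : M' × M'') → TangentSpace (I'.prod I'') p}
    {X' : (x : M') → TangentSpace I' x} {X'' : (x : M'') → TangentSpace I'' x} {p : M' × M''}
    (hX' : SmoothFieldAt I' X' p.1) (hX'' : SmoothFieldAt I'' X'' p.2)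
    (h' : ∀ p, mfderiv (I'.prod I'') I' Prod.fst p (X p) = X' p.1)
    (h'' : ∀ p, mfderiv (I'.prod I'') I'' Prod.snd p (X p) = X'' p.2) :
    SmoothFieldAt (I'.prod I'') X p := by
  refine smoothFieldAt_iff.2 ?_
  have h1 : locField X p =ᶠ[𝓝 (extChartAt (I'.prod I'') p p)] fun z ↦
      (locField X' p.1 z.1, locField X'' p.2 z.2) := by
    filter_upwards [eventually_fderiv_localRep_fst p, eventually_fderiv_localRep_snd p,
      eventually_locField_related contMDiffAt_fst (Filter.Eventually.of_forall h'),
      eventually_locField_related contMDiffAt_snd (Filter.Eventually.of_forall h'')]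
      with z hz1 hz2 h3 h4
    rw [hz1.1, hz1.2] at h3
    rw [hz2.1, hz2.2] at h4
    exact Prod.ext h3 h4
  have e1 : ContDiffAt ℝ ∞ (locField X' p.1) (extChartAt (I'.prod I'') p p).1 :=
    smoothFieldAt_iff.1 hX'
  have e2 : ContDiffAt ℝ ∞ (locField X'' p.2) (extChartAt (I'.prod I'') p p).2 :=
    smoothFieldAt_iff.1 hX''
  exact ContDiffAt.congr_of_eventuallyEq (ContDiffAt.prodMk (e1.comp _ contDiffAt_fst)
    (e2.comp _ contDiffAt_snd)) h1

/-- The pullback of a field of bilinear forms. -/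
def pullMetric {E : Type*} [NormedAddCommGroup E] [NormedSpace ℝ E]
    {H : Type*} [TopologicalSpace H] {I : ModelWithCorners ℝ E H}
    {M : Type*} [TopologicalSpace M] [ChartedSpace H M]
    (f : M → M') (g : (x : M') → TangentSpace I' x →L[ℝ] TangentSpace I' x →L[ℝ] ℝ) (x : M) :
    TangentSpace I x →L[ℝ] TangentSpace I x →L[ℝ] ℝ :=
  pullBilin (E := E) (F := E') (g (f x)) (mfderiv I I' f x)

theorem contDiffAt_locBilin_add {E : Type*} [NormedAddCommGroup E] [NormedSpace ℝ E]
    {H : Type*} [TopologicalSpace H] {I : ModelWithCorners ℝ E H}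
    {M : Type*} [TopologicalSpace M] [ChartedSpace H M]
    {g k : (x : M) → TangentSpace I x →L[ℝ] TangentSpace I x →L[ℝ] ℝ} {x : M}
    (hg : ContDiffAt ℝ ∞ (locBilin g x) (extChartAt I x x))
    (hk : ContDiffAt ℝ ∞ (locBilin k x) (extChartAt I x x)) :
    ContDiffAt ℝ ∞ (locBilin (fun y ↦ g y + k y) x) (extChartAt I x x) :=
  hg.add hk

theorem extDerivM_add {E : Type*} [NormedAddCommGroup E] [NormedSpace ℝ E]
    {H : Type*} [TopologicalSpace H] {I : ModelWithCorners ℝ E H} [I.Boundaryless]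
    {M : Type*} [TopologicalSpace M] [ChartedSpace H M] [IsManifold I 1 M] {n : ℕ}
    {w w' : (x : M) → TangentSpace I x [⋀^Fin n]→L[ℝ] ℝ} {x : M}
    (hw : DifferentiableAt ℝ (locForm w x) (extChartAt I x x))
    (hw' : DifferentiableAt ℝ (locForm w' x) (extChartAt I x x)) :
    extDerivM I (fun y ↦ w y + w' y) x = extDerivM I w x + extDerivM I w' x := by
  rw [extDerivM_eq, extDerivM_eq, extDerivM_eq]
  exact extDeriv_add hw hw'

end ProductTensors

/-! ### The rank of a Sasakian structure -/

section AlmostContact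

variable {E : Type*} [NormedAddCommGroup E] [NormedSpace ℝ E]
  {H : Type*} [TopologicalSpace H] {I : ModelWithCorners ℝ E H}
  {M : Type*} [TopologicalSpace M] [ChartedSpace H M] [IsManifold I ∞ M]

theorem AlmostContactMetric.metric_ξ (S : AlmostContactMetric I M) (x : M)
    (u : TangentSpace I x) : S.metric.inner x u (S.ξ x) = S.η x u := by
  have h := S.compatible x u (S.ξ x)
  rw [S.φ_ξ, map_zero, S.η_ξ, mul_one] at h
  exact sub_eq_zero.1 h.symm

theorem wedge_wedgePow_compLinearMap_eq_zero_iff {V W : Type*} [AddCommGroup V] [Module ℝ V]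
    [AddCommGroup W] [Module ℝ W] {f : W →ₗ[ℝ] V} (hf : Function.Surjective f)
    (η : V [⋀^Fin 1]→ₗ[ℝ] ℝ) (w : V [⋀^Fin 2]→ₗ[ℝ] ℝ) (p : ℕ) :
    wedge (η.compLinearMap f) (wedgePow (w.compLinearMap f) p) = 0 ↔
      wedge η (wedgePow w p) = 0 := by
  rw [wedgePow_compLinearMap, wedge_compLinearMap]
  refine ⟨fun h ↦ ?_, fun h ↦ by rw [h]; rfl⟩
  ext v
  choose g hg using hf
  have h1 := DFunLike.congr_fun h (fun i ↦ g (v i))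
  rw [AlternatingMap.compLinearMap_apply, funext fun i ↦ hg (v i)] at h1
  exact h1

/-- A Sasakian structure on a manifold of dimension `2p + 1` has rank `2p + 1`: in an adapted frame
`ξ, eᵢ, φ eᵢ` the form `dη = 2Φ` is in normal form, and `(dη)^(p + 1)` has degree `2p + 2`. -/
theorem AlmostContactMetric.IsSasakian.rank [FiniteDimensional ℝ E] {S : AlmostContactMetric I M}
    (hS : S.IsSasakian) {p : ℕ} (hp : finrank ℝ E = 2 * p + 1) (x : M) :
    wedge (S.ηForm x).toAlternatingMap (wedgePow (S.dη x).toAlternatingMap p) ≠ 0 ∧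
      wedgePow (S.dη x).toAlternatingMap (p + 1) = 0 := by
  have hfin : FiniteDimensional ℝ (TangentSpace I x) := inferInstanceAs (FiniteDimensional ℝ E)
  replace hp : finrank ℝ (TangentSpace I x) = 2 * p + 1 := hp
  constructor
  · obtain ⟨e, he1, he2, he3⟩ : ∃ e : Fin p → TangentSpace I x, (∀ i, S.η x (e i) = 0) ∧
        (∀ i j, S.metric.inner x (e i) (e j) = if i = j then 1 else 0) ∧
        ∀ i j, S.metric.inner x (e i) (S.φ x (e j)) = 0 :=
      exists_phi_frame (V := TangentSpace I x)
        (LinearMap.mk₂ ℝ (fun u v ↦ S.metric.inner x u v) (by simp) (by simp) (by simp) (by simp))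
        (S.φ x).toLinearMap (S.η x).toLinearMap (S.ξ x) (S.metric.symm x)
        (S.metric.pos x) (S.φ_φ x) (S.compatible x) (S.η_φ x) (S.metric_φ_self x) hp p le_rfl
    have hw : ∀ u v : TangentSpace I x,
        (S.dη x).toAlternatingMap ![u, v] = 2 * S.metric.inner x u (S.φ x v) := fun u v ↦ by
      rw [hS.2]; rfl
    have hη : ∀ u : TangentSpace I x, (S.ηForm x).toAlternatingMap ![u] = S.η x u := fun u ↦ rfl
    have hφe : ∀ j, S.φ x (S.φ x (e j)) = -(e j : TangentSpace I x) := fun j ↦ by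
      rw [S.φ_φ, he1, zero_smul, add_zero]
    have hξ : ∀ u, S.metric.inner x (S.ξ x) (S.φ x u) = 0 := fun u ↦ by
      rw [S.metric.symm, S.metric_ξ, S.η_φ]
    -- `Φ(eᵢ, φ eⱼ) = -δᵢⱼ`, so the second half of the frame is `-φ eᵢ`
    refine wedge_wedgePow_ne_zero (V := TangentSpace I x) _ _ (S.ξ x) e
      (fun j ↦ -S.φ x (e j)) (c := 2) two_pos ?_ ?_ ?_ ?_ ?_ ?_ ?_ ?_
    · rw [hη, S.η_ξ]
    · intro i; rw [hη, he1]
    · intro i; rw [hη, map_neg, S.η_φ, neg_zero]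
    · intro i; rw [hw, hξ, mul_zero]
    · intro i; rw [hw, hξ, mul_zero]
    · intro i j; rw [hw, he3, mul_zero]
    · intro i j
      rw [hw, map_neg, map_neg, map_neg, neg_apply, neg_neg, hφe, map_neg, S.metric.symm, he3]
      simp
    · intro i j
      rw [hw, map_neg, hφe, neg_neg, he2]
      split_ifs <;> simp
  · exact alternatingForm_eq_zero_of_finrank_lt _ (by omega)

end AlmostContact

/-! ### The product structure -/

section ProductTensors

variable {E' : Type*} [NormedAddCommGroup E'] [NormedSpace ℝ E']
  {H' : Type*} [TopologicalSpace H'] {I' : ModelWithCorners ℝ E' H'}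
  {M' : Type*} [TopologicalSpace M'] [ChartedSpace H' M']
  {E'' : Type*} [NormedAddCommGroup E''] [NormedSpace ℝ E'']
  {H'' : Type*} [TopologicalSpace H''] {I'' : ModelWithCorners ℝ E'' H''}
  {M'' : Type*} [TopologicalSpace M''] [ChartedSpace H'' M'']

/-- The endomorphism `φ' × φ''` of the tangent spaces of a product. -/
def prodEndo (φ' : (x : M') → TangentSpace I' x →L[ℝ] TangentSpace I' x)
    (φ'' : (x : M'') → TangentSpace I'' x →L[ℝ] TangentSpace I'' x) (p : M' × M'') :
    TangentSpace (I'.prod I'') p →L[ℝ] TangentSpace (I'.prod I'') p :=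
  ((φ' p.1 : E' →L[ℝ] E').prodMap (φ'' p.2 : E'' →L[ℝ] E'') : E' × E'' →L[ℝ] E' × E'')

theorem mfderiv_fst_prodEndo (φ' : (x : M') → TangentSpace I' x →L[ℝ] TangentSpace I' x)
    (φ'' : (x : M'') → TangentSpace I'' x →L[ℝ] TangentSpace I'' x) (p : M' × M'')
    (u : TangentSpace (I'.prod I'') p) :
    mfderiv (I'.prod I'') I' Prod.fst p (prodEndo φ' φ'' p u) =
      φ' p.1 (mfderiv (I'.prod I'') I' Prod.fst p u) := by
  rw [mfderiv_fst]; rfl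

theorem mfderiv_snd_prodEndo (φ' : (x : M') → TangentSpace I' x →L[ℝ] TangentSpace I' x)
    (φ'' : (x : M'') → TangentSpace I'' x →L[ℝ] TangentSpace I'' x) (p : M' × M'')
    (u : TangentSpace (I'.prod I'') p) :
    mfderiv (I'.prod I'') I'' Prod.snd p (prodEndo φ' φ'' p u) =
      φ'' p.2 (mfderiv (I'.prod I'') I'' Prod.snd p u) := by
  rw [mfderiv_snd]; rfl

/-- A vector field of the first factor, as a vector field of the product. -/
def prodField (X : (x : M') → TangentSpace I' x) (p : M' × M'') : TangentSpace (I'.prod I'') p :=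
  ((X p.1 : E'), (0 : E''))

theorem mfderiv_fst_prodField (X : (x : M') → TangentSpace I' x) (p : M' × M'') :
    mfderiv (I'.prod I'') I' Prod.fst p (prodField (I'' := I'') X p) = X p.1 := by
  rw [mfderiv_fst]; rfl

theorem mfderiv_snd_prodField (X : (x : M') → TangentSpace I' x) (p : M' × M'') :
    mfderiv (I'.prod I'') I'' Prod.snd p (prodField (I'' := I'') X p) = 0 := by
  rw [mfderiv_snd]; rfl

variable [IsManifold I' ∞ M'] [IsManifold I'' ∞ M'']

/-- `η_a` is the pullback of `η'_a`, since `ξ_a` is tangent to the first factor. -/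
theorem IsProductStructure.η_fst {S' : AlmostContactMetric3 I' M'}
    {K : AlmostHyperHermitian I'' M''} {S : AlmostContactMetric3 (I'.prod I'') (M' × M'')}
    (h : IsProductStructure S' K S) (a : Fin 3) (p : M' × M'')
    (u : TangentSpace (I'.prod I'') p) :
    S.η a p u = S'.η a p.1 (mfderiv (I'.prod I'') I' Prod.fst p u) := by
  rw [h.η, h.metric, h.ξ_fst, h.ξ_snd, map_zero, add_zero]
  exact (S'.component a).metric_ξ p.1 _

theorem IsProductStructure.dη_eq [I'.Boundaryless] [I''.Boundaryless]
    {S' : AlmostContactMetric3 I' M'}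
    {K : AlmostHyperHermitian I'' M''} {S : AlmostContactMetric3 (I'.prod I'') (M' × M'')}
    (h : IsProductStructure S' K S) (a : Fin 3) (p : M' × M'') :
    (S.component a).dη p = pullForm (I := I'.prod I'') Prod.fst (S'.component a).dη p := by
  have h1 : (S.component a).ηForm =
      pullForm (I := I'.prod I'') Prod.fst (S'.component a).ηForm := by
    funext q
    ext v
    exact h.η_fst a q (v 0)
  unfold AlmostContactMetric.dη
  rw [h1]
  exact extDerivM_pullForm contMDiffAt_fst
    (((S'.component a).contDiffAt_locForm_ηForm p.1).differentiableAt (by simp))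

/-- A product of structure maps is a structure map. -/
theorem IsProductStructure.isStructureMap {S' : AlmostContactMetric3 I' M'}
    {K : AlmostHyperHermitian I'' M''} {S : AlmostContactMetric3 (I'.prod I'') (M' × M'')}
    (h : IsProductStructure S' K S) {f' : M' → M'} {f'' : M'' → M''}
    (hf' : S'.IsStructureMap S' f') (hf'' : K.IsStructureMap K f'') :
    S.IsStructureMap S (Prod.map f' f'') := by
  have hf := hf'.contMDiff.prodMap hf''.contMDiff
  have hd := fun p ↦ (hf p).mdifferentiableAt (by simp)
  have h1 : ∀ p (u : TangentSpace (I'.prod I'') p),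
      mfderiv (I'.prod I'') I' Prod.fst (Prod.map f' f'' p)
        (mfderiv (I'.prod I'') (I'.prod I'') (Prod.map f' f'') p u) =
      mfderiv I' I' f' p.1 (mfderiv (I'.prod I'') I' Prod.fst p u) := fun p u ↦
    (mfderiv_comp_apply (g := Prod.fst) p mdifferentiableAt_fst (hd p) u).symm.trans
      (mfderiv_comp_apply (f := Prod.fst) p ((hf'.contMDiff p.1).mdifferentiableAt (by simp))
        mdifferentiableAt_fst u)
  have h2 : ∀ p (u : TangentSpace (I'.prod I'') p),
      mfderiv (I'.prod I'') I'' Prod.snd (Prod.map f' f'' p)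
        (mfderiv (I'.prod I'') (I'.prod I'') (Prod.map f' f'') p u) =
      mfderiv I'' I'' f'' p.2 (mfderiv (I'.prod I'') I'' Prod.snd p u) := fun p u ↦
    (mfderiv_comp_apply (g := Prod.snd) p mdifferentiableAt_snd (hd p) u).symm.trans
      (mfderiv_comp_apply (f := Prod.snd) p ((hf''.contMDiff p.2).mdifferentiableAt (by simp))
        mdifferentiableAt_snd u)
  refine ⟨hf, fun p u v ↦ ?_, fun a p u ↦ tangent_prod_ext ?_ ?_,
    fun a p ↦ tangent_prod_ext ?_ ?_⟩
  · rw [h.metric, h.metric, h1, h1, h2, h2]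
    exact congrArg₂ (· + ·) (hf'.metric _ _ _) (hf''.metric _ _ _)
  · rw [h1, h.φ_fst, h.φ_fst, h1, hf'.φ]; rfl
  · rw [h2, h.φ_snd, h.φ_snd, h2, hf''.J]; rfl
  · rw [h1, h.ξ_fst, h.ξ_fst, hf'.ξ]; rfl
  · rw [h2, h.ξ_snd, h.ξ_snd, map_zero]

variable [I'.Boundaryless] [I''.Boundaryless]

/-- The product of a 3-Sasakian and a hyper-Kähler manifold is 3-quasi-Sasakian: the Nijenhuis
tensors, `dη` and `Φ` are all determined by their projections to the factors. -/
theorem IsProductStructure.isThreeQuasiSasakian {S' : AlmostContactMetric3 I' M'}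
    {K : AlmostHyperHermitian I'' M''} {S : AlmostContactMetric3 (I'.prod I'') (M' × M'')}
    (h : IsProductStructure S' K S) (hS' : S'.IsThreeSasakian) (hK : K.IsHyperKahler) :
    S.IsThreeQuasiSasakian := by
  have hI : IsManifold (I'.prod I'') 1 (M' × M'') := .of_le (n := ∞) (by simp)
  intro a
  have hQ := (hS' a).isQuasiSasakian
  constructor
  · rw [AlmostContactMetric.isNormal_iff]
    intro p u v
    have hN := (AlmostContactMetric.isNormal_iff _).1 hQ.1 p.1
    have hN' := (nijenhuis_eq_zero_iff (K.smooth_J a)).1 (hK a).1 p.2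
    have hdη : (S.component a).dη p ![u, v] = (S'.component a).dη p.1
        ![mfderiv (I'.prod I'') I' Prod.fst p u, mfderiv (I'.prod I'') I' Prod.fst p v] := by
      rw [h.dη_eq]
      exact congrArg ((S'.component a).dη p.1) (by ext i; fin_cases i <;> rfl)
    refine tangent_prod_ext ?_ ?_
    · rw [map_add, map_smul, map_zero, hdη]
      have h1 := mfderiv_nijAt (I := I'.prod I'') (f := Prod.fst) contMDiffAt_fst (S.smooth_φ a)
        (S'.smooth_φ a) (Filter.Eventually.of_forall (h.φ_fst a)) u v
      exact (congrArg₂ (fun b c ↦ b + _ • c) h1 (h.ξ_fst a p)).trans (hN _ _)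
    · rw [map_add, map_smul, map_zero]
      have h1 := mfderiv_nijAt (I := I'.prod I'') (f := Prod.snd) contMDiffAt_snd (S.smooth_φ a)
        (K.smooth_J a) (Filter.Eventually.of_forall (h.φ_snd a)) u v
      refine (congrArg₂ (fun b c ↦ b + _ • c) (h1.trans (hN' _ _)) (h.ξ_snd a p)).trans ?_
      rw [smul_zero, zero_add]
  · intro p
    -- `Φ_a` is the sum of the pullbacks of `Φ'_a` and of the Kähler form `Ω_a`
    have h1 : ∀ (p : M' × M'') (v : TangentSpace (I'.prod I'') p),
        pullMetric (I := I'.prod I'') Prod.fst S'.metric.inner p v (S.φ a p v) = 0 := by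
      intro p v
      refine (congrArg (S'.metric.inner p.1 (mfderiv (I'.prod I'') I' Prod.fst p v))
        (h.φ_fst a p v)).trans ?_
      exact (S'.component a).metric_φ_self p.1 _
    have h2 : ∀ (p : M' × M'') (v : TangentSpace (I'.prod I'') p),
        pullMetric (I := I'.prod I'') Prod.snd K.metric.inner p v (S.φ a p v) = 0 := by
      intro p v
      refine (congrArg (K.metric.inner p.2 (mfderiv (I'.prod I'') I'' Prod.snd p v))
        (h.φ_snd a p v)).trans ?_
      exact K.metric_J_self a p.2 _
    have e1 : pullForm (I := I'.prod I'') Prod.fst (S'.component a).fundamentalForm =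
        fun p ↦ twoForm (E := E' × E'') (pullMetric (I := I'.prod I'') Prod.fst S'.metric.inner p)
          (S.φ a p) (h1 p) := by
      funext p
      ext v
      exact congrArg (S'.metric.inner p.1 (mfderiv (I'.prod I'') I' Prod.fst p (v 0)))
        (h.φ_fst a p (v 1)).symm
    have e2 : pullForm (I := I'.prod I'') Prod.snd (K.fundamentalForm a) =
        fun p ↦ twoForm (E := E' × E'') (pullMetric (I := I'.prod I'') Prod.snd K.metric.inner p)
          (S.φ a p) (h2 p) := by
      funext p
      ext v
      exact congrArg (K.metric.inner p.2 (mfderiv (I'.prod I'') I'' Prod.snd p (v 0)))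
        (h.φ_snd a p (v 1)).symm
    have d1 : ContDiffAt ℝ ∞ (locForm (pullForm (I := I'.prod I'') Prod.fst
        (S'.component a).fundamentalForm) p) (extChartAt (I'.prod I'') p p) := by
      rw [e1]
      exact contDiffAt_locForm_twoForm h1
        (contDiffAt_locBilin_pullback contMDiffAt_fst (smoothBilin_iff.1 S'.metric.contMDiff p.1)
          (Filter.Eventually.of_forall fun _ _ _ ↦ rfl)) (smoothEndo_iff.1 (S.smooth_φ a) p)
    have d2 : ContDiffAt ℝ ∞ (locForm (pullForm (I := I'.prod I'') Prod.snd
        (K.fundamentalForm a)) p) (extChartAt (I'.prod I'') p p) := by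
      rw [e2]
      exact contDiffAt_locForm_twoForm h2
        (contDiffAt_locBilin_pullback contMDiffAt_snd (smoothBilin_iff.1 K.metric.contMDiff p.2)
          (Filter.Eventually.of_forall fun _ _ _ ↦ rfl)) (smoothEndo_iff.1 (S.smooth_φ a) p)
    have e3 : (S.component a).fundamentalForm = fun p ↦
        pullForm (I := I'.prod I'') Prod.fst (S'.component a).fundamentalForm p +
          pullForm (I := I'.prod I'') Prod.snd (K.fundamentalForm a) p := by
      funext p
      rw [e1, e2]
      ext v
      exact h.metric p (v 0) (S.φ a p (v 1))
    have z1 := extDerivM_pullForm (I := I'.prod I'') (f := Prod.fst) (x := p) contMDiffAt_fst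
      (((S'.component a).contDiffAt_locForm_fundamentalForm p.1).differentiableAt (by simp))
    have z2 := extDerivM_pullForm (I := I'.prod I'') (f := Prod.snd) (x := p) contMDiffAt_snd
      ((K.contDiffAt_locForm_fundamentalForm a p.2).differentiableAt (by simp))
    -- pullbacks of closed forms are closed
    have z1' : extDerivM (I'.prod I'') (pullForm (I := I'.prod I'') Prod.fst
        (S'.component a).fundamentalForm) p = 0 := by
      rw [z1]; unfold pullForm; rw [hQ.2]; rfl
    have z2' : extDerivM (I'.prod I'') (pullForm (I := I'.prod I'') Prod.snd
        (K.fundamentalForm a)) p = 0 := by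
      rw [z2]; unfold pullForm; rw [(hK a).2]; rfl
    rw [e3, extDerivM_add (d1.differentiableAt (by simp)) (d2.differentiableAt (by simp)), z1', z2',
      add_zero]

/-- `η_a` and `dη_a` are the pullbacks of `η'_a` and `dη'_a` by the projection to the first factor,
whose derivative is surjective, so the rank is that of the Sasakian structure of `M'`. -/
theorem IsProductStructure.hasRank [FiniteDimensional ℝ E'] {S' : AlmostContactMetric3 I' M'}
    {K : AlmostHyperHermitian I'' M''} {S : AlmostContactMetric3 (I'.prod I'') (M' × M'')}
    (h : IsProductStructure S' K S) (hS' : S'.IsThreeSasakian) {p : ℕ}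
    (hp : finrank ℝ E' = 2 * p + 1) : S.HasRank (2 * p + 1) := by
  refine fun a ↦ ⟨p, Or.inr ⟨rfl, fun q ↦ ?_⟩⟩
  obtain ⟨h1, h2⟩ := (hS' a).rank hp q.1
  let A : TangentSpace (I'.prod I'') q →ₗ[ℝ] TangentSpace I' q.1 :=
    (mfderiv (I'.prod I'') I' Prod.fst q).toLinearMap
  have hA : Function.Surjective A := fun u ↦ ⟨((u : E'), (0 : E'')), by
    change mfderiv (I'.prod I'') I' Prod.fst q _ = u
    rw [mfderiv_fst]; rfl⟩
  have hη : ((S.component a).ηForm q).toAlternatingMap =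
      ((S'.component a).ηForm q.1).toAlternatingMap.compLinearMap A := by
    ext v
    exact h.η_fst a q (v 0)
  have hdη : ((S.component a).dη q).toAlternatingMap =
      ((S'.component a).dη q.1).toAlternatingMap.compLinearMap A := by
    rw [h.dη_eq]; rfl
  rw [hη, hdη]
  refine ⟨fun h0 ↦ h1 ((wedge_wedgePow_compLinearMap_eq_zero_iff hA _ _ _).1 h0), ?_⟩
  rw [wedgePow_compLinearMap, h2]
  rfl

/-- The rank of the product is the dimension `4l + 3 = 2(2l + 1) + 1` of the first factor. -/
theorem IsProductStructure.hasRank_of_finrank [FiniteDimensional ℝ E']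
    {S' : AlmostContactMetric3 I' M'}
    {K : AlmostHyperHermitian I'' M''} {S : AlmostContactMetric3 (I'.prod I'') (M' × M'')}
    (h : IsProductStructure S' K S) (hS' : S'.IsThreeSasakian) {l : ℕ}
    (hl : finrank ℝ E' = 4 * l + 3) : S.HasRank (4 * l + 3) := by
  have h1 : 4 * l + 3 = 2 * (2 * l + 1) + 1 := by ring
  rw [h1]
  exact h.hasRank hS' (hl.trans h1)

end ProductTensors

section Product

variable {E' : Type*} [NormedAddCommGroup E'] [NormedSpace ℝ E'] [FiniteDimensional ℝ E']
  {H' : Type*} [TopologicalSpace H'] {I' : ModelWithCorners ℝ E' H'}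
  {M' : Type*} [TopologicalSpace M'] [ChartedSpace H' M'] [IsManifold I' ∞ M'] [I'.Boundaryless]
  {E'' : Type*} [NormedAddCommGroup E''] [NormedSpace ℝ E''] [FiniteDimensional ℝ E'']
  {H'' : Type*} [TopologicalSpace H''] {I'' : ModelWithCorners ℝ E'' H''}
  {M'' : Type*} [TopologicalSpace M''] [ChartedSpace H'' M''] [IsManifold I'' ∞ M'']
  [I''.Boundaryless]

/-- The product of two Riemannian metrics. -/
def prodMetric (g' : Metric I' M') (g'' : Metric I'' M'') :
    Metric (I'.prod I'') (M' × M'') :=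
  mkMetric (fun p ↦ pullMetric (I := I'.prod I'') Prod.fst g'.inner p +
      pullMetric (I := I'.prod I'') Prod.snd g''.inner p)
    (fun p u v ↦ congrArg₂ (· + ·) (g'.symm p.1 _ _) (g''.symm p.2 _ _))
    (fun p v hv ↦ by
      have h0 : ∀ w, 0 ≤ g'.inner p.1 w w := fun w ↦ by
        rcases eq_or_ne w 0 with rfl | h
        · simp
        · exact (g'.pos p.1 w h).le
      have h1 : ∀ w, 0 ≤ g''.inner p.2 w w := fun w ↦ by
        rcases eq_or_ne w 0 with rfl | h
        · simp
        · exact (g''.pos p.2 w h).le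
      by_cases h : mfderiv (I'.prod I'') I' Prod.fst p v = 0
      · refine add_pos_of_nonneg_of_pos (h0 _) (g''.pos p.2 _ fun h' ↦ hv ?_)
        exact tangent_prod_ext (h.trans (map_zero _).symm) (h'.trans (map_zero _).symm)
      · exact add_pos_of_pos_of_nonneg (g'.pos p.1 _ h) (h1 _))
    (fun p ↦ contDiffAt_locBilin_add
      (contDiffAt_locBilin_pullback contMDiffAt_fst (smoothBilin_iff.1 g'.contMDiff p.1)
        (Filter.Eventually.of_forall fun _ _ _ ↦ rfl))
      (contDiffAt_locBilin_pullback contMDiffAt_snd (smoothBilin_iff.1 g''.contMDiff p.2)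
        (Filter.Eventually.of_forall fun _ _ _ ↦ rfl)))

theorem prodMetric_apply (g' : Metric I' M') (g'' : Metric I'' M'') (p : M' × M'')
    (u v : TangentSpace (I'.prod I'') p) : (prodMetric g' g'').inner p u v =
      g'.inner p.1 (mfderiv (I'.prod I'') I' Prod.fst p u) (mfderiv (I'.prod I'') I' Prod.fst p v)
      + g''.inner p.2 (mfderiv (I'.prod I'') I'' Prod.snd p u)
        (mfderiv (I'.prod I'') I'' Prod.snd p v) := rfl

/-- The product of a 3-structure and an almost hyper-Hermitian structure. -/
def prodStructure (S' : AlmostContactMetric3 I' M') (K : AlmostHyperHermitian I'' M'') :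
    AlmostContactMetric3 (I'.prod I'') (M' × M'') where
  metric := prodMetric S'.metric K.metric
  φ a := prodEndo (S'.φ a) (K.J a)
  ξ a := prodField (S'.ξ a)
  η a p := (S'.η a p.1 : E' →L[ℝ] ℝ) ∘L (mfderiv (I'.prod I'') I' Prod.fst p : E' × E'' →L[ℝ] E')
  smooth_φ a := smoothEndo_prod (S'.smooth_φ a) (K.smooth_J a) (mfderiv_fst_prodEndo _ _)
    (mfderiv_snd_prodEndo _ _)
  smooth_ξ a p := smoothFieldAt_prod (X'' := fun _ ↦ 0) (S'.smooth_ξ a p.1)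
    (smoothFieldAt_iff.2 (contDiffAt_const (c := (0 : E'')) |>.congr_of_eventuallyEq
      (Filter.Eventually.of_forall fun z ↦
        map_zero (chartD I'' p.2 ((extChartAt I'' p.2).symm z)))))
    (mfderiv_fst_prodField _) (mfderiv_snd_prodField _)
  smooth_η a := smoothOneForm_iff.2 fun p ↦ contDiffAt_locCovector_pullback contMDiffAt_fst
    (smoothOneForm_iff.1 (S'.smooth_η a) p.1) (Filter.Eventually.of_forall fun _ _ ↦ rfl)
  φ_φ_self a p v := by
    refine tangent_prod_ext ?_ ?_
    · rw [map_add, map_neg, map_smul, mfderiv_fst_prodEndo, mfderiv_fst_prodEndo,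
        mfderiv_fst_prodField, S'.φ_φ_self]; rfl
    · rw [map_add, map_neg, map_smul, mfderiv_snd_prodEndo, mfderiv_snd_prodEndo,
        mfderiv_snd_prodField, K.J_J_self, smul_zero, add_zero]
  η_ξ_self a p :=
    (congrArg (S'.η a p.1) (mfderiv_fst_prodField _ p)).trans (S'.η_ξ_self a p.1)
  compatible a p u v := by
    rw [prodMetric_apply, prodMetric_apply, mfderiv_fst_prodEndo, mfderiv_fst_prodEndo,
      mfderiv_snd_prodEndo, mfderiv_snd_prodEndo, S'.compatible, K.compatible, sub_add_eq_add_sub]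
    rfl
  φ_eq a p v := by
    refine tangent_prod_ext ?_ ?_
    · rw [map_sub, map_smul, mfderiv_fst_prodEndo, mfderiv_fst_prodEndo,
        mfderiv_fst_prodEndo, mfderiv_fst_prodField, S'.φ_eq]; rfl
    · rw [map_sub, map_smul, mfderiv_snd_prodEndo, mfderiv_snd_prodEndo,
        mfderiv_snd_prodEndo, mfderiv_snd_prodField, K.J_eq, smul_zero, sub_zero]
  φ_eq' a p v := by
    refine tangent_prod_ext ?_ ?_
    · rw [map_add, map_neg, map_smul, mfderiv_fst_prodEndo, mfderiv_fst_prodEndo,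
        mfderiv_fst_prodEndo, mfderiv_fst_prodField, S'.φ_eq']; rfl
    · rw [map_add, map_neg, map_smul, mfderiv_snd_prodEndo, mfderiv_snd_prodEndo,
        mfderiv_snd_prodEndo, mfderiv_snd_prodField, K.J_eq', smul_zero, add_zero]
  ξ_eq a p := by
    refine tangent_prod_ext ?_ ?_
    · rw [mfderiv_fst_prodEndo, mfderiv_fst_prodField, mfderiv_fst_prodField, S'.ξ_eq]
    · rw [mfderiv_snd_prodEndo, mfderiv_snd_prodField, mfderiv_snd_prodField, map_zero]
  ξ_eq' a p := by
    refine tangent_prod_ext ?_ ?_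
    · rw [map_neg, mfderiv_fst_prodEndo, mfderiv_fst_prodField, mfderiv_fst_prodField, S'.ξ_eq']
    · rw [map_neg, mfderiv_snd_prodEndo, mfderiv_snd_prodField, mfderiv_snd_prodField, map_zero,
        neg_zero]
  η_eq a p v := (S'.η_eq a p.1 _).trans
    (congrArg (S'.η a p.1) (mfderiv_fst_prodEndo _ _ p v).symm)
  η_eq' a p v := (S'.η_eq' a p.1 _).trans
    (congrArg (fun u ↦ -S'.η (a + 1) p.1 u) (mfderiv_fst_prodEndo _ _ p v).symm)

theorem isProductStructure_prodStructure (S' : AlmostContactMetric3 I' M')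
    (K : AlmostHyperHermitian I'' M'') : IsProductStructure S' K (prodStructure S' K) where
  metric _ _ _ := rfl
  ξ_fst _ p := mfderiv_fst_prodField _ p
  ξ_snd _ p := mfderiv_snd_prodField _ p
  φ_fst _ p u := mfderiv_fst_prodEndo _ _ p u
  φ_snd _ p u := mfderiv_snd_prodEndo _ _ p u
  η a p u := (((prodStructure S' K).component a).metric_ξ p u).symm

end Product

/-! ### Smooth structures on the target of a local homeomorphism -/

section LocalHomeomorph

variable {E : Type*} [NormedAddCommGroup E] [NormedSpace ℝ E]
  {H : Type*} [TopologicalSpace H] {I : ModelWithCorners ℝ E H}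
  {M : Type*} [TopologicalSpace M] [ChartedSpace H M]
  {N : Type*} [TopologicalSpace N] {f : M → N} (hf : IsLocalHomeomorph f)
  {g : N → M} (hg : Function.RightInverse g f)

variable (I f) in
/-- The fibres of `f` are the orbits of smooth maps commuting with `f`. -/
def HasSmoothDeckMaps : Prop :=
  ∀ x y : M, f x = f y → ∃ h : M → M, ContMDiff I I ∞ h ∧ h x = y ∧ ∀ z, f (h z) = f z

variable {hf}

/-- A local section of `f` after `f` is locally a deck map, hence smooth. -/
theorem contMDiffAt_localInverseAt_comp (hdeck : HasSmoothDeckMaps I f) {z x : M}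
    (hx : f x ∈ (hf.localInverseAt z).source) :
    ContMDiffAt I I ∞ (fun y ↦ hf.localInverseAt z (f y)) x := by
  obtain ⟨h, hh, hhx, hfh⟩ := hdeck x (hf.localInverseAt z (f x))
    (hf.apply_localInverseAt_of_mem hx).symm
  refine (hh x).congr_of_eventuallyEq ?_
  have h1 : ∀ᶠ y in 𝓝 x, h y ∈ (hf.localInverseAt z).target := by
    refine hh.continuous.continuousAt.eventually ((hf.localInverseAt z).open_target.mem_nhds ?_)
    rw [hhx]
    exact (hf.localInverseAt z).map_source hx
  filter_upwards [h1] with y hy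
  have h2 := (hf.localInverseAt z).right_inv hy
  rw [hf.localInverseAt_symm, hfh] at h2
  exact h2

variable [I.Boundaryless] [IsManifold I ∞ M]

/-- The charts of the target of a local homeomorphism with smooth deck maps are the charts of the
source after local sections. Their transition functions are smooth because a local section of one
chart after `f` is locally a deck map. -/
theorem isManifold_chartedSpaceOfRightInverse (hdeck : HasSmoothDeckMaps I f) :
    letI := hf.chartedSpaceOfRightInverse (H := H) hg
    IsManifold I ∞ N := by
  let _ := hf.chartedSpaceOfRightInverse (H := H) hg
  refine isManifold_of_contDiffOn I ∞ N ?_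
  rintro _ _ ⟨q, rfl⟩ ⟨q', rfl⟩ w ⟨hw, -⟩
  refine ContDiffAt.contDiffWithinAt ?_
  set c := extChartAt I (g q) with hc
  set c' := extChartAt I (g q') with hc'
  set σ := hf.localInverseAt (g q) with hσ
  set σ' := hf.localInverseAt (g q') with hσ'
  simp only [mfld_simps] at hw
  obtain ⟨⟨hw1, -⟩, hw2, hw3⟩ := hw
  rw [hσ, hf.localInverseAt_symm] at hw2 hw3
  replace hw1 : w ∈ c.target := by
    rw [hc, extChartAt_target]
    exact ⟨hw1, by simp [I.range_eq_univ]⟩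
  replace hw2 : f (c.symm w) ∈ σ'.source := hw2
  replace hw3 : σ' (f (c.symm w)) ∈ (chartAt H (g q')).source := hw3
  -- the transition function is `c' ∘ (σ' ∘ f) ∘ c⁻¹`
  have e1 : ContMDiffAt 𝓘(ℝ, E) I ∞ c.symm w :=
    (contMDiffOn_extChartAt_symm (I := I) (n := ∞) (g q)).contMDiffAt
      ((isOpen_extChartAt_target (I := I) (g q)).mem_nhds hw1)
  have e2 : ContMDiffAt I I ∞ (fun y ↦ σ' (f y)) (c.symm w) :=
    contMDiffAt_localInverseAt_comp hdeck hw2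
  have e3 : ContMDiffAt I 𝓘(ℝ, E) ∞ c' (σ' (f (c.symm w))) := contMDiffAt_extChartAt' hw3
  have e4 : ContMDiffAt 𝓘(ℝ, E) 𝓘(ℝ, E) ∞ (fun v ↦ c' (σ' (f (c.symm v)))) w :=
    e3.comp w (e2.comp w e1)
  refine e4.contDiffAt.congr_of_eventuallyEq (Filter.Eventually.of_forall fun v ↦ ?_)
  simp [hc, hc', hσ, hσ', mfld_simps]

theorem isLocalDiffeomorph_chartedSpaceOfRightInverse (hdeck : HasSmoothDeckMaps I f) :
    letI := hf.chartedSpaceOfRightInverse (H := H) hg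
    IsLocalDiffeomorph I I ∞ f := by
  let _ := hf.chartedSpaceOfRightInverse (H := H) hg
  have hext : ∀ q : N, ∀ y, extChartAt I q y = extChartAt I (g q) (hf.localInverseAt (g q) y) :=
    fun q y ↦ rfl
  have hsymm : ∀ q : N, ∀ w, (extChartAt I q).symm w = f ((extChartAt I (g q)).symm w) :=
    fun q w ↦ by rw [← hf.localInverseAt_symm (x := g q)]; rfl
  have hsrc : ∀ q : N, q ∈ (hf.localInverseAt (g q)).source := fun q ↦ by
    have := hf.apply_self_mem_localInverseAt_source (x := g q)
    rwa [hg q] at this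
  have hsrc' : ∀ q : N, hf.localInverseAt (g q) q ∈ (chartAt H (g q)).source := fun q ↦ by
    have h := mem_chart_source H q
    change q ∈ ((hf.localInverseAt (g q)).trans (chartAt H (g q))).source at h
    rw [OpenPartialHomeomorph.trans_source] at h
    exact h.2
  have hsm : ContMDiff I I ∞ f := by
    intro x
    rw [contMDiffAt_iff_target]
    refine ⟨hf.continuous.continuousAt, ?_⟩
    exact ContMDiffAt.comp (g := extChartAt I (g (f x)))
      (f := fun y ↦ hf.localInverseAt (g (f x)) (f y)) x
      (contMDiffAt_extChartAt' (hsrc' (f x)))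
      (contMDiffAt_localInverseAt_comp hdeck (hsrc (f x)))
  have hinv : ∀ (z : M) (y : N), y ∈ (hf.localInverseAt z).source →
      ContMDiffAt I I ∞ (hf.localInverseAt z) y := by
    intro z y hy
    rw [contMDiffAt_iff_source, I.range_eq_univ, contMDiffWithinAt_univ]
    have h0 : (extChartAt I (g y)).symm (extChartAt I y y) = hf.localInverseAt (g y) y := by
      rw [hext]
      exact (extChartAt I (g y)).left_inv (by rw [extChartAt_source]; exact hsrc' y)
    have e1 : ContMDiffAt 𝓘(ℝ, E) I ∞ (extChartAt I (g y)).symm (extChartAt I y y) :=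
      (contMDiffOn_extChartAt_symm (I := I) (n := ∞) (g y)).contMDiffAt
        ((isOpen_extChartAt_target (I := I) (g y)).mem_nhds (by
          rw [hext]
          exact (extChartAt I (g y)).map_source (by rw [extChartAt_source]; exact hsrc' y)))
    have e2 : ContMDiffAt I I ∞ (fun x ↦ hf.localInverseAt z (f x))
        ((extChartAt I (g y)).symm (extChartAt I y y)) :=
      contMDiffAt_localInverseAt_comp hdeck (by
        rw [h0, hf.apply_localInverseAt_of_mem (hsrc y)]; exact hy)
    refine (e2.comp _ e1).congr_of_eventuallyEq (Filter.Eventually.of_forall fun w ↦ ?_)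
    exact congrArg (hf.localInverseAt z) (hsymm y w)
  intro x
  refine ⟨⟨(hf.localInverseAt x).symm.toPartialEquiv, (hf.localInverseAt x).open_target,
    (hf.localInverseAt x).open_source, ?_, fun y hy ↦ (hinv x y hy).contMDiffWithinAt⟩,
    hf.self_mem_localInverseAt_target, ?_⟩
  · have : ((hf.localInverseAt x).symm : M → N) = f := hf.localInverseAt_symm x
    change ContMDiffOn I I ∞ (hf.localInverseAt x).symm _
    rw [this]
    exact hsm.contMDiffOn
  · intro y hy
    exact (congrFun (hf.localInverseAt_symm x) y).symm

end LocalHomeomorph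

/-! ### Descent of tensor fields along local diffeomorphisms -/

section Descent

variable {E : Type*} [NormedAddCommGroup E] [NormedSpace ℝ E]
  {H : Type*} [TopologicalSpace H] {I : ModelWithCorners ℝ E H}
  {M : Type*} [TopologicalSpace M] [ChartedSpace H M]
  {N : Type*} [TopologicalSpace N] [ChartedSpace H N] {f : M → N}

theorem mfderiv_deck (hf : IsLocalDiffeomorph I I ∞ f) {h : M → M} {x : M}
    (hh : MDifferentiableAt I I h x) (hfh : ∀ z, f (h z) = f z) (u : E) :
    (mfderiv I I f (h x) (mfderiv I I h x u : E) : E) = mfderiv I I f x u := by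
  have h1 := mfderiv_comp_apply (I := I) (I' := I) (I'' := I) (g := f) (f := h) x
    ((hf (h x)).mdifferentiableAt (by simp)) hh u
  have h2 : f ∘ h = f := funext hfh
  rw [h2] at h1
  exact h1.symm

variable [I.Boundaryless] [IsManifold I ∞ M] [IsManifold I ∞ N]

/-- A local diffeomorphism has smooth local sections, whose derivatives invert its derivative. -/
theorem mfderiv_localInverse {x : M} (hf : IsLocalDiffeomorphAt I I ∞ f x) :
    ∃ σ : N → M, ContMDiffAt I I ∞ σ (f x) ∧ σ (f x) = x ∧
      (fderiv ℝ (localRep I I σ (f x)) (extChartAt I (f x) (f x))).IsInvertible ∧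
      ∀ᶠ y in 𝓝 (f x), f (σ y) = y ∧
        (∀ u : E, (mfderiv I I σ y (mfderiv I I f (σ y) u : E) : E) = u) ∧
        ∀ u : E, (mfderiv I I f (σ y) (mfderiv I I σ y u : E) : E) = u := by
  obtain ⟨Φ, hx, hΦ⟩ := hf
  have hfx : f x = Φ x := hΦ hx
  have hnhds : ∀ y ∈ Φ.target, Φ.target ∈ 𝓝 y := fun y hy ↦ Φ.open_target.mem_nhds hy
  have hfx' : f x ∈ Φ.target := by rw [hfx]; exact Φ.map_source hx
  have hσx : Φ.symm (f x) = x := by rw [hfx]; exact Φ.left_inv hx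
  have hσ : ∀ y ∈ Φ.target, ContMDiffAt I I ∞ Φ.symm y := fun y hy ↦
    Φ.contMDiffOn_invFun.contMDiffAt (hnhds y hy)
  have hfs : ∀ z ∈ Φ.source, ContMDiffAt I I ∞ f z := fun z hz ↦
    (Φ.contMDiffOn_toFun.congr hΦ).contMDiffAt (Φ.open_source.mem_nhds hz)
  have hmem : ∀ y ∈ Φ.target, Φ.symm y ∈ Φ.source := fun y hy ↦ Φ.map_target hy
  have hr : ∀ y ∈ Φ.target, f (Φ.symm y) = y := fun y hy ↦
    (hΦ (hmem y hy)).trans (Φ.right_inv hy)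
  have hl : ∀ z ∈ Φ.source, Φ.symm (f z) = z := fun z hz ↦ by
    rw [hΦ hz]; exact Φ.left_inv hz
  have hA : ∀ y ∈ Φ.target, ∀ u : E,
      (mfderiv I I Φ.symm y (mfderiv I I f (Φ.symm y) u : E) : E) = u := by
    intro y hy u
    have h1 : (fun z ↦ Φ.symm (f z)) =ᶠ[𝓝 (Φ.symm y)] id := by
      filter_upwards [Φ.open_source.mem_nhds (hmem y hy)] with z hz using hl z hz
    have h2 := mfderiv_comp_apply_of_eq (I := I) (I' := I) (I'' := I) (g := Φ.symm) (f := f)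
      (Φ.symm y) ((hσ y hy).mdifferentiableAt (by simp))
      ((hfs _ (hmem y hy)).mdifferentiableAt (by simp)) (hr y hy) u
    exact h2.symm.trans ((DFunLike.congr_fun h1.mfderiv_eq u).trans
      (DFunLike.congr_fun mfderiv_id u))
  have hB : ∀ y ∈ Φ.target, ∀ u : E,
      (mfderiv I I f (Φ.symm y) (mfderiv I I Φ.symm y u : E) : E) = u := by
    intro y hy u
    have h1 : (fun z ↦ f (Φ.symm z)) =ᶠ[𝓝 y] id := by
      filter_upwards [hnhds y hy] with z hz using hr z hz
    have h2 := mfderiv_comp_apply (I := I) (I' := I) (I'' := I) (g := f) (f := Φ.symm) y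
      ((hfs _ (hmem y hy)).mdifferentiableAt (by simp))
      ((hσ y hy).mdifferentiableAt (by simp)) u
    exact h2.symm.trans ((DFunLike.congr_fun h1.mfderiv_eq u).trans
      (DFunLike.congr_fun mfderiv_id u))
  refine ⟨Φ.symm, hσ _ hfx', hσx, ?_, ?_⟩
  · refine ⟨ContinuousLinearEquiv.equivOfInverse
      (fderiv ℝ (localRep I I Φ.symm (f x)) (extChartAt I (f x) (f x)))
      (mfderiv I I f (Φ.symm (f x)) : E →L[ℝ] E) (fun u ↦ ?_) (fun u ↦ ?_), rfl⟩
    · rw [← mfderiv_eq_fderiv_localRep (hσ _ hfx')]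
      exact hB _ hfx' u
    · rw [← mfderiv_eq_fderiv_localRep (hσ _ hfx')]
      exact hA _ hfx' u
  · filter_upwards [hnhds _ hfx'] with y hy
    exact ⟨hr y hy, hA y hy, hB y hy⟩

theorem exists_mfderiv_inverse {x : M} (hf : IsLocalDiffeomorphAt I I ∞ f x) :
    ∃ A : E →L[ℝ] E, (∀ u : E, A (mfderiv I I f x u : E) = u) ∧
      ∀ u : E, (mfderiv I I f x (A u) : E) = u := by
  obtain ⟨σ, -, hσ, -, h⟩ := mfderiv_localInverse hf
  have h1 := h.self_of_nhds
  refine ⟨mfderiv I I σ (f x), fun u ↦ ?_, fun u ↦ ?_⟩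
  · have := h1.2.1 u; rwa [hσ] at this
  · have := h1.2.2 u; rwa [hσ] at this

/-- Any two points `x, y` of a fibre of `f` are related by a deck map `h` with `P x h`. In the
applications `P x h` states that the derivative of `h` at `x` preserves a given tensor field. -/
def DeckInvariant (I : ModelWithCorners ℝ E H) (f : M → N) (P : M → (M → M) → Prop) : Prop :=
  ∀ x y : M, f x = f y → ∃ h : M → M, MDifferentiableAt I I h x ∧ h x = y ∧
    (∀ z, f (h z) = f z) ∧ P x h

/-- A covector field invariant under deck maps descends. On the target it is defined through a
set-theoretic section of `f`; invariance makes it independent of this choice, and smoothness then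
follows by pulling back along smooth local sections. The same argument applies to metrics,
endomorphisms and vector fields. -/
theorem exists_descendCovector (hf : IsLocalDiffeomorph I I ∞ f) (hsurj : Function.Surjective f)
    {η : (x : M) → TangentSpace I x →L[ℝ] ℝ} (hη : SmoothOneForm I η)
    (hdeck : DeckInvariant I f fun x h ↦ ∀ u, η (h x) (mfderiv I I h x u) = η x u) :
    ∃ ζ : (y : N) → TangentSpace I y →L[ℝ] ℝ, SmoothOneForm I ζ ∧
      ∀ x u, ζ (f x) (mfderiv I I f x u) = η x u := by
  choose g hg using hsurj
  choose A hA hA' using fun x ↦ exists_mfderiv_inverse (hf x)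
  let ζ : (y : N) → TangentSpace I y →L[ℝ] ℝ := fun y ↦
    ((η (g y) : E →L[ℝ] ℝ) ∘L A (g y) : E →L[ℝ] ℝ)
  have hrel : ∀ x u, ζ (f x) (mfderiv I I f x u) = η x u := by
    intro x u
    obtain ⟨h, hh, hx, hfh, hP⟩ := hdeck x (g (f x)) (hg _).symm
    have h1 : A (g (f x)) (mfderiv I I f x u : E) = mfderiv I I h x u := by
      refine (congrArg (A (g (f x))) (mfderiv_deck hf hh hfh u).symm).trans ?_
      rw [hx]
      exact hA _ _
    refine (congrArg (η (g (f x)) : E → ℝ) h1).trans (Eq.trans ?_ (hP u))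
    rw [hx]
  refine ⟨ζ, smoothOneForm_iff.2 fun q ↦ ?_, hrel⟩
  obtain ⟨x, rfl⟩ : ∃ x, f x = q := ⟨g q, hg q⟩
  obtain ⟨σ, hσ, hσx, -, hev⟩ := mfderiv_localInverse (hf x)
  refine contDiffAt_locCovector_pullback hσ (smoothOneForm_iff.1 hη _) ?_
  filter_upwards [hev] with y hy u
  obtain ⟨h1, -, h3⟩ := hy
  refine Eq.trans ?_ (hrel (σ y) (mfderiv I I σ y u : E))
  rw [h1]
  exact congrArg (ζ y : E → ℝ) (h3 u).symm

theorem exists_descendMetric [FiniteDimensional ℝ E] (hf : IsLocalDiffeomorph I I ∞ f)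
    (hsurj : Function.Surjective f) (k : Metric I M)
    (hdeck : DeckInvariant I f fun x h ↦
      ∀ u v, k.inner (h x) (mfderiv I I h x u) (mfderiv I I h x v) = k.inner x u v) :
    ∃ l : Metric I N,
      ∀ x u v, l.inner (f x) (mfderiv I I f x u) (mfderiv I I f x v) = k.inner x u v := by
  choose g hg using hsurj
  choose A hA hA' using fun x ↦ exists_mfderiv_inverse (hf x)
  let l : (y : N) → TangentSpace I y →L[ℝ] TangentSpace I y →L[ℝ] ℝ := fun y ↦
    pullBilin (E := E) (F := E) (k.inner (g y)) (A (g y))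
  have hrel : ∀ x u v, l (f x) (mfderiv I I f x u) (mfderiv I I f x v) = k.inner x u v := by
    intro x u v
    obtain ⟨h, hh, hx, hfh, hP⟩ := hdeck x (g (f x)) (hg _).symm
    have h1 : ∀ u : E, A (g (f x)) (mfderiv I I f x u : E) = mfderiv I I h x u := fun u ↦ by
      refine (congrArg (A (g (f x))) (mfderiv_deck hf hh hfh u).symm).trans ?_
      rw [hx]
      exact hA _ _
    refine (congrArg₂ (fun a b : E ↦ (k.inner (g (f x)) : E →L[ℝ] E →L[ℝ] ℝ) a b)
      (h1 u) (h1 v)).trans (Eq.trans ?_ (hP u v))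
    rw [hx]
  have hpos : ∀ (x : M) (v : TangentSpace I (f x)), v ≠ 0 → 0 < l (f x) v v := fun x v hv ↦ by
    have h1 : (mfderiv I I f x (A x v) : E) = v := hA' x v
    have h2 := hrel x (A x v) (A x v)
    have h3 : l (f x) (mfderiv I I f x (A x v)) (mfderiv I I f x (A x v)) = l (f x) v v :=
      congrArg₂ (fun a b : E ↦ (l (f x) : E →L[ℝ] E →L[ℝ] ℝ) a b) h1 h1
    rw [← h3, h2]
    refine k.pos x _ fun h0 ↦ hv ?_
    refine h1.symm.trans ((congrArg (mfderiv I I f x : E → E) h0).trans ?_)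
    exact map_zero (mfderiv I I f x)
  refine ⟨mkMetric l (fun y u v ↦ k.symm _ _ _) (fun q v hv ↦ ?_) fun q ↦ ?_, hrel⟩
  · obtain ⟨x, rfl⟩ : ∃ x, f x = q := ⟨g q, hg q⟩
    exact hpos x v hv
  obtain ⟨x, rfl⟩ : ∃ x, f x = q := ⟨g q, hg q⟩
  obtain ⟨σ, hσ, hσx, -, hev⟩ := mfderiv_localInverse (hf x)
  refine contDiffAt_locBilin_pullback hσ (smoothBilin_iff.1 k.contMDiff _) ?_
  filter_upwards [hev] with y hy u v
  obtain ⟨h1, -, h3⟩ := hy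
  refine Eq.trans ?_ (hrel (σ y) (mfderiv I I σ y u : E) (mfderiv I I σ y v : E))
  rw [h1]
  exact congrArg₂ (fun a b : E ↦ (l y : E →L[ℝ] E →L[ℝ] ℝ) a b) (h3 u).symm (h3 v).symm

variable [CompleteSpace E]

theorem exists_descendEndo (hf : IsLocalDiffeomorph I I ∞ f) (hsurj : Function.Surjective f)
    {φ : (x : M) → TangentSpace I x →L[ℝ] TangentSpace I x} (hφ : SmoothEndo I φ)
    (hdeck : DeckInvariant I f fun x h ↦
      ∀ u, mfderiv I I h x (φ x u) = φ (h x) (mfderiv I I h x u)) :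
    ∃ ψ : (y : N) → TangentSpace I y →L[ℝ] TangentSpace I y, SmoothEndo I ψ ∧
      ∀ x u, mfderiv I I f x (φ x u) = ψ (f x) (mfderiv I I f x u) := by
  choose g hg using hsurj
  choose A hA hA' using fun x ↦ exists_mfderiv_inverse (hf x)
  let ψ : (y : N) → TangentSpace I y →L[ℝ] TangentSpace I y := fun y ↦
    ((mfderiv I I f (g y) : E →L[ℝ] E) ∘L (φ (g y) : E →L[ℝ] E) ∘L A (g y) : E →L[ℝ] E)
  have hrel : ∀ x u, mfderiv I I f x (φ x u) = ψ (f x) (mfderiv I I f x u) := by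
    intro x u
    obtain ⟨h, hh, hx, hfh, hP⟩ := hdeck x (g (f x)) (hg _).symm
    have h1 : A (g (f x)) (mfderiv I I f x u : E) = mfderiv I I h x u := by
      refine (congrArg (A (g (f x))) (mfderiv_deck hf hh hfh u).symm).trans ?_
      rw [hx]
      exact hA _ _
    have h2 : (φ (g (f x)) (A (g (f x)) (mfderiv I I f x u : E)) : E) =
        mfderiv I I h x (φ x u) := by
      rw [h1, ← hx]
      exact (hP u).symm
    refine Eq.trans ?_ (congrArg (mfderiv I I f (g (f x)) : E → E) h2.symm)
    refine (mfderiv_deck hf hh hfh (φ x u)).symm.trans ?_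
    rw [hx]
  refine ⟨ψ, smoothEndo_iff.2 fun q ↦ ?_, hrel⟩
  obtain ⟨x, rfl⟩ : ∃ x, f x = q := ⟨g q, hg q⟩
  obtain ⟨σ, hσ, hσx, hinv, hev⟩ := mfderiv_localInverse (hf x)
  refine contDiffAt_locEndo_of_related hσ hinv (smoothEndo_iff.1 hφ _) ?_
  filter_upwards [hev] with y hy u
  obtain ⟨h1, h2, h3⟩ := hy
  have h4 := hrel (σ y) (mfderiv I I σ y u : E)
  have h5 : (mfderiv I I f (σ y) (φ (σ y) (mfderiv I I σ y u)) : E) = ψ y u := by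
    refine h4.trans ((congrArg (ψ (f (σ y)) : E → E) (h3 u)).trans ?_)
    rw [h1]
  exact (congrArg (mfderiv I I σ y : E → E) h5.symm).trans (h2 _)

theorem exists_descendField (hf : IsLocalDiffeomorph I I ∞ f) (hsurj : Function.Surjective f)
    {X : (x : M) → TangentSpace I x} (hX : ∀ x, SmoothFieldAt I X x)
    (hdeck : DeckInvariant I f fun x h ↦ mfderiv I I h x (X x) = X (h x)) :
    ∃ Y : (y : N) → TangentSpace I y, (∀ y, SmoothFieldAt I Y y) ∧
      ∀ x, mfderiv I I f x (X x) = Y (f x) := by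
  choose g hg using hsurj
  let Y : (y : N) → TangentSpace I y := fun y ↦ (mfderiv I I f (g y) (X (g y)) : E)
  have hrel : ∀ x, mfderiv I I f x (X x) = Y (f x) := by
    intro x
    obtain ⟨h, hh, hx, hfh, hP⟩ := hdeck x (g (f x)) (hg _).symm
    refine (mfderiv_deck hf hh hfh (X x)).symm.trans ?_
    refine (congrArg (mfderiv I I f (h x) : E → E) hP).trans ?_
    rw [hx]
  refine ⟨Y, fun q ↦ smoothFieldAt_iff.2 ?_, hrel⟩
  obtain ⟨x, rfl⟩ : ∃ x, f x = q := ⟨g q, hg q⟩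
  obtain ⟨σ, hσ, hσx, hinv, hev⟩ := mfderiv_localInverse (hf x)
  refine contDiffAt_locField_of_related hσ hinv (smoothFieldAt_iff.1 (hX _)) ?_
  filter_upwards [hev] with y hy
  obtain ⟨h1, h2, -⟩ := hy
  have h5 : (mfderiv I I f (σ y) (X (σ y)) : E) = Y y := by
    refine (hrel (σ y)).trans ?_
    rw [h1]
  exact (congrArg (mfderiv I I σ y : E → E) h5.symm).trans (h2 _)

end Descent

/-! ### Descent of geometric structures -/

section DescentOfStructures

variable {E : Type*} [NormedAddCommGroup E] [NormedSpace ℝ E]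
  {H : Type*} [TopologicalSpace H] {I : ModelWithCorners ℝ E H}
  {M : Type*} [TopologicalSpace M] [ChartedSpace H M] [IsManifold I ∞ M]
  {N : Type*} [TopologicalSpace N] [ChartedSpace H N] [IsManifold I ∞ N] {f : M → N}

theorem AlmostContactMetric3.IsStructureMap.η {S : AlmostContactMetric3 I M}
    {T : AlmostContactMetric3 I N} (h : S.IsStructureMap T f) (a : Fin 3) (x : M)
    (u : TangentSpace I x) : T.η a (f x) (mfderiv I I f x u) = S.η a x u := by
  refine ((T.component a).metric_ξ (f x) _).symm.trans (Eq.trans ?_ ((S.component a).metric_ξ x u))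
  refine Eq.trans ?_ (h.metric x u (S.ξ a x))
  rw [h.ξ]
  rfl

variable [I.Boundaryless]

theorem exists_mfderiv_eq (hf : IsLocalDiffeomorph I I ∞ f) (x : M) (v : TangentSpace I (f x)) :
    ∃ u, mfderiv I I f x u = v := by
  obtain ⟨A, -, hA⟩ := exists_mfderiv_inverse (hf x)
  exact ⟨A v, hA v⟩

/-- A map induced on the target of a local diffeomorphism by a structure map is a structure map. -/
theorem AlmostHyperHermitian.IsStructureMap.of_semiconj {K : AlmostHyperHermitian I M}
    {L : AlmostHyperHermitian I N} (h : K.IsStructureMap L f) (hf : IsLocalDiffeomorph I I ∞ f)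
    (hsurj : Function.Surjective f) {k : M → M} (hk : K.IsStructureMap K k) {F : N → N}
    (hF : Function.Semiconj f k F) : L.IsStructureMap L F := by
  have hFs : ContMDiff I I ∞ F := fun q ↦ by
    obtain ⟨x, rfl⟩ := hsurj q
    obtain ⟨σ, hσ, hσx, -, h1⟩ := mfderiv_localInverse (hf x)
    have h2 : ContMDiffAt I I ∞ (f ∘ k ∘ σ) (f x) :=
      (h.contMDiff _).comp (f x) ((hk.contMDiff _).comp (f x) hσ)
    refine h2.congr_of_eventuallyEq ?_
    filter_upwards [h1] with y hy
    have h3 := hF (σ y)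
    rw [hy.1] at h3
    exact h3.symm
  have hd : ∀ (x : M) (u : E), (mfderiv I I F (f x) (mfderiv I I f x u : E) : E) =
      mfderiv I I f (k x) (mfderiv I I k x u : E) := fun x u ↦ by
    have h1 := mfderiv_comp_apply (I := I) (I' := I) (I'' := I) (g := F) (f := f) x
      ((hFs (f x)).mdifferentiableAt (by simp)) ((h.contMDiff x).mdifferentiableAt (by simp)) u
    have h2 := mfderiv_comp_apply (I := I) (I' := I) (I'' := I) (g := f) (f := k) x
      ((h.contMDiff (k x)).mdifferentiableAt (by simp))
      ((hk.contMDiff x).mdifferentiableAt (by simp)) u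
    rw [← hF.comp_eq] at h1
    exact h1.symm.trans h2
  have hg : ∀ (y y' : N) (u v u' v' : E), y = y' → u = u' → v = v' →
      L.metric.inner y u v = L.metric.inner y' u' v' := by
    rintro _ _ _ _ _ _ rfl rfl rfl; rfl
  have hJ : ∀ a (y y' : N) (u u' : E), y = y' → u = u' → (L.J a y u : E) = L.J a y' u' := by
    rintro _ _ _ _ _ rfl rfl; rfl
  refine ⟨hFs, fun q v w ↦ ?_, fun a q v ↦ ?_⟩
  · obtain ⟨x, rfl⟩ := hsurj q
    obtain ⟨u, rfl⟩ := exists_mfderiv_eq hf x v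
    obtain ⟨u', rfl⟩ := exists_mfderiv_eq hf x w
    rw [h.metric, ← hk.metric, ← h.metric]
    exact hg _ _ _ _ _ _ (hF x).symm (hd x u) (hd x u')
  · obtain ⟨x, rfl⟩ := hsurj q
    obtain ⟨u, rfl⟩ := exists_mfderiv_eq hf x v
    rw [← h.J]
    refine (hd x _).trans ?_
    rw [hk.J, h.J]
    exact hJ a _ _ _ _ (hF x) (hd x u).symm

variable [FiniteDimensional ℝ E]

/-- A 3-structure invariant under the deck maps of a local diffeomorphism descends. -/
theorem AlmostContactMetric3.exists_descend (hf : IsLocalDiffeomorph I I ∞ f)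
    (hsurj : Function.Surjective f) (S : AlmostContactMetric3 I M)
    (hdeck : ∀ x y, f x = f y → ∃ h : M → M, S.IsStructureMap S h ∧ h x = y ∧ ∀ z, f (h z) = f z) :
    ∃ T : AlmostContactMetric3 I N, S.IsStructureMap T f := by
  have hc : CompleteSpace E := FiniteDimensional.complete ℝ E
  have hd : ∀ P : M → (M → M) → Prop, (∀ h x, S.IsStructureMap S h → P x h) →
      DeckInvariant I f P := fun P hP x y hxy ↦ by
    obtain ⟨h, h1, h2, h3⟩ := hdeck x y hxy
    exact ⟨h, (h1.contMDiff x).mdifferentiableAt (by simp), h2, h3, hP h x h1⟩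
  choose φ hφs hφ using fun a ↦ exists_descendEndo hf hsurj (S.smooth_φ a)
    (hd _ fun h x hh ↦ hh.φ a x)
  choose ξ hξs hξ using fun a ↦ exists_descendField hf hsurj (S.smooth_ξ a)
    (hd _ fun h x hh ↦ hh.ξ a x)
  choose η hηs hη using fun a ↦ exists_descendCovector hf hsurj (S.smooth_η a)
    (hd _ fun h x hh ↦ hh.η a x)
  obtain ⟨g, hg⟩ := exists_descendMetric hf hsurj S.metric (hd _ fun h x hh ↦ hh.metric x)
  refine ⟨⟨g, φ, ξ, η, hφs, hξs, hηs, ?_, ?_, ?_, ?_, ?_, ?_, ?_, ?_, ?_⟩, hf.contMDiff, hg, hφ, hξ⟩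
  · intro a q v
    obtain ⟨x, rfl⟩ := hsurj q
    obtain ⟨u, rfl⟩ := exists_mfderiv_eq hf x v
    rw [← hφ, ← hφ, S.φ_φ_self, hη, ← hξ, map_add, map_neg, map_smul]
  · intro a q
    obtain ⟨x, rfl⟩ := hsurj q
    rw [← hξ, hη, S.η_ξ_self]
  · intro a q v w
    obtain ⟨x, rfl⟩ := hsurj q
    obtain ⟨u, rfl⟩ := exists_mfderiv_eq hf x v
    obtain ⟨u', rfl⟩ := exists_mfderiv_eq hf x w
    rw [← hφ, ← hφ, hg, hg, hη, hη, S.compatible]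
  · intro a q v
    obtain ⟨x, rfl⟩ := hsurj q
    obtain ⟨u, rfl⟩ := exists_mfderiv_eq hf x v
    rw [← hφ, ← hφ, ← hφ, hη, ← hξ, S.φ_eq, map_sub, map_smul]
  · intro a q v
    obtain ⟨x, rfl⟩ := hsurj q
    obtain ⟨u, rfl⟩ := exists_mfderiv_eq hf x v
    rw [← hφ, ← hφ, ← hφ, hη, ← hξ, S.φ_eq', map_add, map_neg, map_smul]
  · intro a q
    obtain ⟨x, rfl⟩ := hsurj q
    rw [← hξ, ← hξ, ← hφ, S.ξ_eq]
  · intro a q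
    obtain ⟨x, rfl⟩ := hsurj q
    rw [← hξ, ← hξ, ← hφ, S.ξ_eq', map_neg]
  · intro a q v
    obtain ⟨x, rfl⟩ := hsurj q
    obtain ⟨u, rfl⟩ := exists_mfderiv_eq hf x v
    rw [← hφ, hη, hη, S.η_eq]
  · intro a q v
    obtain ⟨x, rfl⟩ := hsurj q
    obtain ⟨u, rfl⟩ := exists_mfderiv_eq hf x v
    rw [← hφ, hη, hη, S.η_eq']

/-- An almost hyper-Hermitian structure invariant under the deck maps of a local diffeomorphism
descends. -/
theorem AlmostHyperHermitian.exists_descend (hf : IsLocalDiffeomorph I I ∞ f)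
    (hsurj : Function.Surjective f) (K : AlmostHyperHermitian I M)
    (hdeck : ∀ x y, f x = f y → ∃ h : M → M, K.IsStructureMap K h ∧ h x = y ∧ ∀ z, f (h z) = f z) :
    ∃ L : AlmostHyperHermitian I N, K.IsStructureMap L f := by
  have hc : CompleteSpace E := FiniteDimensional.complete ℝ E
  have hd : ∀ P : M → (M → M) → Prop, (∀ h x, K.IsStructureMap K h → P x h) →
      DeckInvariant I f P := fun P hP x y hxy ↦ by
    obtain ⟨h, h1, h2, h3⟩ := hdeck x y hxy
    exact ⟨h, (h1.contMDiff x).mdifferentiableAt (by simp), h2, h3, hP h x h1⟩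
  choose J hJs hJ using fun a ↦ exists_descendEndo hf hsurj (K.smooth_J a)
    (hd _ fun h x hh ↦ hh.J a x)
  obtain ⟨g, hg⟩ := exists_descendMetric hf hsurj K.metric (hd _ fun h x hh ↦ hh.metric x)
  refine ⟨⟨g, J, hJs, ?_, ?_, ?_, ?_⟩, hf.contMDiff, hg, hJ⟩
  · intro a q v
    obtain ⟨x, rfl⟩ := hsurj q
    obtain ⟨u, rfl⟩ := exists_mfderiv_eq hf x v
    rw [← hJ, ← hJ, K.J_J_self, map_neg]
  · intro a q v w
    obtain ⟨x, rfl⟩ := hsurj q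
    obtain ⟨u, rfl⟩ := exists_mfderiv_eq hf x v
    obtain ⟨u', rfl⟩ := exists_mfderiv_eq hf x w
    rw [← hJ, ← hJ, hg, hg, K.compatible]
  · intro a q v
    obtain ⟨x, rfl⟩ := hsurj q
    obtain ⟨u, rfl⟩ := exists_mfderiv_eq hf x v
    rw [← hJ, ← hJ, ← hJ, K.J_eq]
  · intro a q v
    obtain ⟨x, rfl⟩ := hsurj q
    obtain ⟨u, rfl⟩ := exists_mfderiv_eq hf x v
    rw [← hJ, ← hJ, ← hJ, K.J_eq', map_neg]

end DescentOfStructures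

section Transfer

variable {E : Type*} [NormedAddCommGroup E] [NormedSpace ℝ E]
  {H : Type*} [TopologicalSpace H] {I : ModelWithCorners ℝ E H} [I.Boundaryless]
  {M : Type*} [TopologicalSpace M] [ChartedSpace H M] [IsManifold I ∞ M]
  {N : Type*} [TopologicalSpace N] [ChartedSpace H N] [IsManifold I ∞ N] {f : M → N}

theorem extDerivM_eq_zero_of_pullForm (hf : IsLocalDiffeomorph I I ∞ f) {n : ℕ}
    {w : (y : N) → TangentSpace I y [⋀^Fin n]→L[ℝ] ℝ} {x : M}
    (hw : ContDiffAt ℝ ∞ (locForm w (f x)) (extChartAt I (f x) (f x)))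
    (h : extDerivM I (pullForm (I := I) f w) x = 0) : extDerivM I w (f x) = 0 := by
  rw [extDerivM_pullForm (hf.contMDiff x) (hw.differentiableAt (by simp))] at h
  ext v
  choose u hu using fun i ↦ exists_mfderiv_eq hf x (v i)
  have h1 := DFunLike.congr_fun h u
  refine Eq.trans ?_ h1
  exact congrArg (extDerivM I w (f x)) (funext fun i ↦ (hu i).symm)

theorem AlmostContactMetric3.IsStructureMap.dη {S : AlmostContactMetric3 I M}
    {T : AlmostContactMetric3 I N} (h : S.IsStructureMap T f) (a : Fin 3) (x : M) :
    (S.component a).dη x = pullForm (I := I) f (T.component a).dη x := by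
  have h1 : (S.component a).ηForm = pullForm (I := I) f (T.component a).ηForm := by
    funext q
    ext v
    exact (h.η a q (v 0)).symm
  unfold AlmostContactMetric.dη
  rw [h1]
  exact extDerivM_pullForm (h.contMDiff x)
    (((T.component a).contDiffAt_locForm_ηForm (f x)).differentiableAt (by simp))

theorem AlmostContactMetric3.IsStructureMap.isThreeQuasiSasakian {S : AlmostContactMetric3 I M}
    {T : AlmostContactMetric3 I N} (h : S.IsStructureMap T f) (hf : IsLocalDiffeomorph I I ∞ f)
    (hsurj : Function.Surjective f) (hS : S.IsThreeQuasiSasakian) : T.IsThreeQuasiSasakian := by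
  intro a
  constructor
  · rw [AlmostContactMetric.isNormal_iff]
    intro q v w
    obtain ⟨x, rfl⟩ := hsurj q
    obtain ⟨u, rfl⟩ := exists_mfderiv_eq hf x v
    obtain ⟨u', rfl⟩ := exists_mfderiv_eq hf x w
    have h1 := (AlmostContactMetric.isNormal_iff _).1 (hS a).1 x u u'
    have h2 := mfderiv_nijAt (h.contMDiff x) (S.smooth_φ a) (T.smooth_φ a)
      (Filter.Eventually.of_forall (h.φ a)) u u'
    have h3 : (S.component a).dη x ![u, u'] =
        (T.component a).dη (f x) ![mfderiv I I f x u, mfderiv I I f x u'] := by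
      rw [h.dη]
      exact congrArg ((T.component a).dη (f x)) (by ext i; fin_cases i <;> rfl)
    have h4 := congrArg (mfderiv I I f x) h1
    rw [map_add, map_smul, map_zero, h3] at h4
    exact (congrArg₂ (fun b c ↦ b + _ • c) h2 (h.ξ a x)).symm.trans h4
  · intro q
    obtain ⟨x, rfl⟩ := hsurj q
    refine extDerivM_eq_zero_of_pullForm hf
      ((T.component a).contDiffAt_locForm_fundamentalForm (f x)) ?_
    rw [← (hS a).2 x]
    congr 1
    funext y
    ext v
    refine Eq.trans ?_ (h.metric y (v 0) (S.φ a y (v 1)))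
    exact congrArg (T.metric.inner (f y) (mfderiv I I f y (v 0))) (h.φ a y (v 1)).symm

theorem AlmostHyperHermitian.IsStructureMap.isHyperKahler {K : AlmostHyperHermitian I M}
    {L : AlmostHyperHermitian I N} (h : K.IsStructureMap L f) (hf : IsLocalDiffeomorph I I ∞ f)
    (hsurj : Function.Surjective f) (hK : K.IsHyperKahler) : L.IsHyperKahler := by
  refine fun a ↦ ⟨(nijenhuis_eq_zero_iff (L.smooth_J a)).2 fun q v w ↦ ?_, fun q ↦ ?_⟩
  · obtain ⟨x, rfl⟩ := hsurj q
    obtain ⟨u, rfl⟩ := exists_mfderiv_eq hf x v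
    obtain ⟨u', rfl⟩ := exists_mfderiv_eq hf x w
    have h1 := (nijenhuis_eq_zero_iff (K.smooth_J a)).1 (hK a).1 x u u'
    have h2 := mfderiv_nijAt (h.contMDiff x) (K.smooth_J a) (L.smooth_J a)
      (Filter.Eventually.of_forall (h.J a)) u u'
    rw [← h2, h1, map_zero]
  · obtain ⟨x, rfl⟩ := hsurj q
    refine extDerivM_eq_zero_of_pullForm hf (L.contDiffAt_locForm_fundamentalForm a (f x)) ?_
    rw [← (hK a).2 x]
    congr 1
    funext y
    ext v
    refine Eq.trans ?_ (h.metric y (v 0) (K.J a y (v 1)))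
    exact congrArg (L.metric.inner (f y) (mfderiv I I f y (v 0))) (h.J a y (v 1)).symm

theorem wedgePow_compLinearMap_eq_zero_iff {V W : Type*} [AddCommGroup V] [Module ℝ V]
    [AddCommGroup W] [Module ℝ W] {f : W →ₗ[ℝ] V} (hf : Function.Surjective f)
    (w : V [⋀^Fin 2]→ₗ[ℝ] ℝ) (p : ℕ) :
    wedgePow (w.compLinearMap f) p = 0 ↔ wedgePow w p = 0 := by
  rw [wedgePow_compLinearMap]
  refine ⟨fun h ↦ ?_, fun h ↦ by rw [h]; rfl⟩
  ext v
  choose g hg using hf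
  have h1 := DFunLike.congr_fun h (fun i ↦ g (v i))
  rw [AlternatingMap.compLinearMap_apply, funext fun i ↦ hg (v i)] at h1
  exact h1

theorem AlmostContactMetric3.IsStructureMap.hasRank {S : AlmostContactMetric3 I M}
    {T : AlmostContactMetric3 I N} (h : S.IsStructureMap T f) (hf : IsLocalDiffeomorph I I ∞ f)
    (hsurj : Function.Surjective f) {r : ℕ} (hS : S.HasRank r) : T.HasRank r := by
  intro a
  have hη : ∀ x, ((S.component a).ηForm x).toAlternatingMap =
      ((T.component a).ηForm (f x)).toAlternatingMap.compLinearMap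
        (mfderiv I I f x).toLinearMap := fun x ↦ by
    ext v
    exact (h.η a x (v 0)).symm
  have hdη : ∀ x, ((S.component a).dη x).toAlternatingMap =
      ((T.component a).dη (f x)).toAlternatingMap.compLinearMap
        (mfderiv I I f x).toLinearMap := fun x ↦ by
    rw [h.dη]; rfl
  have hD : ∀ x, Function.Surjective (mfderiv I I f x).toLinearMap := fun x ↦
    exists_mfderiv_eq hf x
  obtain ⟨p, hp⟩ := hS a
  simp only [hη, hdη, ne_eq, wedge_wedgePow_compLinearMap_eq_zero_iff (hD _),
    wedgePow_compLinearMap_eq_zero_iff (hD _)] at hp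
  refine ⟨p, hp.imp (fun hp ↦ ⟨hp.1, fun q ↦ ?_⟩) fun hp ↦ ⟨hp.1, fun q ↦ ?_⟩⟩
  · obtain ⟨x, rfl⟩ := hsurj q
    exact hp.2 x
  · obtain ⟨x, rfl⟩ := hsurj q
    exact hp.2 x

end Transfer

/-! ### Quotients by free actions of finite groups -/

section Quotient

variable {E : Type*} [NormedAddCommGroup E] [NormedSpace ℝ E] [FiniteDimensional ℝ E]
  {H : Type*} [TopologicalSpace H] {I : ModelWithCorners ℝ E H} [I.Boundaryless]
  {M : Type*} [TopologicalSpace M] [ChartedSpace H M] [IsManifold I ∞ M]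
  [T2Space M] [SecondCountableTopology M] [ConnectedSpace M]

/-- The quotient of a 3-quasi-Sasakian manifold by a free action of a finite group of structure
maps is 3-quasi-Sasakian of the same rank. -/
theorem quotientIsThreeQuasiSasakian {G : Type*} [Group G] [Finite G] [MulAction G M]
    {S : AlmostContactMetric3 I M} (hS : S.IsThreeQuasiSasakian) {r : ℕ} (hr : S.HasRank r)
    (hact : ∀ a : G, S.IsStructureMap S (fun x ↦ a • x))
    (hfree : ∀ (a : G) (x : M), a • x = x → a = 1) : QuotientIsThreeQuasiSasakian G S r := by
  have hcont : ContinuousConstSMul G M := ⟨fun a ↦ (hact a).contMDiff.continuous⟩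
  have hlc : LocallyCompactSpace M := Manifold.locallyCompact_of_finiteDimensional I
  -- a free action of a finite group by homeomorphisms of a locally compact Hausdorff space is
  -- properly discontinuous, so the projection is a covering map
  have hcancel : IsCancelSMul G M :=
    { right_cancel' := fun a b x h ↦ by
        have h1 := hfree (b⁻¹ * a) x (by rw [mul_smul, h, inv_smul_smul])
        rwa [inv_mul_eq_one, eq_comm] at h1 }
  have hcov := isQuotientCoveringMap_quotientMk_of_properlyDiscontinuousSMul (G := G) (E := M)
  have hloc := hcov.isCoveringMap.isLocalHomeomorph
  have hsurj : Function.Surjective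
      (Quotient.mk (MulAction.orbitRel G M) : M → MulAction.orbitRel.Quotient G M) :=
    Quotient.mk_surjective
  have hdeck : ∀ x y : M, (Quotient.mk (MulAction.orbitRel G M) x) = Quotient.mk _ y →
      ∃ a : G, a • x = y := fun x y hxy ↦ by
    obtain ⟨a, ha⟩ := MulAction.orbitRel_apply.1 (Quotient.exact hxy.symm)
    exact ⟨a, ha⟩
  have hinv : ∀ (a : G) (z : M), Quotient.mk (MulAction.orbitRel G M) (a • z) =
      Quotient.mk (MulAction.orbitRel G M) z := fun a z ↦
    Quotient.sound (MulAction.orbitRel_apply.2 ⟨a, rfl⟩)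
  have hdeck' : HasSmoothDeckMaps I
      (Quotient.mk (MulAction.orbitRel G M) : M → MulAction.orbitRel.Quotient G M) := by
    intro x y hxy
    obtain ⟨a, ha⟩ := hdeck x y hxy
    exact ⟨fun x ↦ a • x, (hact a).contMDiff, ha, hinv a⟩
  refine ⟨t2Space_of_properlyDiscontinuousSMul_of_t2Space,
    ContinuousConstSMul.secondCountableTopology, inferInstance,
    hloc.chartedSpace hsurj, isManifold_chartedSpaceOfRightInverse _ hdeck', ?_⟩
  let _ := hloc.chartedSpace (H := H) hsurj
  have : IsManifold I ∞ (MulAction.orbitRel.Quotient G M) :=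
    isManifold_chartedSpaceOfRightInverse _ hdeck'
  have hld : IsLocalDiffeomorph I I ∞
      (Quotient.mk (MulAction.orbitRel G M) : M → MulAction.orbitRel.Quotient G M) :=
    isLocalDiffeomorph_chartedSpaceOfRightInverse _ hdeck'
  obtain ⟨T, hT⟩ := AlmostContactMetric3.exists_descend hld hsurj S fun x y hxy ↦ by
    obtain ⟨a, ha⟩ := hdeck x y hxy
    exact ⟨fun x ↦ a • x, hact a, ha, hinv a⟩
  exact ⟨hld, T, hT, hT.isThreeQuasiSasakian hld hsurj hS, hT.hasRank hld hsurj hr⟩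

end Quotient

/-! ### Quaternionic multiplication -/

section QuaternionicSpace

theorem imUnit_re (a : Fin 3) : (imUnit a).re = 0 := by fin_cases a <;> rfl

theorem imUnit_imI (a : Fin 3) : (imUnit a).imI = ![1, 0, 0] a := by fin_cases a <;> rfl

theorem imUnit_imJ (a : Fin 3) : (imUnit a).imJ = ![0, 1, 0] a := by fin_cases a <;> rfl

theorem imUnit_imK (a : Fin 3) : (imUnit a).imK = ![0, 0, 1] a := by fin_cases a <;> rfl

theorem imUnit_mul_self (a : Fin 3) : imUnit a * imUnit a = -1 := by
  ext <;> fin_cases a <;> simp [imUnit_re, imUnit_imI, imUnit_imJ, imUnit_imK]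

theorem imUnit_add_two (a : Fin 3) : imUnit (a + 2) = imUnit a * imUnit (a + 1) := by
  ext <;> fin_cases a <;> simp [imUnit_re, imUnit_imI, imUnit_imJ, imUnit_imK]

theorem imUnit_add_two' (a : Fin 3) : imUnit (a + 2) = -(imUnit (a + 1) * imUnit a) := by
  ext <;> fin_cases a <;> simp [imUnit_re, imUnit_imI, imUnit_imJ, imUnit_imK]

theorem norm_imUnit (a : Fin 3) : ‖imUnit a‖ = 1 := by
  have h := congrArg norm (imUnit_mul_self a)
  rw [norm_mul, norm_neg, norm_one, ← pow_two] at h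
  exact (pow_eq_one_iff_of_nonneg (norm_nonneg _) two_ne_zero).1 h

theorem norm_imUnit_smul {n : ℕ} (a : Fin 3) (v : QSpace n) : ‖imUnit a • v‖ = ‖v‖ := by
  simp [PiLp.norm_eq_of_L2, norm_smul, norm_imUnit]

/-- Left multiplication by an imaginary unit, as a linear isometry. -/
def leftMul {n : ℕ} (a : Fin 3) : QSpace n →ₗᵢ[ℝ] QSpace n where
  toFun v := imUnit a • v
  map_add' := smul_add _
  map_smul' _ _ := smul_comm _ _ _
  norm_map' := norm_imUnit_smul a

theorem leftMul_apply {n : ℕ} (a : Fin 3) (v : QSpace n) : leftMul a v = imUnit a • v := rfl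

/-- Right multiplication by a power of `i`, as a linear isometry. -/
def rightMul {n : ℕ} (a : Z4) : QSpace n →ₗᵢ[ℝ] QSpace n where
  toFun v := a • v
  map_add' := smul_add _
  map_smul' c v := by
    ext s : 1
    simp [z4_smul_apply]
  norm_map' := norm_z4_smul a

theorem z4_smul_imUnit_smul {n : ℕ} (a : Z4) (b : Fin 3) (v : QSpace n) :
    a • (imUnit b • v) = imUnit b • (a • v) := by
  ext s : 1
  simp [z4_smul_apply, mul_assoc]

theorem leftMul_leftMul_self {n : ℕ} (a : Fin 3) (v : QSpace n) :
    leftMul a (leftMul a v) = -v := by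
  rw [leftMul_apply, leftMul_apply, smul_smul, imUnit_mul_self, neg_smul, one_smul]

theorem leftMul_add_two {n : ℕ} (a : Fin 3) (v : QSpace n) :
    leftMul (a + 2) v = leftMul a (leftMul (a + 1) v) := by
  simp only [leftMul_apply]
  rw [smul_smul, imUnit_add_two]

theorem leftMul_add_two' {n : ℕ} (a : Fin 3) (v : QSpace n) :
    leftMul (a + 2) v = -leftMul (a + 1) (leftMul a v) := by
  simp only [leftMul_apply]
  rw [smul_smul, imUnit_add_two', neg_smul]

theorem inner_leftMul {n : ℕ} (a : Fin 3) (u v : QSpace n) :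
    ⟪leftMul a u, v⟫ = -⟪u, leftMul a v⟫ := by
  rw [← (leftMul a).inner_map_map u (leftMul a v), leftMul_leftMul_self, inner_neg_right, neg_neg]

theorem inner_leftMul_self {n : ℕ} (a : Fin 3) (v : QSpace n) : ⟪v, leftMul a v⟫ = 0 := by
  have h := inner_leftMul a v v
  rw [real_inner_comm] at h
  linarith

end QuaternionicSpace

/-! ### Constant structures on a vector space -/

section ModelSpace

variable {E : Type*} [NormedAddCommGroup E] [NormedSpace ℝ E]

theorem chartD_modelSpace (x z : E) : chartD 𝓘(ℝ, E) x z = ContinuousLinearMap.id ℝ E := by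
  unfold chartD
  simp only [mfld_simps]
  exact mfderiv_id

theorem locEndo_const (A : E →L[ℝ] E) (x : E) :
    locEndo (I := 𝓘(ℝ, E)) (fun _ ↦ A) x = fun _ ↦ A := by
  funext z
  unfold locEndo
  rw [chartInv_modelSpace, chartD_modelSpace]
  rfl

theorem locBilin_const (B : E →L[ℝ] E →L[ℝ] ℝ) (x : E) :
    locBilin (I := 𝓘(ℝ, E)) (fun _ ↦ B) x = fun _ ↦ B := by
  funext z
  unfold locBilin
  rw [chartInv_modelSpace]
  rfl

theorem nijAt_const (A : E →L[ℝ] E) (x u v : E) :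
    nijAt (I := 𝓘(ℝ, E)) (fun _ ↦ A) x u v = (0 : E) := by
  unfold nijAt
  rw [locEndo_const]
  simp [nijTensor]
  rfl

theorem extDerivM_const {n : ℕ} (w : E [⋀^Fin n]→L[ℝ] ℝ) (x : E) :
    extDerivM 𝓘(ℝ, E) (fun _ ↦ w) x = 0 :=
  (extDerivM_modelSpace (fun _ ↦ w) x).trans (by
    rw [extDeriv, fderiv_fun_const]
    exact map_zero (ContinuousAlternatingMap.alternatizeUncurryFinCLM ℝ E ℝ))

end ModelSpace

/-! ### The flat structure of the quaternionic space -/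

section FlatSpace

/-- The flat hyper-Kähler structure of `ℍᵐ`: the Euclidean metric and the left multiplications. -/
def flatStructure (m : ℕ) : AlmostHyperHermitian 𝓘(ℝ, QSpace m) (QSpace m) where
  metric := mkMetric (fun _ ↦ innerSL ℝ) (fun _ u v ↦ real_inner_comm (F := QSpace m) v u)
    (fun _ v hv ↦ real_inner_self_pos.2 hv) (fun x ↦ by
      have h := locBilin_const (innerSL ℝ (E := QSpace m)) x
      exact (contDiffAt_const (c := innerSL ℝ (E := QSpace m))).congr_of_eventuallyEq
        (Filter.Eventually.of_forall fun z ↦ congrFun h z))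
  J a _ := (leftMul a).toContinuousLinearMap
  smooth_J a := smoothEndo_iff.2 fun x ↦ by
    have h := locEndo_const (leftMul (n := m) a).toContinuousLinearMap x
    exact (contDiffAt_const (c := (leftMul (n := m) a).toContinuousLinearMap)).congr_of_eventuallyEq
        (Filter.Eventually.of_forall fun z ↦ congrFun h z)
  J_J_self a _ v := leftMul_leftMul_self a v
  compatible a _ u v := (leftMul a).inner_map_map u v
  J_eq a _ v := leftMul_add_two a v
  J_eq' a _ v := leftMul_add_two' a v

theorem isHyperKahler_flatStructure (m : ℕ) : (flatStructure m).IsHyperKahler := by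
  intro a
  refine ⟨(nijenhuis_eq_zero_iff ((flatStructure m).smooth_J a)).2 fun x u v ↦ ?_, fun x ↦ ?_⟩
  · exact nijAt_const (leftMul (n := m) a).toContinuousLinearMap x u v
  · have h : (flatStructure m).fundamentalForm a = fun _ ↦
        twoForm (innerSL ℝ (E := QSpace m)) (leftMul (n := m) a).toContinuousLinearMap
          (inner_leftMul_self a) := by
      funext y
      rfl
    rw [h]
    exact extDerivM_const _ x

/-- An affine isometry of `ℍᵐ` whose linear part commutes with left multiplication is a structure
map. -/
theorem isStructureMap_flatStructure {m : ℕ} (A : QSpace m →ₗᵢ[ℝ] QSpace m) (c : QSpace m)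
    (hA : ∀ (a : Fin 3) v, A (imUnit a • v) = imUnit a • A v) :
    (flatStructure m).IsStructureMap (flatStructure m) (fun v ↦ A v + c) := by
  have h : ∀ x, mfderiv 𝓘(ℝ, QSpace m) 𝓘(ℝ, QSpace m) (fun v ↦ A v + c) x =
      A.toContinuousLinearMap := fun x ↦ by
    rw [mfderiv_eq_fderiv]
    exact (A.toContinuousLinearMap.hasFDerivAt.add_const c).fderiv
  refine ⟨(A.contDiff.add contDiff_const).contMDiff, fun x u v ↦ ?_, fun a x u ↦ ?_⟩
  · rw [h]; exact A.inner_map_map u v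
  · rw [h]; exact hA a u

end FlatSpace

/-! ### The flat torus -/

section Torus

variable (m : ℕ)

/-- The projection of `ℍᵐ` onto the torus. -/
def torusProj : QSpace m → QTorus m := QuotientAddGroup.mk

theorem torusProj_surjective : Function.Surjective (torusProj m) := QuotientAddGroup.mk_surjective

theorem isStructureMap_translation (c : QSpace m) :
    (flatStructure m).IsStructureMap (flatStructure m) (fun v ↦ v + c) :=
  isStructureMap_flatStructure LinearIsometry.id c fun _ _ ↦ rfl

/-- The deck maps of the projection to the torus are the translations by lattice vectors. -/
theorem exists_translation (x y : QSpace m) (hxy : torusProj m x = torusProj m y) :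
    ∃ h : QSpace m → QSpace m, (flatStructure m).IsStructureMap (flatStructure m) h ∧
      h x = y ∧ ∀ z, torusProj m (h z) = torusProj m z := by
  have h1 : -x + y ∈ intLattice m := QuotientAddGroup.eq.1 hxy
  exact ⟨fun v ↦ v + (-x + y), isStructureMap_translation m _, by simp,
    fun z ↦ (QuotientAddGroup.mk_add_of_mem z h1)⟩

theorem hasSmoothDeckMaps_torusProj : HasSmoothDeckMaps 𝓘(ℝ, QSpace m) (torusProj m) :=
  fun x y hxy ↦ by
    obtain ⟨h, h1, h2, h3⟩ := exists_translation m x y hxy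
    exact ⟨h, h1.contMDiff, h2, h3⟩

instance isManifold_qTorus : IsManifold 𝓘(ℝ, QSpace m) ∞ (QTorus m) :=
  isManifold_chartedSpaceOfRightInverse
    (torusProj_surjective m).hasRightInverse.choose_spec (hasSmoothDeckMaps_torusProj m)

theorem isLocalDiffeomorph_torusProj :
    IsLocalDiffeomorph 𝓘(ℝ, QSpace m) 𝓘(ℝ, QSpace m) ∞ (torusProj m) :=
  isLocalDiffeomorph_chartedSpaceOfRightInverse
    (torusProj_surjective m).hasRightInverse.choose_spec (hasSmoothDeckMaps_torusProj m)

theorem isStructureMap_rightMul (a : Z4) :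
    (flatStructure m).IsStructureMap (flatStructure m) (fun v ↦ a • v) := by
  have h := isStructureMap_flatStructure (rightMul (n := m) a) 0
    fun b v ↦ z4_smul_imUnit_smul a b v
  simp only [add_zero] at h
  exact h

/-- The torus with its standard structure is hyper-Kähler, and `ℤ/4` acts on it by structure
maps. -/
theorem exists_torusStructure : ∃ K : AlmostHyperHermitian 𝓘(ℝ, QSpace m) (QTorus m),
    IsStandardTorusStructure K ∧ K.IsHyperKahler ∧
      ∀ a : Z4, K.IsStructureMap K (fun x ↦ a • x) := by
  have hld := isLocalDiffeomorph_torusProj m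
  have hsurj := torusProj_surjective m
  obtain ⟨K, hK⟩ := AlmostHyperHermitian.exists_descend hld hsurj (flatStructure m)
    (exists_translation m)
  refine ⟨K, ⟨hK.metric, fun a v u ↦ (hK.J a v u).symm⟩,
    hK.isHyperKahler hld hsurj (isHyperKahler_flatStructure m), fun a ↦ ?_⟩
  exact hK.of_semiconj hld hsurj (isStructureMap_rightMul m a) fun v ↦ rfl

instance isClosed_intLattice : IsClosed (intLattice m : Set (QSpace m)) := by
  have : DiscreteTopology (intLattice m) := (isDiscrete_intLattice m).to_subtype
  exact AddSubgroup.isClosed_of_discrete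

instance t2Space_qTorus : T2Space (QTorus m) := inferInstance

instance secondCountableTopology_qTorus : SecondCountableTopology (QTorus m) := inferInstance

instance connectedSpace_qTorus : ConnectedSpace (QTorus m) :=
  (torusProj_surjective m).connectedSpace QuotientAddGroup.continuous_mk

/-- Rounding down the four coordinates of a quaternion moves it by at most `2`. -/
theorem exists_norm_sub_intQuaternions_le (q : ℍ[ℝ]) : ∃ p ∈ intQuaternions, ‖q - p‖ ≤ 2 := by
  obtain ⟨p, h3, h4, h5, h6⟩ : ∃ p : ℍ[ℝ], p.re = ⌊q.re⌋ ∧ p.imI = ⌊q.imI⌋ ∧ p.imJ = ⌊q.imJ⌋ ∧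
      p.imK = ⌊q.imK⌋ := ⟨⟨⌊q.re⌋, ⌊q.imI⌋, ⌊q.imJ⌋, ⌊q.imK⌋⟩, rfl, rfl, rfl, rfl⟩
  refine ⟨p, ⟨_, _, _, _, h3, h4, h5, h6⟩, ?_⟩
  have h1 := Quaternion.normSq_eq_norm_mul_self (q - p)
  rw [Quaternion.normSq_def', Quaternion.re_sub, Quaternion.imI_sub, Quaternion.imJ_sub,
    Quaternion.imK_sub, h3, h4, h5, h6] at h1
  have h2 : ∀ t : ℝ, (t - ⌊t⌋) ^ 2 ≤ 1 := fun t ↦ by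
    have := Int.floor_le t
    have := Int.lt_floor_add_one t
    rw [sq_le_one_iff_abs_le_one, abs_le]
    constructor <;> linarith
  refine le_of_sq_le_sq ?_ (by norm_num)
  rw [pow_two, ← h1]
  linarith [h2 q.re, h2 q.imI, h2 q.imJ, h2 q.imK]

/-- The torus is the image of a ball which meets every coset of the lattice. -/
instance compactSpace_qTorus : CompactSpace (QTorus m) := by
  have : ProperSpace (QSpace m) := FiniteDimensional.proper ℝ _
  have h : torusProj m '' Metric.closedBall 0 (Real.sqrt (m * 4)) = univ := by
    refine eq_univ_of_forall fun t ↦ ?_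
    obtain ⟨v, rfl⟩ := torusProj_surjective m t
    choose p hp hvp using fun s ↦ exists_norm_sub_intQuaternions_le (v s)
    have h1 : WithLp.toLp 2 p ∈ intLattice m := hp
    refine ⟨v - WithLp.toLp 2 p, ?_, ?_⟩
    · rw [mem_closedBall_zero_iff]
      refine Real.le_sqrt_of_sq_le ?_
      rw [PiLp.norm_sq_eq_of_L2]
      refine (Finset.sum_le_card_nsmul _ _ 4 fun s _ ↦ ?_).trans (by simp)
      have h2 := hvp s
      have h3 := norm_nonneg (v s - p s)
      change ‖v s - p s‖ ^ 2 ≤ 4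
      nlinarith
    · rw [sub_eq_add_neg]
      exact QuotientAddGroup.mk_add_of_mem v ((intLattice m).neg_mem h1)
  refine ⟨?_⟩
  rw [← h]
  exact (isCompact_closedBall _ _).image QuotientAddGroup.continuous_mk

end Torus

/-! ### Freeness of the action -/

theorem iPow_eq_one {a : Z4} (h : iPow a = 1) : a = 1 := by
  have h1 : ∀ k : ZMod 4, imUnit 0 ^ k.val = 1 → k = 0 := by
    intro k hk
    have h2 := congrArg (fun q : ℍ[ℝ] ↦ q.re) hk
    fin_cases k
    · rfl
    · exact absurd h2 (by simp [ZMod.val, imUnit_zero_re])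
    · exact absurd h2 (by simp [ZMod.val, pow_two, imUnit_mul_self]; norm_num)
    · exact absurd h2 (by simp [ZMod.val, pow_succ, imUnit_mul_self, imUnit_zero_re])
  exact h1 (Multiplicative.toAdd a) h

/-- The action of `ℤ/4` on the sphere is free. -/
theorem eq_one_of_smul_eq_self {l : ℕ} {a : Z4} {x : QSphere l} (h : a • x = x) : a = 1 := by
  have hx : (x : QSpace (l + 1)) ≠ 0 := ne_zero_of_mem_unit_sphere x
  have h1 : ∃ s, (x : QSpace (l + 1)) s ≠ 0 := by
    by_contra! h2
    exact hx (PiLp.ext h2)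
  obtain ⟨s, hs⟩ := h1
  have h2 : (x : QSpace (l + 1)) s * iPow a = (x : QSpace (l + 1)) s :=
    congrArg (fun y : QSphere l ↦ (y : QSpace (l + 1)) s) h
  exact iPow_eq_one (mul_left_cancel₀ hs (h2.trans (mul_one _).symm))

/-! ### Left inverses of injective linear maps -/

section LeftInverse

variable {E V : Type*} [NormedAddCommGroup E] [InnerProductSpace ℝ E] [FiniteDimensional ℝ E]
  [NormedAddCommGroup V] [InnerProductSpace ℝ V] [FiniteDimensional ℝ V]

/-- The left inverse `(D* D)⁻¹ D*` of an injective linear map `D`. -/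
def leftInv (D : E →L[ℝ] V) : V →L[ℝ] E :=
  (ContinuousLinearMap.adjoint D ∘L D).inverse ∘L ContinuousLinearMap.adjoint D

theorem isInvertible_adjoint_comp {D : E →L[ℝ] V} (hD : Function.Injective D) :
    (ContinuousLinearMap.adjoint D ∘L D).IsInvertible := by
  have h : Function.Injective (ContinuousLinearMap.adjoint D ∘L D).toLinearMap := by
    rw [injective_iff_map_eq_zero]
    intro u hu
    have h1 : ⟪u, ContinuousLinearMap.adjoint D (D u)⟫ = 0 := by
      rw [show ContinuousLinearMap.adjoint D (D u) = 0 from hu, inner_zero_right]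
    rw [ContinuousLinearMap.adjoint_inner_right, inner_self_eq_zero] at h1
    exact hD (h1.trans (map_zero D).symm)
  exact ⟨(LinearEquiv.ofInjectiveEndo _ h).toContinuousLinearEquiv, rfl⟩

theorem leftInv_apply {D : E →L[ℝ] V} (hD : Function.Injective D) (u : E) :
    leftInv D (D u) = u :=
  (isInvertible_adjoint_comp hD).inverse_apply_eq.2 rfl

theorem leftInv_eq_zero {D : E →L[ℝ] V} {x : V} (h : ∀ u, ⟪x, D u⟫ = 0) : leftInv D x = 0 := by
  have h1 : ContinuousLinearMap.adjoint D x = 0 := by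
    refine ext_inner_right ℝ fun u ↦ ?_
    rw [ContinuousLinearMap.adjoint_inner_left, h, inner_zero_left]
  change (ContinuousLinearMap.adjoint D ∘L D).inverse (ContinuousLinearMap.adjoint D x) = 0
  rw [h1, map_zero]

theorem contDiffAt_leftInv {X : Type*} [NormedAddCommGroup X] [NormedSpace ℝ X]
    {D : X → E →L[ℝ] V} {z : X} (hD : ContDiffAt ℝ ∞ D z) (hz : Function.Injective (D z)) :
    ContDiffAt ℝ ∞ (fun y ↦ leftInv (D y)) z := by
  have h1 : ContDiffAt ℝ ∞ (fun y ↦ ContinuousLinearMap.adjoint (D y)) z :=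
    (ContinuousLinearMap.adjoint (𝕜 := ℝ) (E := E) (F := V)).toContinuousLinearEquiv.contDiff
      |>.contDiffAt.comp z hD
  obtain ⟨e, he⟩ := isInvertible_adjoint_comp hz
  have h2 : ContDiffAt ℝ ∞ ContinuousLinearMap.inverse
      (ContinuousLinearMap.adjoint (D z) ∘L D z) := by
    rw [← he]
    exact contDiffAt_map_inverse e
  exact (h2.comp z (h1.clm_comp hD)).clm_comp h1

end LeftInverse

/-! ### Hypersurfaces of a Hermitian vector space -/

section Hypersurface

variable {E V : Type*} [NormedAddCommGroup E] [NormedSpace ℝ E]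
  [NormedAddCommGroup V] [InnerProductSpace ℝ V]

/-- The derivative of the relation `dF ∘ φ = J ∘ dF - η ⊗ F`. -/
theorem fderiv_related {F : E → V} {J : V →L[ℝ] V} {φ : E → E →L[ℝ] E} {η : E → E →L[ℝ] ℝ} {z : E}
    (hF : ContDiffAt ℝ ∞ F z) (hφ : DifferentiableAt ℝ φ z) (hη : DifferentiableAt ℝ η z)
    (h : ∀ᶠ y in 𝓝 z, ∀ v, fderiv ℝ F y (φ y v) = J (fderiv ℝ F y v) - η y v • F y) (u v : E) :
    fderiv ℝ F z (fderiv ℝ φ z u v) = J (fderiv ℝ (fderiv ℝ F) z u v)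
      - (η z v • fderiv ℝ F z u + fderiv ℝ η z u v • F z)
      - fderiv ℝ (fderiv ℝ F) z u (φ z v) := by
  have hF1 : HasFDerivAt F (fderiv ℝ F z) z := (hF.differentiableAt (by simp)).hasFDerivAt
  have hF2 : HasFDerivAt (fderiv ℝ F) (fderiv ℝ (fderiv ℝ F) z) z :=
    ((hF.fderiv_right (m := 1) two_le_infty).differentiableAt (by simp)).hasFDerivAt
  have h1 := hF2.clm_apply (hφ.hasFDerivAt.clm_apply (hasFDerivAt_const v z))
  have h2 := (J.hasFDerivAt.comp z (hF2.clm_apply (hasFDerivAt_const v z))).sub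
    ((hη.hasFDerivAt.clm_apply (hasFDerivAt_const v z)).smul hF1)
  have h3 : (fun y ↦ fderiv ℝ F y (φ y v)) =ᶠ[𝓝 z]
      fun y ↦ J (fderiv ℝ F y v) - η y v • F y := h.mono fun y hy ↦ hy v
  have h4 := DFunLike.congr_fun (h1.unique (h2.congr_of_eventuallyEq h3)) u
  simp at h4
  rw [← h4]
  abel

/-- Normality of a hypersurface `F` of a Hermitian vector space `(V, J)` whose normal is the
position vector. Differentiating `dF ∘ φ = J ∘ dF - η ⊗ F` expresses the image under `dF` of the
Nijenhuis tensor of `φ` by `d²F`, `dη` and `F`; the terms in `d²F` cancel by symmetry, and up to a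
multiple of the normal `F` what remains is `dη ⊗ J F`. The multiple vanishes since `dF` takes values
orthogonal to `F`. -/
theorem fderiv_nijTensor_hypersurface {F : E → V} {J : V →L[ℝ] V} {φ : E → E →L[ℝ] E}
    {η : E → E →L[ℝ] ℝ} {z : E} (hF : ContDiffAt ℝ ∞ F z) (hφ : DifferentiableAt ℝ φ z)
    (hη : DifferentiableAt ℝ η z) (hJ : ∀ v, J (J v) = -v)
    (h : ∀ᶠ y in 𝓝 z, ∀ v, fderiv ℝ F y (φ y v) = J (fderiv ℝ F y v) - η y v • F y)
    (hJF : ⟪F z, J (F z)⟫ = 0) (hT : ∀ v, ⟪F z, fderiv ℝ F z v⟫ = 0) (hFz : F z ≠ 0) (u v : E) :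
    fderiv ℝ F z (nijTensor φ z u v) = (fderiv ℝ η z u v - fderiv ℝ η z v u) • J (F z) := by
  have hB : ∀ u v, fderiv ℝ (fderiv ℝ F) z u v = fderiv ℝ (fderiv ℝ F) z v u :=
    (hF.isSymmSndFDerivAt (by simpa [one_add_one_eq_two] using two_le_infty))
  have h0 := h.self_of_nhds
  have h1 := fderiv_related hF hφ hη h
  obtain ⟨c, hc⟩ : ∃ c : ℝ, fderiv ℝ F z (nijTensor φ z u v) =
      (fderiv ℝ η z u v - fderiv ℝ η z v u) • J (F z) + c • F z := by
    -- each of the four terms of the Nijenhuis tensor leaves a multiple of `F`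
    refine ⟨-fderiv ℝ η z (φ z u) v + fderiv ℝ η z (φ z v) u - η z (fderiv ℝ φ z v u)
      + η z (fderiv ℝ φ z u v), ?_⟩
    simp only [nijTensor, map_add, map_sub, h0, h1, map_smul, hJ]
    rw [hB (φ z u) v, hB (φ z v) u, hB (φ z v) (φ z u), hB u v]
    module
  have h2 := congrArg (fun w ↦ ⟪F z, w⟫) hc
  simp only [hT, inner_add_right, inner_smul_right, hJF, mul_zero, zero_add] at h2
  have h3 : c = 0 := by
    rcases mul_eq_zero.1 h2.symm with h3 | h3
    · exact h3
    · exact absurd (inner_self_eq_zero.1 h3) hFz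
  rw [hc, h3, zero_smul, add_zero]

/-- The exterior derivative of the contact form `η = ⟪J dF, F⟫` is `2 ⟪dF, J dF⟫`. -/
theorem fderiv_contactForm {F : E → V} {J : V →L[ℝ] V} {η : E → E →L[ℝ] ℝ} {z : E}
    (hF : ContDiffAt ℝ ∞ F z) (hη : DifferentiableAt ℝ η z)
    (hJ : ∀ u v, ⟪J u, v⟫ = -⟪u, J v⟫)
    (h : ∀ᶠ y in 𝓝 z, ∀ v, η y v = ⟪J (fderiv ℝ F y v), F y⟫) (u v : E) :
    fderiv ℝ η z u v - fderiv ℝ η z v u = 2 * ⟪fderiv ℝ F z u, J (fderiv ℝ F z v)⟫ := by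
  have hF1 : HasFDerivAt F (fderiv ℝ F z) z := (hF.differentiableAt (by simp)).hasFDerivAt
  have hF2 : HasFDerivAt (fderiv ℝ F) (fderiv ℝ (fderiv ℝ F) z) z :=
    ((hF.fderiv_right (m := 1) two_le_infty).differentiableAt (by simp)).hasFDerivAt
  have hB : ∀ u v, fderiv ℝ (fderiv ℝ F) z u v = fderiv ℝ (fderiv ℝ F) z v u :=
    (hF.isSymmSndFDerivAt (by simpa [one_add_one_eq_two] using two_le_infty))
  have key : ∀ u v, fderiv ℝ η z u v = ⟪J (fderiv ℝ F z v), fderiv ℝ F z u⟫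
      + ⟪J (fderiv ℝ (fderiv ℝ F) z u v), F z⟫ := by
    intro u v
    have h1 := hη.hasFDerivAt.clm_apply (hasFDerivAt_const v z)
    have h2 := (J.hasFDerivAt.comp z (hF2.clm_apply (hasFDerivAt_const v z))).inner ℝ hF1
    have h3 : (fun y ↦ η y v) =ᶠ[𝓝 z] fun y ↦ ⟪J (fderiv ℝ F y v), F y⟫ :=
      h.mono fun y hy ↦ hy v
    have h4 := DFunLike.congr_fun (h1.unique (h2.congr_of_eventuallyEq h3)) u
    simpa using h4
  rw [key u v, key v u, hB u v, hJ (fderiv ℝ F z u), real_inner_comm (J (fderiv ℝ F z v))]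
  ring

end Hypersurface

/-! ### The tensors of the sphere -/

section Sphere

variable {l : ℕ}

/-- The differential of the inclusion of the sphere, on the model space. -/
def sphereD (x : QSphere l) : EuclideanSpace ℝ (Fin (4 * l + 3)) →L[ℝ] QSpace (l + 1) :=
  mvfderiv (𝓡 (4 * l + 3)) (fun y : QSphere l ↦ (y : QSpace (l + 1))) x

theorem sphereD_injective (x : QSphere l) : Function.Injective (sphereD x) :=
  injective_mvfderiv_subtypeVal_sphere x

theorem range_sphereD (x : QSphere l) :
    (sphereD x).range = (Submodule.span ℝ {(x : QSpace (l + 1))})ᗮ :=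
  range_mvfderiv_subtypeVal x

theorem inner_sphereD (x : QSphere l) (u : EuclideanSpace ℝ (Fin (4 * l + 3))) :
    ⟪(x : QSpace (l + 1)), sphereD x u⟫ = 0 := by
  have h : sphereD x u ∈ (sphereD x).range := ⟨u, rfl⟩
  rw [range_sphereD] at h
  exact Submodule.mem_orthogonal_singleton_iff_inner_right.1 h

theorem sphereD_leftInv (x : QSphere l) {v : QSpace (l + 1)}
    (hv : ⟪(x : QSpace (l + 1)), v⟫ = 0) : sphereD x (leftInv (sphereD x) v) = v := by
  have h : v ∈ (sphereD x).range := by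
    rw [range_sphereD]
    exact Submodule.mem_orthogonal_singleton_iff_inner_right.2 hv
  obtain ⟨u, rfl⟩ := h
  exact congrArg (sphereD x) (leftInv_apply (sphereD_injective x) u)

theorem inner_self_sphere (x : QSphere l) : ⟪(x : QSpace (l + 1)), (x : QSpace (l + 1))⟫ = 1 := by
  rw [real_inner_self_eq_norm_sq, norm_eq_of_mem_sphere, one_pow]

/-- The normal component `η_a(u) = ⟪N, J_a u⟫` of `J_a u`. -/
def sphereη (a : Fin 3) (x : QSphere l) : EuclideanSpace ℝ (Fin (4 * l + 3)) →L[ℝ] ℝ :=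
  innerSL ℝ (x : QSpace (l + 1)) ∘L (leftMul a).toContinuousLinearMap ∘L sphereD x

theorem sphereη_apply (a : Fin 3) (x : QSphere l) (u : EuclideanSpace ℝ (Fin (4 * l + 3))) :
    sphereη a x u = ⟪(x : QSpace (l + 1)), leftMul a (sphereD x u)⟫ := rfl

/-- The tangential part of `J_a`. The left inverse of the differential of the inclusion kills the
normal part. -/
def sphereφ (a : Fin 3) (x : QSphere l) :
    EuclideanSpace ℝ (Fin (4 * l + 3)) →L[ℝ] EuclideanSpace ℝ (Fin (4 * l + 3)) :=
  leftInv (sphereD x) ∘L (leftMul a).toContinuousLinearMap ∘L sphereD x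

/-- The Reeb vector field `-J_a N`. -/
def sphereξ (a : Fin 3) (x : QSphere l) : EuclideanSpace ℝ (Fin (4 * l + 3)) :=
  leftInv (sphereD x) (-leftMul a (x : QSpace (l + 1)))

theorem sphereD_ξ (a : Fin 3) (x : QSphere l) :
    sphereD x (sphereξ a x) = -leftMul a (x : QSpace (l + 1)) :=
  sphereD_leftInv x (by rw [inner_neg_right, inner_leftMul_self, neg_zero])

theorem sphereD_φ (a : Fin 3) (x : QSphere l) (u : EuclideanSpace ℝ (Fin (4 * l + 3))) :
    sphereD x (sphereφ a x u) =
      leftMul a (sphereD x u) - sphereη a x u • (x : QSpace (l + 1)) := by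
  have h1 : leftInv (sphereD x) (x : QSpace (l + 1)) = 0 := leftInv_eq_zero (inner_sphereD x)
  have h2 : sphereφ a x u = leftInv (sphereD x)
      (leftMul a (sphereD x u) - sphereη a x u • (x : QSpace (l + 1))) := by
    rw [map_sub, map_smul, h1, smul_zero, sub_zero]
    rfl
  rw [h2]
  refine sphereD_leftInv x ?_
  rw [inner_sub_right, inner_smul_right, inner_self_sphere, mul_one, sphereη_apply, sub_self]

theorem sphereη_ξ (a b : Fin 3) (x : QSphere l) :
    sphereη a x (sphereξ b x) =
      ⟪leftMul a (x : QSpace (l + 1)), leftMul b (x : QSpace (l + 1))⟫ := by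
  rw [sphereη_apply, sphereD_ξ, map_neg, inner_neg_right, inner_leftMul]

theorem sphereη_φ (a b : Fin 3) (x : QSphere l) (u : EuclideanSpace ℝ (Fin (4 * l + 3))) :
    sphereη a x (sphereφ b x u) = ⟪(x : QSpace (l + 1)), leftMul a (leftMul b (sphereD x u))⟫ := by
  rw [sphereη_apply, sphereD_φ, map_sub, map_smul, inner_sub_right, inner_smul_right,
    inner_leftMul_self, mul_zero, sub_zero]

/-! ### Smoothness of the tensors of the sphere -/

/-- The inclusion of the sphere in the preferred chart at `x`. -/
def sphereRep (x : QSphere l) (z : EuclideanSpace ℝ (Fin (4 * l + 3))) : QSpace (l + 1) :=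
  ((extChartAt (𝓡 (4 * l + 3)) x).symm z : QSphere l)

theorem contMDiffAt_sphereInclusion (x : QSphere l) :
    ContMDiffAt (𝓡 (4 * l + 3)) 𝓘(ℝ, QSpace (l + 1)) ∞ (fun y : QSphere l ↦ (y : QSpace (l + 1)))
      x :=
  contMDiff_coe_sphere x

theorem contDiffAt_sphereRep (x : QSphere l) :
    ContDiffAt ℝ ∞ (sphereRep x) (extChartAt (𝓡 (4 * l + 3)) x x) :=
  contDiffAt_localRep (contMDiffAt_sphereInclusion x)

theorem eventually_sphereD_chartInv (x : QSphere l) :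
    ∀ᶠ z in 𝓝 (extChartAt (𝓡 (4 * l + 3)) x x), z ∈ (extChartAt (𝓡 (4 * l + 3)) x).target ∧
      ∀ v, sphereD ((extChartAt (𝓡 (4 * l + 3)) x).symm z) (chartInv (𝓡 (4 * l + 3)) x z v) =
        fderiv ℝ (sphereRep x) z v := by
  filter_upwards [eventually_mfderiv_eq (contMDiffAt_sphereInclusion x)] with z hz
  refine ⟨hz.1, fun v ↦ (hz.2.2.2 v).trans ?_⟩
  rw [chartInv_modelSpace]
  rfl

/-- The preferred chart at `x` identifies the tangent space at `x` with the model space by the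
identity, so at `x` the two differentials of the inclusion agree. -/
theorem fderiv_sphereRep (x : QSphere l) :
    fderiv ℝ (sphereRep x) (extChartAt (𝓡 (4 * l + 3)) x x) = sphereD x := by
  ext1 v
  exact (mfderiv_eq_fderiv_localRep (contMDiffAt_sphereInclusion x) v).symm

theorem sphereRep_self (x : QSphere l) : sphereRep x (extChartAt (𝓡 (4 * l + 3)) x x) = x := by
  rw [sphereRep, extChartAt_to_inv]

theorem contDiffAt_fderiv_sphereRep (x : QSphere l) :
    ContDiffAt ℝ ∞ (fderiv ℝ (sphereRep x)) (extChartAt (𝓡 (4 * l + 3)) x x) :=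
  (contDiffAt_sphereRep x).fderiv_right (by simp)

theorem eventually_locCovector_sphereη (a : Fin 3) (x : QSphere l) :
    ∀ᶠ z in 𝓝 (extChartAt (𝓡 (4 * l + 3)) x x), ∀ v,
      locCovector (I := 𝓡 (4 * l + 3)) (sphereη a) x z v =
        ⟪sphereRep x z, leftMul a (fderiv ℝ (sphereRep x) z v)⟫ := by
  filter_upwards [eventually_sphereD_chartInv x] with z hz v
  rw [← hz.2 v]
  rfl

theorem eventually_fderiv_sphereRep_locEndo (a : Fin 3) (x : QSphere l) :
    ∀ᶠ z in 𝓝 (extChartAt (𝓡 (4 * l + 3)) x x), ∀ v,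
      fderiv ℝ (sphereRep x) z (locEndo (I := 𝓡 (4 * l + 3)) (sphereφ a) x z v) =
        leftMul a (fderiv ℝ (sphereRep x) z v)
          - locCovector (I := 𝓡 (4 * l + 3)) (sphereη a) x z v • sphereRep x z := by
  filter_upwards [eventually_sphereD_chartInv x] with z hz v
  rw [← hz.2 v, ← hz.2]
  refine Eq.trans ?_ (sphereD_φ a _ (chartInv (𝓡 (4 * l + 3)) x z v))
  exact congrArg (sphereD _) (chartInv_chartD hz.1 _)

theorem eventually_fderiv_sphereRep_locField (a : Fin 3) (x : QSphere l) :
    ∀ᶠ z in 𝓝 (extChartAt (𝓡 (4 * l + 3)) x x),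
      fderiv ℝ (sphereRep x) z (locField (I := 𝓡 (4 * l + 3)) (sphereξ a) x z) =
        -leftMul a (sphereRep x z) := by
  filter_upwards [eventually_sphereD_chartInv x] with z hz
  rw [← hz.2]
  refine Eq.trans ?_ (sphereD_ξ a _)
  exact congrArg (sphereD _) (chartInv_chartD hz.1 _)

theorem eventually_injective_fderiv_sphereRep (x : QSphere l) :
    ∀ᶠ z in 𝓝 (extChartAt (𝓡 (4 * l + 3)) x x),
      Function.Injective (fderiv ℝ (sphereRep x) z) := by
  filter_upwards [eventually_sphereD_chartInv x] with z hz u v huv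
  rw [← hz.2, ← hz.2] at huv
  have h := congrArg (chartD (𝓡 (4 * l + 3)) x ((extChartAt (𝓡 (4 * l + 3)) x).symm z))
    (sphereD_injective _ huv)
  rwa [chartD_chartInv hz.1, chartD_chartInv hz.1] at h

theorem smoothOneForm_sphereη (a : Fin 3) :
    SmoothOneForm (𝓡 (4 * l + 3)) (M := QSphere l) (sphereη a) := by
  refine smoothOneForm_iff.2 fun x ↦ ?_
  have h1 : locCovector (I := 𝓡 (4 * l + 3)) (sphereη a) x
      =ᶠ[𝓝 (extChartAt (𝓡 (4 * l + 3)) x x)] fun z ↦ innerSL ℝ (sphereRep x z) ∘L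
        (leftMul a).toContinuousLinearMap ∘L fderiv ℝ (sphereRep x) z :=
    (eventually_locCovector_sphereη a x).mono fun z hz ↦ ContinuousLinearMap.ext hz
  refine (contDiffAt_congr_iff h1).2 ?_
  exact ((innerSL ℝ (E := QSpace (l + 1))).contDiff.contDiffAt.comp _
    (contDiffAt_sphereRep x)).clm_comp (contDiffAt_const.clm_comp (contDiffAt_fderiv_sphereRep x))

theorem smoothEndo_sphereφ (a : Fin 3) :
    SmoothEndo (𝓡 (4 * l + 3)) (M := QSphere l) (sphereφ a) := by
  refine smoothEndo_iff.2 fun x ↦ ?_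
  have hη := smoothOneForm_iff.1 (smoothOneForm_sphereη a) x
  have h1 : locEndo (I := 𝓡 (4 * l + 3)) (sphereφ a) x
      =ᶠ[𝓝 (extChartAt (𝓡 (4 * l + 3)) x x)] fun z ↦ leftInv (fderiv ℝ (sphereRep x) z) ∘L
        ((leftMul a).toContinuousLinearMap ∘L fderiv ℝ (sphereRep x) z
          - ContinuousLinearMap.smulRight (locCovector (I := 𝓡 (4 * l + 3)) (sphereη a) x z)
            (sphereRep x z)) := by
    filter_upwards [eventually_fderiv_sphereRep_locEndo a x,
      eventually_injective_fderiv_sphereRep x] with z hz hi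
    ext1 v
    exact (leftInv_apply hi _).symm.trans (congrArg (leftInv (fderiv ℝ (sphereRep x) z)) (hz v))
  refine (contDiffAt_congr_iff h1).2 ?_
  refine (contDiffAt_leftInv (contDiffAt_fderiv_sphereRep x)
    (eventually_injective_fderiv_sphereRep x).self_of_nhds).clm_comp ?_
  exact (contDiffAt_const.clm_comp (contDiffAt_fderiv_sphereRep x)).sub
    (hη.smulRight (contDiffAt_sphereRep x))

theorem smoothFieldAt_sphereξ (a : Fin 3) (x : QSphere l) :
    SmoothFieldAt (𝓡 (4 * l + 3)) (sphereξ a) x := by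
  refine smoothFieldAt_iff.2 ?_
  have h1 : locField (I := 𝓡 (4 * l + 3)) (sphereξ a) x
      =ᶠ[𝓝 (extChartAt (𝓡 (4 * l + 3)) x x)] fun z ↦ leftInv (fderiv ℝ (sphereRep x) z)
        (-leftMul a (sphereRep x z)) := by
    filter_upwards [eventually_fderiv_sphereRep_locField a x,
      eventually_injective_fderiv_sphereRep x] with z hz hi
    exact (leftInv_apply hi _).symm.trans (congrArg (leftInv (fderiv ℝ (sphereRep x) z)) hz)
  refine (contDiffAt_congr_iff h1).2 ?_
  refine (contDiffAt_leftInv (contDiffAt_fderiv_sphereRep x)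
    (eventually_injective_fderiv_sphereRep x).self_of_nhds).clm_apply ?_
  exact ((leftMul a).contDiff.contDiffAt.comp _ (contDiffAt_sphereRep x)).neg

/-- The metric of the sphere induced by the inclusion. -/
def sphereMetric (l : ℕ) : Metric (𝓡 (4 * l + 3)) (QSphere l) :=
  mkMetric (fun x ↦ pullBilin (innerSL ℝ) (sphereD x))
    (fun x u v ↦ real_inner_comm (sphereD x v) (sphereD x u))
    (fun x _ hv ↦ real_inner_self_pos.2 fun h ↦
      hv (sphereD_injective x (h.trans (map_zero (sphereD x)).symm)))
    (fun x ↦ contDiffAt_locBilin_pullback (J := 𝓘(ℝ, QSpace (l + 1)))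
      (g := fun _ ↦ innerSL ℝ) (contMDiffAt_sphereInclusion x)
        ((contDiffAt_const (c := innerSL ℝ (E := QSpace (l + 1)))).congr_of_eventuallyEq
          (Filter.Eventually.of_forall fun z ↦
            congrFun (locBilin_const (innerSL ℝ (E := QSpace (l + 1))) (x : QSpace (l + 1))) z))
      (Filter.Eventually.of_forall fun _ _ _ ↦ rfl))

end Sphere

/-! ### The 3-Sasakian structure of the sphere -/

section SphereAlgebra

variable {l : ℕ} (a : Fin 3) (x : QSphere l) (u v : EuclideanSpace ℝ (Fin (4 * l + 3)))

theorem sphereη_φ_add_one : sphereη a x (sphereφ (a + 1) x u) = sphereη (a + 2) x u := by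
  rw [sphereη_φ, ← leftMul_add_two, sphereη_apply]

theorem sphereη_add_one_φ : sphereη (a + 1) x (sphereφ a x u) = -sphereη (a + 2) x u := by
  rw [sphereη_φ, sphereη_apply, leftMul_add_two', inner_neg_right, neg_neg]

theorem sphereη_φ_self : sphereη a x (sphereφ a x u) = 0 := by
  rw [sphereη_φ, leftMul_leftMul_self, inner_neg_right, inner_sphereD, neg_zero]

theorem sphereη_ξ_self : sphereη a x (sphereξ a x) = 1 := by
  rw [sphereη_ξ, (leftMul a).inner_map_map, inner_self_sphere]

theorem sphereη_ξ_add_one : sphereη a x (sphereξ (a + 1) x) = 0 := by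
  rw [sphereη_ξ, inner_leftMul, ← leftMul_add_two, inner_leftMul_self, neg_zero]

theorem sphereη_add_one_ξ : sphereη (a + 1) x (sphereξ a x) = 0 := by
  rw [sphereη_ξ, real_inner_comm, ← sphereη_ξ, sphereη_ξ_add_one]

theorem sphereφ_φ_self : sphereφ a x (sphereφ a x u) = -u + sphereη a x u • sphereξ a x := by
  apply sphereD_injective x
  rw [sphereD_φ, sphereη_φ_self, sphereD_φ, map_sub, map_smul, leftMul_leftMul_self, map_add,
    map_neg, map_smul, sphereD_ξ]
  module

theorem inner_sphereD_φ : ⟪sphereD x (sphereφ a x u), sphereD x (sphereφ a x v)⟫ =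
    ⟪sphereD x u, sphereD x v⟫ - sphereη a x u * sphereη a x v := by
  have h1 : ⟪leftMul a (sphereD x u), (x : QSpace (l + 1))⟫ = sphereη a x u := real_inner_comm _ _
  have h2 : ⟪(x : QSpace (l + 1)), leftMul a (sphereD x v)⟫ = sphereη a x v := rfl
  rw [sphereD_φ, sphereD_φ, inner_sub_left, inner_sub_right, inner_sub_right, inner_smul_left,
    inner_smul_right, inner_smul_left, inner_smul_right, inner_self_sphere,
    (leftMul a).inner_map_map, h1, h2]
  simp only [conj_trivial]
  ring

theorem inner_sphereD_sphereD_φ : ⟪sphereD x u, sphereD x (sphereφ a x v)⟫ =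
    ⟪sphereD x u, leftMul a (sphereD x v)⟫ := by
  rw [sphereD_φ, inner_sub_right, inner_smul_right,
    real_inner_comm (x : QSpace (l + 1)) (sphereD x u), inner_sphereD, mul_zero, sub_zero]

theorem sphereφ_add_two : sphereφ (a + 2) x u =
    sphereφ a x (sphereφ (a + 1) x u) - sphereη (a + 1) x u • sphereξ a x := by
  apply sphereD_injective x
  rw [sphereD_φ, map_sub, map_smul, sphereD_φ, sphereD_φ, sphereη_φ_add_one, sphereD_ξ,
    leftMul_add_two, map_sub, map_smul]
  module

theorem sphereφ_add_two' : sphereφ (a + 2) x u =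
    -sphereφ (a + 1) x (sphereφ a x u) + sphereη a x u • sphereξ (a + 1) x := by
  apply sphereD_injective x
  rw [sphereD_φ, map_add, map_neg, map_smul, sphereD_φ, sphereD_φ, sphereη_add_one_φ, sphereD_ξ,
    leftMul_add_two', map_sub, map_smul]
  module

theorem sphereξ_add_two : sphereξ (a + 2) x = sphereφ a x (sphereξ (a + 1) x) := by
  apply sphereD_injective x
  rw [sphereD_φ, sphereη_ξ_add_one, sphereD_ξ, sphereD_ξ, leftMul_add_two, map_neg, zero_smul,
    sub_zero]

theorem sphereξ_add_two' : sphereξ (a + 2) x = -sphereφ (a + 1) x (sphereξ a x) := by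
  apply sphereD_injective x
  rw [map_neg, sphereD_φ, sphereη_add_one_ξ, sphereD_ξ, sphereD_ξ, leftMul_add_two', map_neg,
    zero_smul, sub_zero]

end SphereAlgebra

/-- The 3-Sasakian structure of the unit sphere of `ℍ^{l+1}`. -/
def sphereStructure (l : ℕ) : AlmostContactMetric3 (𝓡 (4 * l + 3)) (QSphere l) where
  metric := sphereMetric l
  φ := sphereφ
  ξ := sphereξ
  η := sphereη
  smooth_φ := smoothEndo_sphereφ
  smooth_ξ := smoothFieldAt_sphereξ
  smooth_η := smoothOneForm_sphereη
  φ_φ_self := sphereφ_φ_self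
  η_ξ_self := sphereη_ξ_self
  compatible := inner_sphereD_φ
  φ_eq := sphereφ_add_two
  φ_eq' := sphereφ_add_two'
  ξ_eq := sphereξ_add_two
  ξ_eq' := sphereξ_add_two'
  η_eq a x u := (sphereη_φ_add_one a x u).symm
  η_eq' a x u := by
    refine Eq.trans ?_ (congrArg Neg.neg (sphereη_add_one_φ a x u)).symm
    exact (neg_neg _).symm

theorem isStandardSphereStructure (l : ℕ) : IsStandardSphereStructure (sphereStructure l) where
  metric _ _ _ := rfl
  ξ := sphereD_ξ
  φ_η a x u := by
    refine Eq.trans ?_ (congrArg (· + sphereη a x u • (x : QSpace (l + 1))) (sphereD_φ a x u)).symm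
    exact (sub_add_cancel _ _).symm

/-- The sphere is 3-Sasakian, by the formulas for hypersurfaces applied to the inclusion read in the
preferred chart. -/
theorem isThreeSasakian_sphereStructure (l : ℕ) : (sphereStructure l).IsThreeSasakian := by
  intro a
  have hη : ∀ x : QSphere l, DifferentiableAt ℝ
      (locCovector (I := 𝓡 (4 * l + 3)) (sphereη a) x) (extChartAt (𝓡 (4 * l + 3)) x x) :=
    fun x ↦ (smoothOneForm_iff.1 (smoothOneForm_sphereη a) x).differentiableAt (by simp)
  have hφ : ∀ x : QSphere l, DifferentiableAt ℝ
      (locEndo (I := 𝓡 (4 * l + 3)) (sphereφ a) x) (extChartAt (𝓡 (4 * l + 3)) x x) :=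
    fun x ↦ (smoothEndo_iff.1 (smoothEndo_sphereφ a) x).differentiableAt (by simp)
  constructor
  · rw [AlmostContactMetric.isNormal_iff]
    intro x u v
    have h1 := ((sphereStructure l).component a).dη_apply x ![u, v]
    have h2 := fderiv_nijTensor_hypersurface (J := (leftMul a).toContinuousLinearMap)
      (contDiffAt_sphereRep x) (hφ x) (hη x) (leftMul_leftMul_self a)
      (eventually_fderiv_sphereRep_locEndo a x) (inner_leftMul_self a _)
      (fun v ↦ by rw [sphereRep_self, fderiv_sphereRep]; exact inner_sphereD x v)
      (by rw [sphereRep_self]; exact ne_zero_of_mem_unit_sphere x) u v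
    rw [fderiv_sphereRep, sphereRep_self] at h2
    -- under the injective differential of the inclusion, the Nijenhuis tensor becomes `dη ⊗ J N`
    -- and `dη ⊗ ξ` becomes `-dη ⊗ J N`
    apply sphereD_injective x
    refine (map_add (sphereD x) _ _).trans ?_
    refine Eq.trans ?_ (map_zero (sphereD x)).symm
    refine (congrArg₂ (· + ·) h2 (map_smul (sphereD x) _ _)).trans ?_
    refine (congrArg₂ (fun c w ↦ _ + c • w) h1 (sphereD_ξ a x)).trans ?_
    rw [smul_neg]
    exact add_neg_cancel _
  · intro x
    ext w
    have h1 := ((sphereStructure l).component a).dη_apply x w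
    have h2 := fderiv_contactForm (J := (leftMul a).toContinuousLinearMap)
      (contDiffAt_sphereRep x) (hη x) (inner_leftMul a)
      ((eventually_locCovector_sphereη a x).mono fun z hz v ↦
        (hz v).trans (real_inner_comm _ _)) (w 0) (w 1)
    refine h1.trans (h2.trans ?_)
    rw [fderiv_sphereRep]
    refine congrArg (2 * ·) ?_
    exact (inner_sphereD_sphereD_φ a x (w 0) (w 1)).symm

/-! ### The action on the sphere, and its topology -/

section SphereAction

variable {l : ℕ} (a : Z4)

theorem contMDiff_smul_sphere :
    ContMDiff (𝓡 (4 * l + 3)) (𝓡 (4 * l + 3)) ∞ (fun x : QSphere l ↦ a • x) := by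
  have h : ContMDiff (𝓡 (4 * l + 3)) 𝓘(ℝ, QSpace (l + 1)) ∞
      (fun x : QSphere l ↦ rightMul a (x : QSpace (l + 1))) :=
    (rightMul a).contDiff.contMDiff.comp contMDiffAt_sphereInclusion
  exact h.codRestrict_sphere fun x ↦ (a • x).2

theorem sphereD_mfderiv_smul (x : QSphere l) (u : EuclideanSpace ℝ (Fin (4 * l + 3))) :
    sphereD (a • x) (mfderiv (𝓡 (4 * l + 3)) (𝓡 (4 * l + 3)) (fun x : QSphere l ↦ a • x) x u) =
      rightMul a (sphereD x u) := by
  have h1 := mfderiv_comp_apply (I := 𝓡 (4 * l + 3)) (I' := 𝓡 (4 * l + 3))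
    (I'' := 𝓘(ℝ, QSpace (l + 1))) (g := fun y : QSphere l ↦ (y : QSpace (l + 1)))
    (f := fun x : QSphere l ↦ a • x) x
    ((contMDiffAt_sphereInclusion (a • x)).mdifferentiableAt (by simp))
    ((contMDiff_smul_sphere a x).mdifferentiableAt (by simp)) u
  have h2 := mfderiv_comp_apply (I := 𝓡 (4 * l + 3)) (I' := 𝓘(ℝ, QSpace (l + 1)))
    (I'' := 𝓘(ℝ, QSpace (l + 1))) (g := rightMul a)
    (f := fun y : QSphere l ↦ (y : QSpace (l + 1))) x
    (rightMul a).toContinuousLinearMap.differentiableAt.mdifferentiableAt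
    ((contMDiffAt_sphereInclusion x).mdifferentiableAt (by simp)) u
  refine h1.symm.trans (h2.trans ?_)
  rw [mfderiv_eq_fderiv]
  exact DFunLike.congr_fun (rightMul a).toContinuousLinearMap.fderiv (sphereD x u)

theorem sphereD_φ_smul (b : Fin 3) (x : QSphere l) (u v : EuclideanSpace ℝ (Fin (4 * l + 3)))
    (h : sphereD (a • x) v = rightMul a (sphereD x u)) :
    sphereD (a • x) (sphereφ b (a • x) v) = rightMul a (sphereD x (sphereφ b x u)) := by
  have hJ : ∀ v : QSpace (l + 1), rightMul a (leftMul b v) = leftMul b (rightMul a v) :=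
    z4_smul_imUnit_smul a b
  have hx : ((a • x : QSphere l) : QSpace (l + 1)) = rightMul a x := rfl
  rw [sphereD_φ, sphereD_φ, sphereη_apply, h, hx, ← hJ, (rightMul a).inner_map_map, map_sub,
    map_smul, sphereη_apply]

/-- Right multiplication by powers of `i` commutes with left multiplication, hence preserves the
structure of the sphere. -/
theorem isStructureMap_smul_sphere :
    (sphereStructure l).IsStructureMap (sphereStructure l) (fun x ↦ a • x) := by
  have hJ : ∀ (b : Fin 3) (v : QSpace (l + 1)),
      rightMul a (leftMul b v) = leftMul b (rightMul a v) := z4_smul_imUnit_smul a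
  have hD := sphereD_mfderiv_smul (l := l) a
  have hx : ∀ x : QSphere l, ((a • x : QSphere l) : QSpace (l + 1)) = rightMul a x := fun _ ↦ rfl
  refine ⟨contMDiff_smul_sphere a, fun x u v ↦ ?_, fun b x u ↦ ?_, fun b x ↦ ?_⟩
  · change ⟪sphereD (a • x) _, sphereD (a • x) _⟫ = ⟪sphereD x u, sphereD x v⟫
    exact (congrArg₂ _ (hD x u) (hD x v)).trans ((rightMul a).inner_map_map _ _)
  · apply sphereD_injective (a • x)
    refine (hD x _).trans (Eq.symm ?_)
    exact sphereD_φ_smul a b x u _ (hD x u)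
  · apply sphereD_injective (a • x)
    refine (hD x _).trans (Eq.trans ?_ (sphereD_ξ b (a • x)).symm)
    refine (congrArg (rightMul a) (sphereD_ξ b x)).trans ?_
    rw [map_neg, hJ, hx]

end SphereAction

section SphereTopology

variable (l : ℕ)

instance connectedSpace_qSphere : ConnectedSpace (QSphere l) := by
  have h : IsConnected (Metric.sphere (0 : QSpace (l + 1)) 1) := by
    refine isConnected_sphere ?_ 0 zero_le_one
    rw [← Module.finrank_eq_rank, finrank_qSpace]
    exact_mod_cast (by omega : 1 < 4 * (l + 1))
  exact isConnected_iff_connectedSpace.1 h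

instance compactSpace_qSphere : CompactSpace (QSphere l) := by
  have : ProperSpace (QSpace (l + 1)) := FiniteDimensional.proper ℝ _
  exact isCompact_iff_compactSpace.1 (isCompact_sphere _ _)

end SphereTopology

end ThreeQuasiSasakian

end

theorem mainTheorem2 :
    -- the general construction
    (∀ (l m : ℕ)
      (E' : Type*) [NormedAddCommGroup E'] [NormedSpace ℝ E'] [FiniteDimensional ℝ E']
      (M' : Type*) [TopologicalSpace M'] [T2Space M'] [SecondCountableTopology M']
      [ConnectedSpace M'] [ChartedSpace E' M'] [IsManifold 𝓘(ℝ, E') ∞ M']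
      (E'' : Type*) [NormedAddCommGroup E''] [NormedSpace ℝ E''] [FiniteDimensional ℝ E'']
      (M'' : Type*) [TopologicalSpace M''] [T2Space M''] [SecondCountableTopology M'']
      [ConnectedSpace M''] [ChartedSpace E'' M''] [IsManifold 𝓘(ℝ, E'') ∞ M'']
      (S' : ThreeQuasiSasakian.AlmostContactMetric3 𝓘(ℝ, E') M')
      (K : ThreeQuasiSasakian.AlmostHyperHermitian 𝓘(ℝ, E'') M''),
      Module.finrank ℝ E' = 4 * l + 3 → Module.finrank ℝ E'' = 4 * m →
      S'.IsThreeSasakian → K.IsHyperKahler →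
      ∃ S : ThreeQuasiSasakian.AlmostContactMetric3 (𝓘(ℝ, E').prod 𝓘(ℝ, E'')) (M' × M''),
        ThreeQuasiSasakian.IsProductStructure S' K S ∧
        S.IsThreeQuasiSasakian ∧ S.HasRank (4 * l + 3) ∧
        ∀ (G : Type*) [Group G] [Finite G] [MulAction G M'] [MulAction G M''],
          (∀ a : G, S'.IsStructureMap S' (fun x ↦ a • x)) →
          (∀ a : G, K.IsStructureMap K (fun x ↦ a • x)) →
          (∀ (a : G) (p : M' × M''), a • p = p → a = 1) →
          (∀ a : G, S.IsStructureMap S (fun p ↦ a • p)) ∧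
          ThreeQuasiSasakian.QuotientIsThreeQuasiSasakian G S (4 * l + 3)) ∧
    -- the manifolds `M_{l,m}`
    (∀ l m : ℕ,
      ∃ S' : ThreeQuasiSasakian.AlmostContactMetric3 (𝓡 (4 * l + 3)) (ThreeQuasiSasakian.QSphere l),
        ThreeQuasiSasakian.IsStandardSphereStructure S' ∧ S'.IsThreeSasakian ∧
        (∀ a : ThreeQuasiSasakian.Z4, S'.IsStructureMap S' (fun x ↦ a • x)) ∧
      ∃ (_ : IsManifold 𝓘(ℝ, ThreeQuasiSasakian.QSpace m) ∞ (ThreeQuasiSasakian.QTorus m))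
        (K : ThreeQuasiSasakian.AlmostHyperHermitian 𝓘(ℝ, ThreeQuasiSasakian.QSpace m)
          (ThreeQuasiSasakian.QTorus m)),
        ThreeQuasiSasakian.IsStandardTorusStructure K ∧ K.IsHyperKahler ∧
        (∀ a : ThreeQuasiSasakian.Z4, K.IsStructureMap K (fun x ↦ a • x)) ∧
        (∀ (a : ThreeQuasiSasakian.Z4)
          (p : ThreeQuasiSasakian.QSphere l × ThreeQuasiSasakian.QTorus m), a • p = p → a = 1) ∧
      ∃ S : ThreeQuasiSasakian.AlmostContactMetric3
          ((𝓡 (4 * l + 3)).prod 𝓘(ℝ, ThreeQuasiSasakian.QSpace m))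
          (ThreeQuasiSasakian.QSphere l × ThreeQuasiSasakian.QTorus m),
        ThreeQuasiSasakian.IsProductStructure S' K S ∧
        CompactSpace (MulAction.orbitRel.Quotient ThreeQuasiSasakian.Z4
          (ThreeQuasiSasakian.QSphere l × ThreeQuasiSasakian.QTorus m)) ∧
        ThreeQuasiSasakian.QuotientIsThreeQuasiSasakian ThreeQuasiSasakian.Z4 S (4 * l + 3)) := by
  refine ⟨?_, fun l m ↦ ?_⟩
  · intro l m E' _ _ _ M' _ _ _ _ _ _ E'' _ _ _ M'' _ _ _ _ _ _ S' K hl _ hS' hK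
    have h := ThreeQuasiSasakian.isProductStructure_prodStructure S' K
    have hr := ThreeQuasiSasakian.IsProductStructure.hasRank_of_finrank h hS' hl
    refine ⟨ThreeQuasiSasakian.prodStructure S' K, h, h.isThreeQuasiSasakian hS' hK, hr, ?_⟩
    intro G _ _ _ _ hG' hG'' hfree
    have hG := fun a : G ↦ h.isStructureMap (hG' a) (hG'' a)
    exact ⟨hG, ThreeQuasiSasakian.quotientIsThreeQuasiSasakian
      (h.isThreeQuasiSasakian hS' hK) hr hG hfree⟩
  · have hS' := ThreeQuasiSasakian.isThreeSasakian_sphereStructure l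
    have hG' := ThreeQuasiSasakian.isStructureMap_smul_sphere (l := l)
    obtain ⟨K, hKstd, hK, hG''⟩ := ThreeQuasiSasakian.exists_torusStructure m
    have h := ThreeQuasiSasakian.isProductStructure_prodStructure
      (ThreeQuasiSasakian.sphereStructure l) K
    have hr := ThreeQuasiSasakian.IsProductStructure.hasRank_of_finrank h hS'
      finrank_euclideanSpace_fin
    have hfree : ∀ (a : ThreeQuasiSasakian.Z4)
        (p : ThreeQuasiSasakian.QSphere l × ThreeQuasiSasakian.QTorus m), a • p = p → a = 1 :=
      fun a p hp ↦ ThreeQuasiSasakian.eq_one_of_smul_eq_self (congrArg Prod.fst hp)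
    exact ⟨ThreeQuasiSasakian.sphereStructure l, ThreeQuasiSasakian.isStandardSphereStructure l,
      hS', hG', inferInstance, K, hKstd, hK, hG'', hfree,
      ThreeQuasiSasakian.prodStructure (ThreeQuasiSasakian.sphereStructure l) K, h,
      Quotient.compactSpace, ThreeQuasiSasakian.quotientIsThreeQuasiSasakian
        (h.isThreeQuasiSasakian hS' hK) hr (fun a ↦ h.isStructureMap (hG' a) (hG'' a)) hfree⟩
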